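/- Let $0<p_B<p_A<1$ and $\pi=p_A-p_B$. On a probability space let $(U_n)_{n\ge1}$ be independent random variables, uniform on $[0,1]$, and let $(A_n)_{n\ge 1}$, $(B_n)_{n\ge1}$ be events with $P(A_n)=p_A$, $P(B_n)=p_B$ such that the pairs $(\mathbf 1_{A_n},\mathbf 1_{B_n})$, $n\ge1$, are independent of each other and the sequence $(\mathbf 1_{A_n},\mathbf 1_{B_n})_{n\ge1}$ is independent of $(U_n)_{n\ge1}$ ($A_n$ and $B_n$ may be dependent for the same $n$). Let $0\le\gamma_n<1$ for all $n\ge1$ and, for all large enough $n$, $$\gamma_n=\Big(\frac{C}{C'+n}\Big)^{\alpha},\qquad \alpha\in(0,1],\ C,C'>0 .$$ For $x\in[0,1]$ define $X_0=x$ and $$X_{n+1}=X_n+\gamma_{n+1}\big(\mathbf 1_{\{U_{n+1}\le X_n\}\cap A_{n+1}}(1-X_n)-\mathbf 1_{\{U_{n+1}>X_n\}\cap B_{n+1}}X_n\big),$$ and write $P_x$ for probabilities when $X_0=x$. The algorithm is called fallible from $x$ if $P_x(X_n\to0)>0$ and infallible from $x$ if $P_x(X_n\to1)=1$. For a sequence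 $e_n\ge 0$ tending to $0$, say that it has rate $n^{-r}$ if $n^{r}e_n$ converges to a limit in $(0,\infty)$, and that its rate is fast if $\sum_n e_n<\infty$ and slow otherwise. Rates at $0$ refer to $e_n=X_n$ and rates at $1$ to $e_n=1-X_n$; the limits of $n^re_n$ may be random. Then: 1. If $\alpha<1$, or if $\alpha=1$ and $Cp_B>1$, the algorithm is fallible from every $x\in[0,1)$; moreover $P_x(X_n\to0)<1$ for every $x\in(0,1)$, and for every $x\in[0,1)$ the rate is fast $P_x$-almost surely on $\{X_n\to0\}$. If $\alpha=1$ and $Cp_B>1$, then for every $x\in(0,1)$ the rate is $n^{-Cp_B}$ $P_x$-almost surely on $\{X_n\to0\}$. 2. If $\alpha=1$ and $C\le 1/p_B$, the algorithm is infallible from every $x\in(0,1]$. 3. If $\alpha=1$ and $C\ge1/\pi$, then for every $x\in(0,1)$, $P_x$-almost surely on $\{X_n\to1\}$, the rate is fast and equal to $n^{-Cp_A}$. 4. If $\alpha=1$ and $1/p_A<C<1/\pi$, then for every $x\in(0,1)$, $P_x$-almost surely on $\{X_n\to1\}$, either the rate is slow and equal to $n^{-C\pi}$, or it is fast and equal to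 $n^{-Cp_A}$; each of these two alternatives occurs, together with $X_n\to1$, with positive $P_x$-probability. 5. If $\alpha=1$ and $C\le1/p_A$, the algorithm is infallible from every $x\in(0,1]$, and for every $x\in(0,1)$, $P_x$-almost surely on $\{X_n\to1\}$, the rate is slow and equal to $n^{-C\pi}$. -/

import Mathlib

open MeasureTheory ProbabilityTheory Filter Set
open scoped Topology

/-- The two-armed bandit (linear reward-inaction) recursion started from `x`. The variables
`U n`, `A n`, `B n` (for `n = 0, 1, 2, …`) are the ones used in the step from time `n` to time
`n + 1`; this step uses the reward `γ (n + 1)`, so the value `γ 0` plays no role. -/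
noncomputable def bandit {Ω : Type*} (γ : ℕ → ℝ) (U : ℕ → Ω → ℝ) (A B : ℕ → Set Ω) (x : ℝ) :
    ℕ → Ω → ℝ
  | 0 => fun _ => x
  | n + 1 => fun ω =>
      bandit γ U A B x n ω + γ (n + 1) *
        (({ω' | U n ω' ≤ bandit γ U A B x n ω'} ∩ A n).indicator
            (fun ω' => 1 - bandit γ U A B x n ω') ω
          - ({ω' | bandit γ U A B x n ω' < U n ω'} ∩ B n).indicator
            (fun ω' => bandit γ U A B x n ω') ω)

/-- The pair of indicator variables of two events. -/
noncomputable def indicatorPair {Ω : Type*} (A B : Set Ω) (ω : Ω) : ℝ × ℝ :=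
  (A.indicator (fun _ => (1 : ℝ)) ω, B.indicator (fun _ => (1 : ℝ)) ω)

/-- The event that the process converges to `l`. -/
def convergesTo {Ω : Type*} (X : ℕ → Ω → ℝ) (l : ℝ) : Set Ω :=
  {ω | Tendsto (fun n => X n ω) atTop (𝓝 l)}

/-- Fallibility: the trap `0` is reached in the limit with positive probability. -/
def IsFallible {Ω : Type*} [MeasurableSpace Ω] (P : Measure Ω) (X : ℕ → Ω → ℝ) : Prop :=
  0 < P (convergesTo X 0)

/-- Infallibility: the process converges to the target `1` with probability one. -/
def IsInfallible {Ω : Type*} [MeasurableSpace Ω] (P : Measure Ω) (X : ℕ → Ω → ℝ) : Prop :=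
  ∀ᵐ ω ∂P, ω ∈ convergesTo X 1

/-- The (nonnegative) error sequence `e` goes to zero at a fast rate: the error series converges.
A rate that is not fast is slow. -/
def IsFast (e : ℕ → ℝ) : Prop := Summable e

/-- The error sequence `e` goes to zero exactly at the rate `n ^ (-r)`:
`n ^ r * e n` has a limit in `(0, ∞)`. -/
def HasRate (e : ℕ → ℝ) (r : ℝ) : Prop :=
  ∃ L : ℝ, 0 < L ∧ Tendsto (fun n : ℕ => (n : ℝ) ^ r * e n) atTop (𝓝 L)

/-!
The process `X` and its mirror image `1 - X` obey the same recursion with the two arms exchanged,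
so everything is proved at the end point `0` of a general reinforced process `Y`
(`IsReinforced`): given the past, `Y` jumps up, `Y ↦ Y + γ (1 - Y)`, with probability `p Y`, and
down, `Y ↦ (1 - γ) Y`, with probability `q (1 - Y)`. For `X` one has `p = pA`, `q = pB`; for
`1 - X` one has `p = pB`, `q = pA`.

The almost sure statements come from one tool, a localised Robbins–Siegmund theorem
(`robbins_siegmund`) applied to well chosen functions of `Y`, together with Lévy's form of the
Borel–Cantelli lemma: `∑ Y n < ∞` if and only if upward jumps eventually stop (`ae_summable_iff`).

* Convergence to `0` or `1`: `Y` or `1 - Y` is a supermartingale whose drift is summable, while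
  `∑ γ = ∞` (`ae_tendsto_zero_or_one`).
* Fast convergence: once upward jumps have stopped, `Y n` is a constant times a product of factors
  `1 - γ` taken along the downward jumps. This product and its inverse, divided by their
  compensators, are both almost supermartingales, so that `Y n` is of exact order
  `∏ (1 - q γ)` (`ae_tendsto_fast`). For harmonic steps this is `n ^ (-C q)`, which is summable
  only if `C q > 1` (`ae_not_summable`).
* Slow convergence: let `κ = Y / γ`. If the drift of `Y` towards `0` is smaller than the relative
  decay of `γ`, then `κ` has an upward drift comparable to `Y`, so `∑ Y n < ∞` where `κ` is bounded
  (`ae_summable_of_le_step`). Where `κ` is unbounded, the supermartingale `min (1 / κ) (1 / K)`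
  (`ae_tendsto_truncated_inv`) shows that `κ` stays large and that `∑ γ ^ 2 / Y < ∞`. This makes
  the inverse of `Y n / ∏ (1 - (q - p) γ (1 - Y))` converge as well as this ratio itself, which
  therefore has a positive limit (`ae_tendsto_slow`). When `q < p` that contradicts `Y → 0`, hence
  convergence is always fast (`ae_summable_of_lt`).
* If instead `C (q - p) ≥ 1`, the ratio `κ` itself converges, while each upward jump increases it by
  almost `1`; so upward jumps stop and convergence is fast (`ae_summable_of_inc_le`).

Fast convergence has positive probability when the increments of `1 / γ` stay below `q` (that is,
`C q > 1` for harmonic steps), because near `0` the variable `exp (-K Y / γ)`, killed at the first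
upward jump after some time `N`, does not decrease in mean (`not_ae_not_summable`).
Slow convergence has positive probability when the drift is weak, because otherwise the bounded
supermartingale `Y + K min (1 / κ) (1 / K)` would tend to `1` although it may start below `1`
(`not_ae_summable`).
-/

/-! ### Almost supermartingales -/

/-- A nonnegative supermartingale converges almost surely. -/
theorem ae_exists_tendsto_of_supermartingale_nonneg {Ω : Type*} {m : MeasurableSpace Ω}
    {P : Measure Ω} [IsFiniteMeasure P] {ℱ : Filtration ℕ m} {S : ℕ → Ω → ℝ}
    (hS : Supermartingale S ℱ P) (h0 : ∀ n ω, 0 ≤ S n ω) :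
    ∀ᵐ ω ∂P, ∃ L, Tendsto (fun n => S n ω) atTop (𝓝 L) := by
  have hb : ∀ n, eLpNorm ((-S) n) 1 P ≤ (Real.toNNReal (∫ ω, S 0 ω ∂P) : NNReal) := by
    intro n
    rw [eLpNorm_one_eq_lintegral_enorm]
    have h1 : ∫⁻ ω, ‖(-S) n ω‖ₑ ∂P = ENNReal.ofReal (∫ ω, S n ω ∂P) := by
      rw [ofReal_integral_eq_lintegral_ofReal (hS.integrable n) (ae_of_all _ (h0 n))]
      refine lintegral_congr fun ω => ?_
      simp [Real.enorm_eq_ofReal (h0 n ω)]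
    rw [h1]
    refine ENNReal.ofReal_le_ofReal ?_
    simpa using hS.setIntegral_le (Nat.zero_le n) MeasurableSet.univ
  filter_upwards [hS.neg.exists_ae_tendsto_of_bdd hb] with ω ⟨c, hc⟩
  exact ⟨-c, by simpa using hc.neg⟩

/-- Weights that discount the growth factors `1 + a k` and vanish once `G` has been left. -/
noncomputable def discount {Ω : Type*} (a : ℕ → Ω → ℝ) (G : ℕ → Set Ω) (n : ℕ) (ω : Ω) : ℝ :=
  ∏ k ∈ Finset.range n, (G k).indicator (fun ω => (1 + a k ω)⁻¹) ω

theorem discount_succ {Ω : Type*} (a : ℕ → Ω → ℝ) (G : ℕ → Set Ω) (n : ℕ) (ω : Ω) :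
    discount a G (n + 1) ω
      = discount a G n ω * (G n).indicator (fun ω => (1 + a n ω)⁻¹) ω := by
  simp [discount, Finset.prod_range_succ]

theorem discount_mem_Icc {Ω : Type*} {a : ℕ → Ω → ℝ} (G : ℕ → Set Ω) (ha : ∀ n ω, 0 ≤ a n ω)
    (n : ℕ) (ω : Ω) : discount a G n ω ∈ Icc (0 : ℝ) 1 := by
  have h : ∀ k, (G k).indicator (fun ω => (1 + a k ω)⁻¹) ω ∈ Icc (0 : ℝ) 1 := by
    intro k
    have := ha k ω
    by_cases hk : ω ∈ G k
    · rw [indicator_of_mem hk]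
      exact ⟨by positivity, inv_le_one_of_one_le₀ (by linarith)⟩
    · rw [indicator_of_notMem hk]; simp
  exact ⟨Finset.prod_nonneg fun k _ => (h k).1,
    Finset.prod_le_one (fun k _ => (h k).1) fun k _ => (h k).2⟩

/-- A form of the Robbins–Siegmund theorem: if `E[V (n+1) | ℱ n] ≤ (1 + a n) V n - b n` on `G n`,
then on the event that all `G n` hold and `∑ a n < ∞`, the sequence `V n` converges and
`∑ b n < ∞`. -/
theorem robbins_siegmund_aux {Ω : Type*} {m : MeasurableSpace Ω} {P : Measure Ω}
    [IsFiniteMeasure P] {ℱ : Filtration ℕ m} {V a b : ℕ → Ω → ℝ} {G : ℕ → Set Ω}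
    (hV0 : ∀ n ω, 0 ≤ V n ω) (ha0 : ∀ n ω, 0 ≤ a n ω) (hb0 : ∀ n ω, 0 ≤ b n ω)
    (hVm : ∀ n, StronglyMeasurable[ℱ n] (V n)) (ham : ∀ n, StronglyMeasurable[ℱ n] (a n))
    (hbm : ∀ n, StronglyMeasurable[ℱ n] (b n)) (hG : ∀ n, MeasurableSet[ℱ n] (G n))
    (hVi : ∀ n, Integrable (V n) P) (hbi : ∀ n, Integrable (b n) P)
    (h : ∀ n, ∀ᵐ ω ∂P, ω ∈ G n → P[V (n + 1) | ℱ n] ω ≤ (1 + a n ω) * V n ω - b n ω) :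
    ∀ᵐ ω ∂P, (∀ n, ω ∈ G n) → Summable (fun n => a n ω) →
      (∃ L, Tendsto (fun n => V n ω) atTop (𝓝 L)) ∧ Summable (fun n => b n ω) := by
  set w := discount a G with hw
  have hw01 : ∀ n ω, w n ω ∈ Icc (0 : ℝ) 1 := discount_mem_Icc G ha0
  have hwm : ∀ n, StronglyMeasurable[ℱ n] (w (n + 1)) := by
    intro n
    refine Measurable.stronglyMeasurable ?_
    refine Finset.measurable_prod _ fun k hk => ?_
    have hkn : k ≤ n := by simpa [Nat.lt_succ_iff] using hk
    refine Measurable.indicator ?_ (ℱ.mono hkn _ (hG k))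
    exact (((ham k).measurable.mono (ℱ.mono hkn) le_rfl).const_add 1).inv
  have hwm' : ∀ n, StronglyMeasurable[ℱ n] (w n) := by
    intro n
    cases n with
    | zero =>
      have h0 : w 0 = fun _ => (1 : ℝ) := by funext ω; simp [hw, discount]
      rw [h0]; exact stronglyMeasurable_const
    | succ n => exact (hwm n).mono (ℱ.mono (Nat.le_succ n))
  have hwi : ∀ n (f : Ω → ℝ), Integrable f P → Integrable (w n * f) P := by
    intro n f hf
    refine hf.bdd_mul (c := 1) ((hwm' n).mono (ℱ.le n)).aestronglyMeasurable ?_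
    refine ae_of_all _ fun ω => ?_
    rw [Real.norm_eq_abs, abs_of_nonneg (hw01 n ω).1]
    exact (hw01 n ω).2
  set S : ℕ → Ω → ℝ := fun n => w n * V n + ∑ k ∈ Finset.range n, w (k + 1) * b k with hS
  have hTm : ∀ n, StronglyMeasurable[ℱ n] (∑ k ∈ Finset.range (n + 1), w (k + 1) * b k) := by
    intro n
    refine Finset.stronglyMeasurable_sum _ fun k hk => ?_
    have hkn : k ≤ n := by simpa [Nat.lt_succ_iff] using hk
    exact ((hwm k).mul (hbm k)).mono (ℱ.mono hkn)
  have hTi : ∀ n, Integrable (∑ k ∈ Finset.range n, w (k + 1) * b k) P :=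
    fun n => integrable_finsetSum' _ fun k _ => hwi _ _ (hbi k)
  have hSS : Supermartingale S ℱ P := by
    refine supermartingale_nat (fun n => ?_) (fun n => (hwi n _ (hVi n)).add (hTi n)) fun n => ?_
    · refine ((hwm' n).mul (hVm n)).add ?_
      cases n with
      | zero => simpa using stronglyMeasurable_zero
      | succ n => exact (hTm n).mono (ℱ.mono (Nat.le_succ n))
    · have h1 : P[S (n + 1) | ℱ n] =ᵐ[P] w (n + 1) * P[V (n + 1) | ℱ n]
          + ∑ k ∈ Finset.range (n + 1), w (k + 1) * b k := by
        refine (condExp_add (hwi _ _ (hVi _)) (hTi _) _).trans ?_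
        refine (condExp_mul_of_stronglyMeasurable_left (hwm n) (hwi _ _ (hVi _)) (hVi _)).add ?_
        rw [condExp_of_stronglyMeasurable (ℱ.le n) (hTm n) (hTi _)]
      filter_upwards [h1, h n] with ω h1 h2
      rw [h1]
      simp only [hS, Pi.add_apply, Pi.mul_apply, Finset.sum_apply, Finset.sum_range_succ]
      suffices w (n + 1) ω * (P[V (n + 1) | ℱ n] ω + b n ω) ≤ w n ω * V n ω by linarith
      have hs := discount_succ a G n ω
      by_cases hn : ω ∈ G n
      · rw [indicator_of_mem hn] at hs
        have ha := ha0 n ω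
        calc w (n + 1) ω * (P[V (n + 1) | ℱ n] ω + b n ω)
            ≤ w (n + 1) ω * ((1 + a n ω) * V n ω) :=
              mul_le_mul_of_nonneg_left (by linarith [h2 hn]) (hw01 _ _).1
          _ = w n ω * V n ω := by
              rw [hw, hs]; field_simp
      · rw [indicator_of_notMem hn] at hs
        rw [hw, hs]
        simpa using mul_nonneg (hw01 n ω).1 (hV0 n ω)
  have hTmono : ∀ ω n, 0 ≤ w (n + 1) ω * b n ω := fun ω n => mul_nonneg (hw01 _ _).1 (hb0 _ _)
  have hS0 : ∀ n ω, 0 ≤ S n ω := by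
    intro n ω
    simp only [hS, Pi.add_apply, Pi.mul_apply, Finset.sum_apply]
    exact add_nonneg (mul_nonneg (hw01 _ _).1 (hV0 _ _)) (Finset.sum_nonneg fun k _ => hTmono ω k)
  filter_upwards [ae_exists_tendsto_of_supermartingale_nonneg hSS hS0] with ω ⟨L, hL⟩ hGω haω
  -- on this event the weights are the inverses of convergent partial products
  have hwe : ∀ n, w n ω * ∏ k ∈ Finset.range n, (1 + a k ω) = 1 := by
    intro n
    simp only [hw, discount]
    rw [← Finset.prod_mul_distrib]
    refine Finset.prod_eq_one fun k _ => ?_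
    have := ha0 k ω
    rw [indicator_of_mem (hGω k)]; field_simp
  have hprod : Tendsto (fun n => ∏ k ∈ Finset.range n, (1 + a k ω)) atTop
      (𝓝 (∏' k, (1 + a k ω))) :=
    (Real.multipliable_one_add_of_summable haω).hasProd.tendsto_prod_nat
  have hbd : ∃ B, ∀ n, ∏ k ∈ Finset.range n, (1 + a k ω) ≤ B := by
    obtain ⟨B, hB⟩ := hprod.bddAbove_range
    exact ⟨B, fun n => hB ⟨n, rfl⟩⟩
  obtain ⟨B, hB⟩ := hbd
  obtain ⟨R, hR⟩ := hL.bddAbove_range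
  have hR : ∀ n, S n ω ≤ R := fun n => hR ⟨n, rfl⟩
  have hwb : Summable fun k => w (k + 1) ω * b k ω := by
    refine summable_of_sum_range_le (c := R) (hTmono ω) fun n => ?_
    refine le_trans ?_ (hR n)
    simp only [hS, Pi.add_apply, Pi.mul_apply, Finset.sum_apply]
    linarith [mul_nonneg (hw01 n ω).1 (hV0 n ω)]
  have hwV : Tendsto (fun n => w n ω * V n ω) atTop
      (𝓝 (L - ∑' k, w (k + 1) ω * b k ω)) := by
    refine (hL.sub hwb.hasSum.tendsto_sum_nat).congr fun n => ?_
    simp [hS]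
  refine ⟨⟨_, (hprod.mul hwV).congr fun n => ?_⟩, ?_⟩
  · rw [← mul_assoc, mul_comm (∏ k ∈ Finset.range n, (1 + a k ω)), hwe, one_mul]
  · refine Summable.of_nonneg_of_le (fun n => hb0 n ω) (fun n => ?_) (hwb.mul_left B)
    have h1 := hwe (n + 1)
    calc b n ω = (∏ k ∈ Finset.range (n + 1), (1 + a k ω)) * (w (n + 1) ω * b n ω) := by
          rw [← mul_assoc, mul_comm (∏ k ∈ Finset.range (n + 1), (1 + a k ω)), h1, one_mul]
      _ ≤ B * (w (n + 1) ω * b n ω) := mul_le_mul_of_nonneg_right (hB _) (hTmono ω n)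

/-- The Robbins–Siegmund theorem, localised to the event that `G n` holds for all large `n`. -/
theorem robbins_siegmund {Ω : Type*} {m : MeasurableSpace Ω} {P : Measure Ω}
    [IsFiniteMeasure P] {ℱ : Filtration ℕ m} {V a b : ℕ → Ω → ℝ} {G : ℕ → Set Ω}
    (hV0 : ∀ n ω, 0 ≤ V n ω) (ha0 : ∀ n ω, 0 ≤ a n ω) (hb0 : ∀ n ω, 0 ≤ b n ω)
    (hVm : ∀ n, StronglyMeasurable[ℱ n] (V n)) (ham : ∀ n, StronglyMeasurable[ℱ n] (a n))
    (hbm : ∀ n, StronglyMeasurable[ℱ n] (b n)) (hG : ∀ n, MeasurableSet[ℱ n] (G n))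
    (hVi : ∀ n, Integrable (V n) P) (hbi : ∀ n, Integrable (b n) P)
    (h : ∀ᶠ n in atTop, ∀ᵐ ω ∂P, ω ∈ G n →
      P[V (n + 1) | ℱ n] ω ≤ (1 + a n ω) * V n ω - b n ω) :
    ∀ᵐ ω ∂P, (∀ᶠ n in atTop, ω ∈ G n) → Summable (fun n => a n ω) →
      (∃ L, Tendsto (fun n => V n ω) atTop (𝓝 L)) ∧ Summable (fun n => b n ω) := by
  obtain ⟨N, hN⟩ := eventually_atTop.1 h
  have key : ∀ M, N ≤ M → ∀ᵐ ω ∂P, (∀ n, ω ∈ G (n + M)) → Summable (fun n => a (n + M) ω) →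
      (∃ L, Tendsto (fun n => V (n + M) ω) atTop (𝓝 L)) ∧ Summable (fun n => b (n + M) ω) := by
    intro M hM
    let ℱ' : Filtration ℕ m :=
      ⟨fun n => ℱ (n + M), fun i j hij => ℱ.mono (by omega), fun n => ℱ.le _⟩
    refine robbins_siegmund_aux (ℱ := ℱ') (V := fun n => V (n + M)) (a := fun n => a (n + M))
      (b := fun n => b (n + M)) (G := fun n => G (n + M)) (fun _ => hV0 _) (fun _ => ha0 _)
      (fun _ => hb0 _) (fun _ => hVm _) (fun _ => ham _) (fun _ => hbm _) (fun _ => hG _)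
      (fun _ => hVi _) (fun _ => hbi _) fun n => ?_
    have := hN (n + M) (by omega)
    rw [show n + M + 1 = n + 1 + M by ring] at this
    exact this
  have key' : ∀ᵐ ω ∂P, ∀ M, N ≤ M → (∀ n, ω ∈ G (n + M)) → Summable (fun n => a (n + M) ω) →
      (∃ L, Tendsto (fun n => V (n + M) ω) atTop (𝓝 L)) ∧ Summable (fun n => b (n + M) ω) := by
    rw [ae_all_iff]; intro M
    by_cases hM : N ≤ M
    · filter_upwards [key M hM] with ω hω _ using hω
    · exact ae_of_all _ fun ω h => absurd h hM
  filter_upwards [key'] with ω hω hGω haω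
  obtain ⟨M, hM⟩ := eventually_atTop.1 hGω
  obtain ⟨⟨L, hL⟩, hb⟩ := hω (max N M) (le_max_left _ _)
    (fun n => hM _ (le_trans (le_max_right N M) (Nat.le_add_left _ _)))
    ((summable_nat_add_iff _).2 haω)
  exact ⟨⟨L, (tendsto_add_atTop_iff_nat _).1 hL⟩, (summable_nat_add_iff _).1 hb⟩

/-! ### Bounded measurable functions -/

/-- Real functions that are bounded and measurable with respect to a given `σ`-algebra. -/
def IsBddMeas {Ω : Type*} (m : MeasurableSpace Ω) (f : Ω → ℝ) : Prop :=
  Measurable[m] f ∧ ∃ C, ∀ ω, |f ω| ≤ C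

namespace IsBddMeas

variable {Ω : Type*} {m m' : MeasurableSpace Ω} {f g : Ω → ℝ}

theorem const (c : ℝ) : IsBddMeas m (fun _ => c) := ⟨measurable_const, |c|, fun _ => le_rfl⟩

theorem mono (hm : m ≤ m') (hf : IsBddMeas m f) : IsBddMeas m' f := ⟨hf.1.mono hm le_rfl, hf.2⟩

theorem add (hf : IsBddMeas m f) (hg : IsBddMeas m g) : IsBddMeas m (fun ω => f ω + g ω) := by
  obtain ⟨hf, C, hC⟩ := hf
  obtain ⟨hg, D, hD⟩ := hg
  exact ⟨hf.add hg, C + D, fun ω => (abs_add_le _ _).trans (add_le_add (hC ω) (hD ω))⟩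

theorem mul (hf : IsBddMeas m f) (hg : IsBddMeas m g) : IsBddMeas m (fun ω => f ω * g ω) := by
  obtain ⟨hf, C, hC⟩ := hf
  obtain ⟨hg, D, hD⟩ := hg
  refine ⟨hf.mul hg, C * D, fun ω => ?_⟩
  rw [abs_mul]
  exact mul_le_mul (hC ω) (hD ω) (abs_nonneg _) ((abs_nonneg _).trans (hC ω))

theorem neg (hf : IsBddMeas m f) : IsBddMeas m (fun ω => -f ω) := by
  simpa using (const (-1)).mul hf

theorem sub (hf : IsBddMeas m f) (hg : IsBddMeas m g) : IsBddMeas m (fun ω => f ω - g ω) := by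
  simpa [sub_eq_add_neg] using hf.add hg.neg

theorem max (hf : IsBddMeas m f) (hg : IsBddMeas m g) : IsBddMeas m (fun ω => f ω ⊔ g ω) := by
  obtain ⟨hf, C, hC⟩ := hf
  obtain ⟨hg, D, hD⟩ := hg
  exact ⟨hf.max hg, C ⊔ D, fun ω => abs_max_le_max_abs_abs.trans (max_le_max (hC ω) (hD ω))⟩

theorem min (hf : IsBddMeas m f) (hg : IsBddMeas m g) : IsBddMeas m (fun ω => f ω ⊓ g ω) := by
  have := (hf.neg.max hg.neg).neg
  simpa [max_neg_neg] using this

theorem inv {c : ℝ} (hc : 0 < c) (hf : IsBddMeas m f) (h : ∀ ω, c ≤ f ω) :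
    IsBddMeas m (fun ω => (f ω)⁻¹) := by
  refine ⟨hf.1.inv, c⁻¹, fun ω => ?_⟩
  have := hc.trans_le (h ω)
  rw [abs_of_nonneg (by positivity)]
  exact inv_anti₀ hc (h ω)

theorem indicator {s : Set Ω} (hs : MeasurableSet[m] s) (hf : IsBddMeas m f) :
    IsBddMeas m (s.indicator f) := by
  obtain ⟨hf, C, hC⟩ := hf
  refine ⟨hf.indicator hs, C, fun ω => ?_⟩
  by_cases h : ω ∈ s
  · rw [indicator_of_mem h]; exact hC ω
  · rw [indicator_of_notMem h, abs_zero]; exact (abs_nonneg _).trans (hC ω)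

theorem measurableSet_le (hf : IsBddMeas m f) (hg : IsBddMeas m g) :
    MeasurableSet[m] {ω | f ω ≤ g ω} :=
  _root_.measurableSet_le hf.1 hg.1

theorem prod {f : ℕ → Ω → ℝ} (n : ℕ) (hf : ∀ k < n, IsBddMeas m (f k)) :
    IsBddMeas m (fun ω => ∏ k ∈ Finset.range n, f k ω) := by
  induction n with
  | zero => simpa using const 1
  | succ n ih =>
    simp only [Finset.prod_range_succ]
    exact (ih fun k hk => hf k (by omega)).mul (hf n (by omega))

theorem integrable (hm : m ≤ m') {P : Measure[m'] Ω}
    [IsFiniteMeasure P] (hf : IsBddMeas m f) : Integrable f P := by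
  obtain ⟨hf, C, hC⟩ := hf
  exact Integrable.of_bound (hf.mono hm le_rfl).aestronglyMeasurable C (ae_of_all _ hC)

end IsBddMeas

/-! ### The reinforced process -/

/-- The law of the two-armed bandit recursion, seen from one of its end points. At step `n` the
process `Y` with values in `[0, 1]` moves towards `1` on `E n`, towards `0` on `F n`, and stays
put otherwise; given the past, these events have probability `p * Y n` and `q * (1 - Y n)`.
Exchanging `(E, p)` with `(F, q)` turns `Y` into `1 - Y`. -/
structure IsReinforced {Ω : Type*} {m : MeasurableSpace Ω} (P : Measure Ω) (ℱ : Filtration ℕ m)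
    (p q y : ℝ) (γ : ℕ → ℝ) (E F : ℕ → Set Ω) (Y : ℕ → Ω → ℝ) : Prop where
  p_mem : p ∈ Ioo (0 : ℝ) 1
  q_mem : q ∈ Ioo (0 : ℝ) 1
  y_mem : y ∈ Icc (0 : ℝ) 1
  γ_nonneg : ∀ n, 0 ≤ γ (n + 1)
  γ_lt_one : ∀ n, γ (n + 1) < 1
  zero : ∀ ω, Y 0 ω = y
  step_E : ∀ n ω, ω ∈ E n → Y (n + 1) ω = Y n ω + γ (n + 1) * (1 - Y n ω)
  step_F : ∀ n ω, ω ∈ F n → Y (n + 1) ω = (1 - γ (n + 1)) * Y n ω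
  step_else : ∀ n ω, ω ∉ E n → ω ∉ F n → Y (n + 1) ω = Y n ω
  disj : ∀ n, Disjoint (E n) (F n)
  measE : ∀ n, MeasurableSet[ℱ (n + 1)] (E n)
  measF : ∀ n, MeasurableSet[ℱ (n + 1)] (F n)
  condE : ∀ n, P[(E n).indicator (1 : Ω → ℝ) | ℱ n] =ᵐ[P] fun ω => p * Y n ω
  condF : ∀ n, P[(F n).indicator (1 : Ω → ℝ) | ℱ n] =ᵐ[P] fun ω => q * (1 - Y n ω)

namespace IsReinforced

variable {Ω : Type*} {m : MeasurableSpace Ω} {P : Measure Ω} {ℱ : Filtration ℕ m}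
  {p q y : ℝ} {γ : ℕ → ℝ} {E F : ℕ → Set Ω} {Y : ℕ → Ω → ℝ}

theorem mem_Icc (h : IsReinforced P ℱ p q y γ E F Y) (n : ℕ) (ω : Ω) : Y n ω ∈ Icc (0 : ℝ) 1 := by
  induction n with
  | zero => rw [h.zero]; exact h.y_mem
  | succ n ih =>
    have h0 := h.γ_nonneg n
    have h1 := h.γ_lt_one n
    by_cases hE : ω ∈ E n
    · rw [h.step_E n ω hE]; constructor <;> nlinarith [ih.1, ih.2]
    by_cases hF : ω ∈ F n
    · rw [h.step_F n ω hF]; constructor <;> nlinarith [ih.1, ih.2]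
    rwa [h.step_else n ω hE hF]

theorem nonneg (h : IsReinforced P ℱ p q y γ E F Y) (n : ℕ) (ω : Ω) : 0 ≤ Y n ω := (h.mem_Icc n ω).1

theorem le_one (h : IsReinforced P ℱ p q y γ E F Y) (n : ℕ) (ω : Ω) : Y n ω ≤ 1 := (h.mem_Icc n ω).2

theorem step_le (h : IsReinforced P ℱ p q y γ E F Y) (n : ℕ) (ω : Ω) :
    (1 - γ (n + 1)) * Y n ω ≤ Y (n + 1) ω := by
  have h0 := h.γ_nonneg n
  have h1 := h.γ_lt_one n
  have h2 := h.mem_Icc n ω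
  by_cases hE : ω ∈ E n
  · rw [h.step_E n ω hE]; nlinarith [h2.1, h2.2]
  by_cases hF : ω ∈ F n
  · rw [h.step_F n ω hF]
  · rw [h.step_else n ω hE hF]; nlinarith [h2.1, h2.2]

/-- A positive starting point gives a positive deterministic lower bound at each time. -/
theorem exists_pos_le (h : IsReinforced P ℱ p q y γ E F Y) (hy : 0 < y) (n : ℕ) :
    ∃ c, 0 < c ∧ ∀ ω, c ≤ Y n ω := by
  induction n with
  | zero => exact ⟨y, hy, fun ω => (h.zero ω).ge⟩
  | succ n ih =>
    obtain ⟨c, hc, hcY⟩ := ih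
    have h1 := sub_pos.2 (h.γ_lt_one n)
    exact ⟨(1 - γ (n + 1)) * c, by positivity, fun ω =>
      (mul_le_mul_of_nonneg_left (hcY ω) h1.le).trans (h.step_le n ω)⟩

theorem pos (h : IsReinforced P ℱ p q y γ E F Y) (hy : 0 < y) (n : ℕ) (ω : Ω) : 0 < Y n ω := by
  obtain ⟨c, hc, hcY⟩ := h.exists_pos_le hy n
  exact hc.trans_le (hcY ω)

theorem symm [IsFiniteMeasure P] (h : IsReinforced P ℱ p q y γ E F Y) :
    IsReinforced P ℱ q p (1 - y) γ F E (fun n ω => 1 - Y n ω) where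
  p_mem := h.q_mem
  q_mem := h.p_mem
  y_mem := ⟨by linarith [h.y_mem.2], by linarith [h.y_mem.1]⟩
  γ_nonneg := h.γ_nonneg
  γ_lt_one := h.γ_lt_one
  zero ω := by rw [h.zero]
  step_E n ω hω := by rw [h.step_F n ω hω]; ring
  step_F n ω hω := by rw [h.step_E n ω hω]; ring
  step_else n ω h1 h2 := by rw [h.step_else n ω h2 h1]
  disj n := (h.disj n).symm
  measE := h.measF
  measF := h.measE
  condE := h.condF
  condF n := by simpa using h.condE n

theorem step_eq (h : IsReinforced P ℱ p q y γ E F Y) {n : ℕ} {W v0 vE vF : Ω → ℝ}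
    (hE : ∀ ω ∈ E n, W ω = vE ω) (hF : ∀ ω ∈ F n, W ω = vF ω)
    (h0 : ∀ ω, ω ∉ E n → ω ∉ F n → W ω = v0 ω) :
    W = v0 + (vE - v0) * (E n).indicator 1 + (vF - v0) * (F n).indicator 1 := by
  funext ω
  simp only [Pi.add_apply, Pi.mul_apply, Pi.sub_apply]
  by_cases h1 : ω ∈ E n
  · have h2 : ω ∉ F n := fun h2 => disjoint_left.1 (h.disj n) h1 h2
    simp [hE ω h1, h1, h2]
  by_cases h2 : ω ∈ F n
  · simp [hF ω h2, h1, h2]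
  · simp [h0 ω h1 h2, h1, h2]

theorem isBddMeas_of_step (h : IsReinforced P ℱ p q y γ E F Y) {n : ℕ} {W v0 vE vF : Ω → ℝ}
    (hE : ∀ ω ∈ E n, W ω = vE ω) (hF : ∀ ω ∈ F n, W ω = vF ω)
    (h0 : ∀ ω, ω ∉ E n → ω ∉ F n → W ω = v0 ω) (hvE : IsBddMeas (ℱ n) vE)
    (hvF : IsBddMeas (ℱ n) vF) (hv0 : IsBddMeas (ℱ n) v0) : IsBddMeas (ℱ (n + 1)) W := by
  have hle := ℱ.mono (Nat.le_succ n)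
  rw [h.step_eq hE hF h0]
  exact ((hv0.mono hle).add (((hvE.sub hv0).mono hle).mul ((IsBddMeas.const 1).indicator
    (h.measE n)))).add (((hvF.sub hv0).mono hle).mul ((IsBddMeas.const 1).indicator (h.measF n)))

theorem isBddMeas (h : IsReinforced P ℱ p q y γ E F Y) (n : ℕ) : IsBddMeas (ℱ n) (Y n) := by
  induction n with
  | zero =>
    have h0 : Y 0 = fun _ => y := funext h.zero
    rw [h0]; exact IsBddMeas.const y
  | succ n ih =>
    exact h.isBddMeas_of_step (h.step_E n) (h.step_F n) (h.step_else n)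
      (ih.add ((IsBddMeas.const _).mul ((IsBddMeas.const 1).sub ih)))
      ((IsBddMeas.const _).mul ih) ih

theorem isBddMeas_inv (h : IsReinforced P ℱ p q y γ E F Y) (hy : 0 < y) (n : ℕ) :
    IsBddMeas (ℱ n) (fun ω => (Y n ω)⁻¹) := by
  obtain ⟨c, hc, hcY⟩ := h.exists_pos_le hy n
  exact (h.isBddMeas n).inv hc hcY

/-- The conditional expectation of a function of the next step. -/
theorem condExp_step [IsFiniteMeasure P] (h : IsReinforced P ℱ p q y γ E F Y) {n : ℕ}
    {W v0 vE vF : Ω → ℝ}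
    (hE : ∀ ω ∈ E n, W ω = vE ω) (hF : ∀ ω ∈ F n, W ω = vF ω)
    (h0 : ∀ ω, ω ∉ E n → ω ∉ F n → W ω = v0 ω) (hvE : IsBddMeas (ℱ n) vE)
    (hvF : IsBddMeas (ℱ n) vF) (hv0 : IsBddMeas (ℱ n) v0) :
    P[W | ℱ n] =ᵐ[P] fun ω =>
      v0 ω + p * Y n ω * (vE ω - v0 ω) + q * (1 - Y n ω) * (vF ω - v0 ω) := by
  have hle := ℱ.mono (Nat.le_succ n)
  have hiE : IsBddMeas (ℱ (n + 1)) ((E n).indicator (1 : Ω → ℝ)) :=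
    (IsBddMeas.const 1).indicator (h.measE n)
  have hiF : IsBddMeas (ℱ (n + 1)) ((F n).indicator (1 : Ω → ℝ)) :=
    (IsBddMeas.const 1).indicator (h.measF n)
  have hintE : Integrable ((vE - v0) * (E n).indicator 1) P :=
    (((hvE.sub hv0).mono hle).mul hiE).integrable (P := P) (ℱ.le _)
  have hintF : Integrable ((vF - v0) * (F n).indicator 1) P :=
    (((hvF.sub hv0).mono hle).mul hiF).integrable (P := P) (ℱ.le _)
  have hint0 : Integrable v0 P := hv0.integrable (P := P) (ℱ.le _)
  rw [h.step_eq hE hF h0]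
  have e1 := condExp_add (hint0.add hintE) hintF (ℱ n)
  have e2 := condExp_add hint0 hintE (ℱ n)
  have e3 := condExp_mul_of_stronglyMeasurable_left (hvE.sub hv0).1.stronglyMeasurable hintE
    (hiE.integrable (P := P) (ℱ.le _))
  have e4 := condExp_mul_of_stronglyMeasurable_left (hvF.sub hv0).1.stronglyMeasurable hintF
    (hiF.integrable (P := P) (ℱ.le _))
  have e5 := condExp_of_stronglyMeasurable (μ := P) (ℱ.le n) hv0.1.stronglyMeasurable hint0
  filter_upwards [e1, e2, e3, e4, h.condE n, h.condF n] with ω e1 e2 e3 e4 e6 e7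
  rw [e1, Pi.add_apply, e2, Pi.add_apply, e5]
  have e3' : P[(vE - v0) * (E n).indicator 1 | ℱ n] ω = (vE ω - v0 ω) * (p * Y n ω) := by
    rw [← e6]; exact e3
  have e4' : P[(vF - v0) * (F n).indicator 1 | ℱ n] ω = (vF ω - v0 ω) * (q * (1 - Y n ω)) := by
    rw [← e7]; exact e4
  rw [e3', e4']; ring

/-- The Robbins–Siegmund theorem for functionals of a reinforced process, with the conditional
expectation made explicit. -/
theorem robbins_siegmund [IsFiniteMeasure P] (h : IsReinforced P ℱ p q y γ E F Y)
    {V a b v0 vE vF : ℕ → Ω → ℝ} {G : ℕ → Set Ω}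
    (hV0 : ∀ n ω, 0 ≤ V n ω) (ha0 : ∀ n ω, 0 ≤ a n ω) (hb0 : ∀ n ω, 0 ≤ b n ω)
    (hVm : ∀ n, IsBddMeas (ℱ n) (V n)) (ham : ∀ n, IsBddMeas (ℱ n) (a n))
    (hbm : ∀ n, IsBddMeas (ℱ n) (b n)) (hG : ∀ n, MeasurableSet[ℱ n] (G n))
    (hE : ∀ n, ∀ ω ∈ E n, V (n + 1) ω = vE n ω) (hF : ∀ n, ∀ ω ∈ F n, V (n + 1) ω = vF n ω)
    (h0 : ∀ n ω, ω ∉ E n → ω ∉ F n → V (n + 1) ω = v0 n ω) (hvE : ∀ n, IsBddMeas (ℱ n) (vE n))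
    (hvF : ∀ n, IsBddMeas (ℱ n) (vF n)) (hv0 : ∀ n, IsBddMeas (ℱ n) (v0 n))
    (hle : ∀ᶠ n in atTop, ∀ ω, ω ∈ G n →
      v0 n ω + p * Y n ω * (vE n ω - v0 n ω) + q * (1 - Y n ω) * (vF n ω - v0 n ω)
        ≤ (1 + a n ω) * V n ω - b n ω) :
    ∀ᵐ ω ∂P, (∀ᶠ n in atTop, ω ∈ G n) → Summable (fun n => a n ω) →
      (∃ L, Tendsto (fun n => V n ω) atTop (𝓝 L)) ∧ Summable (fun n => b n ω) := by
  refine _root_.robbins_siegmund (ℱ := ℱ) hV0 ha0 hb0 (fun n => (hVm n).1.stronglyMeasurable)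
    (fun n => (ham n).1.stronglyMeasurable) (fun n => (hbm n).1.stronglyMeasurable) hG
    (fun n => (hVm n).integrable (P := P) (ℱ.le n))
    (fun n => (hbm n).integrable (P := P) (ℱ.le n)) ?_
  filter_upwards [hle] with n hn
  filter_upwards [h.condExp_step (hE n) (hF n) (h0 n) (hvE n) (hvF n) (hv0 n)] with ω hω hGω
  rw [hω]; exact hn ω hGω

/-- Lévy's extension of the Borel–Cantelli lemma: `∑ Y n < ∞` exactly when only finitely many
moves towards `1` occur. -/
theorem ae_summable_iff [IsFiniteMeasure P] (h : IsReinforced P ℱ p q y γ E F Y) :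
    ∀ᵐ ω ∂P, (Summable fun n => Y n ω) ↔ ∀ᶠ n in atTop, ω ∉ E n := by
  set s : ℕ → Set Ω := fun n => Nat.casesOn n ∅ E with hs
  have hsm : ∀ n, MeasurableSet[ℱ n] (s n) := by
    intro n
    cases n with
    | zero => exact @MeasurableSet.empty _ (ℱ 0)
    | succ n => exact h.measE n
  filter_upwards [ae_mem_limsup_atTop_iff P hsm, ae_all_iff.2 h.condE] with ω h1 h2
  have e1 : ω ∈ limsup s atTop ↔ ∃ᶠ n in atTop, ω ∈ E n := by
    rw [← limsup_nat_add s 1, mem_limsup_iff_frequently_mem]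
  have e2 : (fun n => ∑ k ∈ Finset.range n, (P[(s (k + 1)).indicator (1 : Ω → ℝ) | ℱ k]) ω)
      = fun n => ∑ k ∈ Finset.range n, p * Y k ω := by
    funext n; exact Finset.sum_congr rfl fun k _ => h2 k
  have hp := h.p_mem.1
  rw [e1, e2, ← not_summable_iff_tendsto_nat_atTop_of_nonneg
    (fun n => mul_nonneg hp.le (h.nonneg n ω)), summable_mul_left_iff hp.ne'] at h1
  rw [← not_frequently, h1, not_not]

end IsReinforced

/-! ### Step sizes -/

/-- Step sizes that tend to `0` with divergent sum and whose inverses have increments in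
`[ρ₁, ρ₂]` from some time on. -/
structure IsStepSize (γ : ℕ → ℝ) (ρ₁ ρ₂ : ℝ) : Prop where
  pos : ∀ᶠ n in atTop, 0 < γ n
  le_inc : ∀ᶠ n in atTop, ρ₁ ≤ (γ (n + 1))⁻¹ - (γ n)⁻¹
  inc_le : ∀ᶠ n in atTop, (γ (n + 1))⁻¹ - (γ n)⁻¹ ≤ ρ₂
  tendsto : Tendsto γ atTop (𝓝 0)
  not_summable : ¬ Summable γ

namespace IsStepSize

variable {γ : ℕ → ℝ} {ρ₁ ρ₂ : ℝ}

theorem eventually_le (h : IsStepSize γ ρ₁ ρ₂) {δ : ℝ} (hδ : 0 < δ) :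
    ∀ᶠ n in atTop, γ (n + 1) ≤ δ :=
  (tendsto_add_atTop_nat 1).eventually (h.tendsto.eventually (eventually_le_nhds hδ))

theorem eventually_pos_succ (h : IsStepSize γ ρ₁ ρ₂) : ∀ᶠ n in atTop, 0 < γ (n + 1) :=
  (tendsto_add_atTop_nat 1).eventually h.pos

theorem succ_le (h : IsStepSize γ ρ₁ ρ₂) (hρ : 0 ≤ ρ₁) :
    ∀ᶠ n in atTop, γ (n + 1) * (1 + ρ₁ * γ (n + 1)) ≤ γ n := by
  filter_upwards [h.pos, h.eventually_pos_succ, h.le_inc] with n h1 h2 h3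
  have h4 : γ (n + 1) ≤ γ n := by
    rw [← inv_le_inv₀ h1 h2]; linarith
  have h5 : ρ₁ * (γ n * γ (n + 1)) ≤ γ n - γ (n + 1) := by
    have : ((γ (n + 1))⁻¹ - (γ n)⁻¹) * (γ n * γ (n + 1)) = γ n - γ (n + 1) := by field_simp
    rw [← this]; gcongr
  have h6 : ρ₁ * (γ (n + 1) * γ (n + 1)) ≤ ρ₁ * (γ n * γ (n + 1)) := by gcongr
  linarith

theorem le_two_mul_succ (h : IsStepSize γ ρ₁ ρ₂) (hρ : 0 ≤ ρ₁) :
    ∀ᶠ n in atTop, γ n ≤ 2 * γ (n + 1) := by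
  have hδ : (0 : ℝ) < 1 / (|ρ₂| + 1) := by positivity
  filter_upwards [h.pos, h.eventually_pos_succ, h.inc_le, h.eventually_le hδ, h.succ_le hρ,
    h.tendsto.eventually (eventually_le_nhds hδ)] with n h1 h2 h3 h4 h5 h6
  have h7 : γ n - γ (n + 1) ≤ |ρ₂| * γ n * γ (n + 1) := by
    have : ((γ (n + 1))⁻¹ - (γ n)⁻¹) * (γ n * γ (n + 1)) = γ n - γ (n + 1) := by field_simp
    rw [← this, mul_assoc]
    have := le_abs_self ρ₂
    gcongr; linarith
  have h8 : |ρ₂| * γ n ≤ 1 := by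
    rw [le_div_iff₀ (by positivity)] at h6; nlinarith
  nlinarith

theorem not_summable_succ (h : IsStepSize γ ρ₁ ρ₂) : ¬ Summable fun n => γ (n + 1) :=
  fun hs => h.not_summable ((summable_nat_add_iff 1).1 hs)

end IsStepSize

namespace IsReinforced

variable {Ω : Type*} {m : MeasurableSpace Ω} {P : Measure Ω} {ℱ : Filtration ℕ m}
  {p q y : ℝ} {γ : ℕ → ℝ} {E F : ℕ → Set Ω} {Y : ℕ → Ω → ℝ} {ρ₁ ρ₂ : ℝ}

/-! ### Almost sure convergence to an end point -/

theorem ae_tendsto_aux [IsFiniteMeasure P] (h : IsReinforced P ℱ p q y γ E F Y) (hpq : p < q) :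
    ∀ᵐ ω ∂P, (∃ L, Tendsto (fun n => Y n ω) atTop (𝓝 L)) ∧
      Summable (fun n => γ (n + 1) * (Y n ω * (1 - Y n ω))) := by
  have hY := h.isBddMeas
  have hc := fun (n : ℕ) (c : ℝ) => IsBddMeas.const (m := ℱ n) c
  have := h.robbins_siegmund (V := Y) (a := fun _ _ => 0)
    (b := fun n ω => (q - p) * (γ (n + 1) * (Y n ω * (1 - Y n ω)))) (G := fun _ => univ)
    (v0 := Y) (vE := fun n ω => Y n ω + γ (n + 1) * (1 - Y n ω))
    (vF := fun n ω => (1 - γ (n + 1)) * Y n ω)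
    h.nonneg (fun _ _ => le_rfl)
    (fun n ω => mul_nonneg (sub_nonneg.2 hpq.le) (mul_nonneg (h.γ_nonneg n)
      (mul_nonneg (h.nonneg n ω) (sub_nonneg.2 (h.le_one n ω)))))
    hY (fun n => hc n 0)
    (fun n => (hc n _).mul ((hc n _).mul ((hY n).mul ((hc n 1).sub (hY n)))))
    (fun n => @MeasurableSet.univ _ (ℱ n)) h.step_E h.step_F h.step_else
    (fun n => (hY n).add ((hc n _).mul ((hc n 1).sub (hY n)))) (fun n => (hc n _).mul (hY n)) hY
    (Eventually.of_forall fun n ω _ => by apply le_of_eq; ring)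
  filter_upwards [this] with ω hω
  obtain ⟨h1, h2⟩ := hω (Eventually.of_forall fun _ => mem_univ _) summable_zero
  exact ⟨h1, (summable_mul_left_iff (sub_pos.2 hpq).ne').1 h2⟩

theorem ae_tendsto [IsFiniteMeasure P] (h : IsReinforced P ℱ p q y γ E F Y) (hpq : p ≠ q) :
    ∀ᵐ ω ∂P, (∃ L, Tendsto (fun n => Y n ω) atTop (𝓝 L)) ∧
      Summable (fun n => γ (n + 1) * (Y n ω * (1 - Y n ω))) := by
  rcases hpq.lt_or_gt with hlt | hlt
  · exact h.ae_tendsto_aux hlt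
  · filter_upwards [h.symm.ae_tendsto_aux hlt] with ω ⟨⟨L, hL⟩, h2⟩
    exact ⟨⟨1 - L, by simpa using hL.const_sub 1⟩, h2.congr fun n => by ring⟩

theorem ae_tendsto_zero_or_one [IsFiniteMeasure P] (h : IsReinforced P ℱ p q y γ E F Y)
    (hpq : p ≠ q) (hγ : ¬ Summable fun n => γ (n + 1)) :
    ∀ᵐ ω ∂P, Tendsto (fun n => Y n ω) atTop (𝓝 0) ∨ Tendsto (fun n => Y n ω) atTop (𝓝 1) := by
  filter_upwards [h.ae_tendsto hpq] with ω ⟨⟨L, hL⟩, hs⟩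
  have h0 : 0 ≤ L := ge_of_tendsto' hL fun n => h.nonneg n ω
  have h1 : L ≤ 1 := le_of_tendsto' hL fun n => h.le_one n ω
  rcases h0.eq_or_lt with rfl | h0
  · exact Or.inl hL
  rcases h1.eq_or_lt with rfl | h1
  · exact Or.inr hL
  exfalso
  have hlim : Tendsto (fun n => Y n ω * (1 - Y n ω)) atTop (𝓝 (L * (1 - L))) :=
    hL.mul (hL.const_sub 1)
  have hpos : 0 < L * (1 - L) := mul_pos h0 (sub_pos.2 h1)
  apply hγ
  have hev : ∀ᶠ n in atTop, L * (1 - L) / 2 ≤ Y n ω * (1 - Y n ω) :=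
    hlim.eventually (eventually_ge_nhds (by linarith))
  refine summable_of_isBigO_nat hs (Asymptotics.IsBigO.of_bound (2 / (L * (1 - L))) ?_)
  filter_upwards [hev] with n hn
  have hg := h.γ_nonneg n
  rw [Real.norm_eq_abs, Real.norm_eq_abs, abs_of_nonneg hg,
    abs_of_nonneg (mul_nonneg hg (by linarith)), div_mul_eq_mul_div, le_div_iff₀ hpos]
  nlinarith

/-- Where `Y` tends to `0`, the accumulated step sizes weighted by `Y` are finite. -/
theorem ae_summable_step_mul [IsFiniteMeasure P] (h : IsReinforced P ℱ p q y γ E F Y)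
    (hpq : p ≠ q) :
    ∀ᵐ ω ∂P, Tendsto (fun n => Y n ω) atTop (𝓝 0) → Summable (fun n => γ (n + 1) * Y n ω) := by
  filter_upwards [h.ae_tendsto hpq] with ω ⟨_, hs⟩ h0
  refine summable_of_isBigO_nat hs (Asymptotics.IsBigO.of_bound 2 ?_)
  filter_upwards [h0.eventually (eventually_le_nhds (show (0 : ℝ) < 1 / 2 by norm_num))] with n hn
  have hg := h.γ_nonneg n
  have hy := h.nonneg n ω
  rw [Real.norm_eq_abs, Real.norm_eq_abs, abs_of_nonneg (mul_nonneg hg hy),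
    abs_of_nonneg (mul_nonneg hg (mul_nonneg hy (by linarith)))]
  have := mul_nonneg hg hy
  nlinarith

/-! ### The slow regime -/

/-- On `{Y → 0}`, if `Y n = O(γ n)` then `∑ Y n < ∞`: the ratio `Y n / γ n` has an upward drift
comparable to `Y n`, which must be summable where the ratio stays bounded. -/
theorem ae_summable_of_le_step [IsFiniteMeasure P] (h : IsReinforced P ℱ p q y γ E F Y)
    (hγ : IsStepSize γ ρ₁ ρ₂) (hρ0 : 0 ≤ ρ₁) (hρ : q - p < ρ₁) {M : ℝ} (hM : 0 ≤ M) :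
    ∀ᵐ ω ∂P, Tendsto (fun n => Y n ω) atTop (𝓝 0) → (∀ᶠ n in atTop, Y n ω ≤ M * γ n) →
      Summable fun n => Y n ω := by
  have hY := h.isBddMeas
  have hc := fun (n : ℕ) (c : ℝ) => IsBddMeas.const (m := ℱ n) c
  set η := ρ₁ + p - q with hη
  have hη0 : 0 < η := by linarith
  have := h.robbins_siegmund (V := fun n ω => 0 ⊔ (2 * M + 1 - Y n ω * (γ n)⁻¹))
    (a := fun _ _ => 0)
    (b := fun n ω => η / 2 * Y n ω) (G := fun n => {ω | Y n ω ≤ M * γ n} ∩ {ω | Y n ω ≤ 1 / 2})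
    (v0 := fun n ω => 0 ⊔ (2 * M + 1 - Y n ω * (γ (n + 1))⁻¹))
    (vE := fun n ω => 0 ⊔ (2 * M + 1 - (Y n ω + γ (n + 1) * (1 - Y n ω)) * (γ (n + 1))⁻¹))
    (vF := fun n ω => 0 ⊔ (2 * M + 1 - ((1 - γ (n + 1)) * Y n ω) * (γ (n + 1))⁻¹))
    (fun _ _ => le_max_left _ _) (fun _ _ => le_rfl)
    (fun n ω => mul_nonneg (by positivity) (h.nonneg n ω))
    (fun n => (hc n 0).max ((hc n _).sub ((hY n).mul (hc n _)))) (fun n => hc n 0)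
    (fun n => (hc n _).mul (hY n))
    (fun n => ((hY n).measurableSet_le (hc n _)).inter ((hY n).measurableSet_le (hc n _)))
    (fun n ω hω => by rw [h.step_E n ω hω]) (fun n ω hω => by rw [h.step_F n ω hω])
    (fun n ω h1 h2 => by rw [h.step_else n ω h1 h2])
    (fun n => (hc n 0).max ((hc n _).sub (((hY n).add ((hc n _).mul
      ((hc n 1).sub (hY n)))).mul (hc n _))))
    (fun n => (hc n 0).max ((hc n _).sub (((hc n _).mul (hY n)).mul (hc n _))))
    (fun n => (hc n 0).max ((hc n _).sub ((hY n).mul (hc n _)))) ?_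
  · filter_upwards [this] with ω hω h0 hMω
    obtain ⟨_, h2⟩ := hω (by
      filter_upwards [hMω, h0.eventually (eventually_le_nhds (show (0 : ℝ) < 1 / 2 by norm_num))]
        with n h1 h2 using ⟨h1, h2⟩) summable_zero
    exact (summable_mul_left_iff (by positivity)).1 h2
  · -- on `G n` the next ratio is at most `2 * M + 1`, so the truncation at `0` is inactive
    filter_upwards [hγ.pos, hγ.eventually_pos_succ, hγ.le_inc, hγ.le_two_mul_succ hρ0]
      with n h1 h2 h3 h4 ω ⟨hω1, hω2⟩
    simp only [mem_ofPred_eq] at hω1 hω2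
    have hy := h.nonneg n ω
    have hinv : (Y n ω) * (γ (n + 1))⁻¹ ≤ 2 * M := by
      rw [← div_eq_mul_inv, div_le_iff₀ h2]; nlinarith
    have e1 : (Y n ω + γ (n + 1) * (1 - Y n ω)) * (γ (n + 1))⁻¹
        = Y n ω * (γ (n + 1))⁻¹ + (1 - Y n ω) := by field_simp
    have e2 : ((1 - γ (n + 1)) * Y n ω) * (γ (n + 1))⁻¹ = Y n ω * (γ (n + 1))⁻¹ - Y n ω := by
      field_simp
    rw [e1, e2, max_eq_right (by linarith), max_eq_right (by linarith), max_eq_right (by linarith)]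
    have h5 := le_max_right 0 (2 * M + 1 - Y n ω * (γ n)⁻¹)
    have h6 : ρ₁ * Y n ω ≤ ((γ (n + 1))⁻¹ - (γ n)⁻¹) * Y n ω := by gcongr
    have h7 : η / 2 * Y n ω ≤ ρ₁ * Y n ω + (p - q) * (Y n ω * (1 - Y n ω)) := by
      have : ρ₁ * Y n ω + (p - q) * (Y n ω * (1 - Y n ω))
        = η / 2 * Y n ω + η * Y n ω * (1 / 2 - Y n ω) + ρ₁ * (Y n ω * Y n ω) := by
        rw [hη]; ring
      have h8 : 0 ≤ η * Y n ω * (1 / 2 - Y n ω) :=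
        mul_nonneg (by positivity) (by linarith)
      have h9 : 0 ≤ ρ₁ * (Y n ω * Y n ω) := by positivity
      linarith
    nlinarith

/-- A bound for the conditional expectation of `1 / Y (n + 1)`: it is `1 / Y` times
`1 + t (q - p)` up to a relative error of order `g ^ 2 / Y`, where `t = g (1 - Y)`. -/
theorem inv_step_le {p q Y g : ℝ} (hp : p ∈ Ioo (0 : ℝ) 1) (hq : q ∈ Ioo (0 : ℝ) 1) (hY : 0 < Y)
    (hY1 : Y ≤ 1) (hg : 0 ≤ g) (hg2 : g ≤ 1 / 2) :
    Y⁻¹ + p * Y * ((Y + g * (1 - Y))⁻¹ - Y⁻¹) + q * (1 - Y) * (((1 - g) * Y)⁻¹ - Y⁻¹)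
      ≤ Y⁻¹ * (1 + g * (1 - Y) * (q - p + 2 * g + g * (1 - Y) * Y⁻¹)) := by
  set t := g * (1 - Y) with ht
  have ht0 : 0 ≤ t := mul_nonneg hg (by linarith)
  have h1 : (1 - g) ≠ 0 := by linarith
  have e : Y⁻¹ + p * Y * ((Y + t)⁻¹ - Y⁻¹) + q * (1 - Y) * (((1 - g) * Y)⁻¹ - Y⁻¹)
      = Y⁻¹ * (1 + t * (q / (1 - g) - p * (Y / (Y + t)))) := by
    have : Y + t ≠ 0 := by positivity
    rw [ht] at this ⊢
    field_simp
    ring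
  rw [e]
  have h2 : q / (1 - g) ≤ q + 2 * g := by
    rw [div_le_iff₀ (by linarith)]
    nlinarith [hq.1, hq.2, mul_nonneg hg hg]
  have h3 : 1 - t * Y⁻¹ ≤ Y / (Y + t) := by
    rw [le_div_iff₀ (by positivity)]
    have : (1 - t * Y⁻¹) * (Y + t) = Y - t * t * Y⁻¹ := by field_simp; ring
    rw [this]
    have : 0 ≤ t * t * Y⁻¹ := by positivity
    linarith
  have h4 : q / (1 - g) - p * (Y / (Y + t)) ≤ q - p + 2 * g + t * Y⁻¹ := by
    have h5 : p * (1 - t * Y⁻¹) ≤ p * (Y / (Y + t)) := mul_le_mul_of_nonneg_left h3 hp.1.le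
    have h6 : p * (t * Y⁻¹) ≤ 1 * (t * Y⁻¹) :=
      mul_le_mul_of_nonneg_right hp.2.le (by positivity)
    linarith
  gcongr

/-- The truncated inverse ratio `min (γ n / Y n) (1 / K)` decreases in mean, with an explicit
downward drift where `K * γ n ≤ Y n`. -/
theorem truncated_inv_step_le {p q Y g g' ρ K : ℝ} (hp : p ∈ Ioo (0 : ℝ) 1)
    (hq : q ∈ Ioo (0 : ℝ) 1) (hY : 0 < Y) (hY1 : Y ≤ 1) (hg' : 0 < g') (hρ0 : 0 ≤ ρ)
    (hη0 : 0 < ρ + p - q) (hg1 : g' * (1 + ρ * g') ≤ g) (hg2 : g ≤ 2 * g') (hK : 0 < K)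
    (hK1 : 4 / (ρ + p - q) ≤ K) (hδ : g' ≤ (ρ + p - q) / 8) (hδ' : g' ≤ 1 / 2) :
    g' * Y⁻¹ ⊓ K⁻¹ + p * Y * (g' * (Y + g' * (1 - Y))⁻¹ ⊓ K⁻¹ - g' * Y⁻¹ ⊓ K⁻¹)
        + q * (1 - Y) * (g' * ((1 - g') * Y)⁻¹ ⊓ K⁻¹ - g' * Y⁻¹ ⊓ K⁻¹)
      ≤ g * Y⁻¹ ⊓ K⁻¹
        - (if K * g ≤ Y then (ρ + p - q) / 4 * (g' * (1 - Y)) * (g * Y⁻¹) else 0) := by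
  set η := ρ + p - q with hη
  have w1 : 0 ≤ p * Y := mul_nonneg hp.1.le hY.le
  have w2 : 0 ≤ q * (1 - Y) := mul_nonneg hq.1.le (by linarith)
  have w0 : 0 ≤ 1 - p * Y - q * (1 - Y) := by nlinarith [hp.2, hq.2]
  have hmono : ∀ a b c a' b' c' : ℝ, a ≤ a' → b ≤ b' → c ≤ c' →
      a + p * Y * (b - a) + q * (1 - Y) * (c - a)
        ≤ a' + p * Y * (b' - a') + q * (1 - Y) * (c' - a') := by
    intro a b c a' b' c' h1 h2 h3
    nlinarith [mul_le_mul_of_nonneg_left h1 w0, mul_le_mul_of_nonneg_left h2 w1,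
      mul_le_mul_of_nonneg_left h3 w2]
  have hg'g : g' ≤ g := by nlinarith [mul_nonneg hρ0 (mul_nonneg hg'.le hg'.le)]
  split_ifs with hc
  · have hgY : g * Y⁻¹ ≤ K⁻¹ := by
      rw [← div_eq_mul_inv, div_le_iff₀ hY, inv_mul_eq_div, le_div_iff₀ hK]; linarith
    rw [min_eq_left hgY]
    refine (hmono _ _ _ _ _ _ (min_le_left _ _) (min_le_left _ _) (min_le_left _ _)).trans ?_
    have h1 := inv_step_le hp hq hY hY1 hg'.le hδ'
    set t := g' * (1 - Y) with ht
    have ht0 : 0 ≤ t := mul_nonneg hg'.le (by linarith)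
    have htg : t ≤ g' := by nlinarith
    have hKη : K⁻¹ ≤ η / 4 := by
      rw [inv_le_comm₀ hK (by positivity)]; simpa using hK1
    have h2 : t * Y⁻¹ ≤ η / 4 := by
      have : t * Y⁻¹ ≤ g * Y⁻¹ := by gcongr; linarith
      linarith
    calc g' * Y⁻¹ + p * Y * (g' * (Y + t)⁻¹ - g' * Y⁻¹)
          + q * (1 - Y) * (g' * ((1 - g') * Y)⁻¹ - g' * Y⁻¹)
        = g' * (Y⁻¹ + p * Y * ((Y + t)⁻¹ - Y⁻¹) + q * (1 - Y) * (((1 - g') * Y)⁻¹ - Y⁻¹)) := by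
          ring
      _ ≤ g' * (Y⁻¹ * (1 + t * (q - p + 2 * g' + t * Y⁻¹))) := by gcongr
      _ ≤ g' * (Y⁻¹ * (1 + t * (ρ - η / 2))) := by
          gcongr; linarith
      _ ≤ g' * (Y⁻¹ * (1 + ρ * g' - t * (η / 2))) := by
          gcongr; nlinarith
      _ = Y⁻¹ * (g' * (1 + ρ * g') - g' * t * (η / 2)) := by ring
      _ ≤ Y⁻¹ * (g - g / 2 * t * (η / 2)) := by
          gcongr; linarith
      _ = g * Y⁻¹ - η / 4 * t * (g * Y⁻¹) := by ring
  · have hgY : K⁻¹ ≤ g * Y⁻¹ := by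
      rw [← div_eq_mul_inv, le_div_iff₀ hY, inv_mul_eq_div, div_le_iff₀ hK]; linarith
    rw [min_eq_right hgY]
    refine (hmono _ _ _ _ _ _ (min_le_right _ _) (min_le_right _ _) (min_le_right _ _)).trans ?_
    linarith

/-- The truncated inverse ratio converges almost surely, and its drift is summable. The absolute
values only matter for the finitely many indices where `γ n` need not be positive. -/
theorem ae_tendsto_truncated_inv [IsFiniteMeasure P] (h : IsReinforced P ℱ p q y γ E F Y)
    (hy : 0 < y) (hγ : IsStepSize γ ρ₁ ρ₂) (hρ0 : 0 ≤ ρ₁) (hρ : q - p < ρ₁) {K : ℝ}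
    (hK : 4 / (ρ₁ + p - q) ≤ K) :
    ∀ᵐ ω ∂P, (∃ L, Tendsto (fun n => |γ n| * (Y n ω)⁻¹ ⊓ K⁻¹) atTop (𝓝 L)) ∧
      Summable (fun n => if K * |γ n| ≤ Y n ω then
        (ρ₁ + p - q) / 4 * (γ (n + 1) * (1 - Y n ω)) * (|γ n| * (Y n ω)⁻¹) else 0) := by
  have hY := h.isBddMeas
  have hYi := h.isBddMeas_inv hy
  have hη0 : 0 < ρ₁ + p - q := by linarith
  have hK0 : 0 < K := lt_of_lt_of_le (by positivity) hK
  have hc := fun (n : ℕ) (c : ℝ) => IsBddMeas.const (m := ℱ n) c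
  have hiE : ∀ n, IsBddMeas (ℱ n) (fun ω => (Y n ω + γ (n + 1) * (1 - Y n ω))⁻¹) := by
    intro n
    obtain ⟨c, hc0, hcY⟩ := h.exists_pos_le hy n
    exact ((hY n).add ((hc n _).mul ((hc n 1).sub (hY n)))).inv hc0 fun ω => (hcY ω).trans
      (le_add_of_nonneg_right (mul_nonneg (h.γ_nonneg n) (sub_nonneg.2 (h.le_one n ω))))
  have := h.robbins_siegmund (V := fun n ω => |γ n| * (Y n ω)⁻¹ ⊓ K⁻¹)
    (a := fun _ _ => 0)
    (b := fun n ω => if K * |γ n| ≤ Y n ω then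
        (ρ₁ + p - q) / 4 * (γ (n + 1) * (1 - Y n ω)) * (|γ n| * (Y n ω)⁻¹) else 0)
    (G := fun n => univ)
    (v0 := fun n ω => |γ (n + 1)| * (Y n ω)⁻¹ ⊓ K⁻¹)
    (vE := fun n ω => |γ (n + 1)| * (Y n ω + γ (n + 1) * (1 - Y n ω))⁻¹ ⊓ K⁻¹)
    (vF := fun n ω => |γ (n + 1)| * ((1 - γ (n + 1)) * Y n ω)⁻¹ ⊓ K⁻¹)
    (fun n ω => le_min (mul_nonneg (abs_nonneg _) (inv_nonneg.2 (h.nonneg n ω))) (by positivity))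
    (fun _ _ => le_rfl)
    (fun n ω => ?_)
    (fun n => ((hc n _).mul (hYi n)).min (hc n _)) (fun n => hc n 0)
    (fun n => ?_)
    (fun n => @MeasurableSet.univ _ (ℱ n))
    (fun n ω hω => by rw [h.step_E n ω hω]) (fun n ω hω => by rw [h.step_F n ω hω])
    (fun n ω h1 h2 => by rw [h.step_else n ω h1 h2])
    (fun n => ((hc n _).mul (hiE n)).min (hc n _))
    (fun n => ?_)
    (fun n => ((hc n _).mul (hYi n)).min (hc n _)) ?_
  · filter_upwards [this] with ω hω
    exact hω (Eventually.of_forall fun _ => mem_univ _) summable_zero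
  · have := h.γ_nonneg n
    have := h.nonneg n ω
    have := sub_nonneg.2 (h.le_one n ω)
    split_ifs
    · positivity
    · exact le_rfl
  · have hs : MeasurableSet[ℱ n] {ω | K * |γ n| ≤ Y n ω} :=
      (hc n _).measurableSet_le (hY n)
    have := IsBddMeas.indicator hs (((hc n ((ρ₁ + p - q) / 4)).mul
      ((hc n (γ (n + 1))).mul ((hc n 1).sub (hY n)))).mul ((hc n |γ n|).mul (hYi n)))
    convert this using 1
    funext ω
    simp [indicator]
  · have : (fun ω => ((1 - γ (n + 1)) * Y n ω)⁻¹)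
        = fun ω => (1 - γ (n + 1))⁻¹ * (Y n ω)⁻¹ := by funext ω; rw [mul_inv]
    have h2 : IsBddMeas (ℱ n) (fun ω => ((1 - γ (n + 1)) * Y n ω)⁻¹) := by
      rw [this]; exact (hc n _).mul (hYi n)
    exact ((hc n _).mul h2).min (hc n _)
  · filter_upwards [hγ.pos, hγ.eventually_pos_succ, hγ.succ_le hρ0, hγ.le_two_mul_succ hρ0,
      hγ.eventually_le (show 0 < (ρ₁ + p - q) / 8 by positivity),
      hγ.eventually_le (show (0 : ℝ) < 1 / 2 by norm_num)] with n h1 h2 h3 h4 h5 h6 ω _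
    rw [abs_of_pos h1, abs_of_pos h2]
    have := truncated_inv_step_le h.p_mem h.q_mem (h.pos hy n ω) (h.le_one n ω) h2 hρ0 hη0 h3 h4
      hK0 hK h5 h6
    linarith

/-- On `{Y → 0, ∑ Y n = ∞}` the sum of `γ (n + 1) ^ 2 / Y n` is finite: there `Y n / γ n` is
unbounded, so the limit of the truncated inverse ratio lies below the truncation level. -/
theorem ae_summable_sq_div [IsFiniteMeasure P] (h : IsReinforced P ℱ p q y γ E F Y)
    (hy : 0 < y) (hγ : IsStepSize γ ρ₁ ρ₂) (hρ0 : 0 ≤ ρ₁) (hρ : q - p < ρ₁) :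
    ∀ᵐ ω ∂P, Tendsto (fun n => Y n ω) atTop (𝓝 0) → ¬ Summable (fun n => Y n ω) →
      Summable fun n => γ (n + 1) ^ 2 * (Y n ω)⁻¹ := by
  have hη0 : 0 < ρ₁ + p - q := by linarith
  set K := 4 / (ρ₁ + p - q) with hK
  have hK0 : 0 < K := by positivity
  filter_upwards [h.ae_tendsto_truncated_inv hy hγ hρ0 hρ le_rfl,
    ae_all_iff.2 fun M : ℕ => h.ae_summable_of_le_step hγ hρ0 hρ (Nat.cast_nonneg M)]
    with ω ⟨⟨L, hL⟩, hs⟩ hM h0 hns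
  have hL0 : L < K⁻¹ := by
    obtain ⟨M, hMK⟩ := exists_nat_gt K
    have hM0 : (0 : ℝ) < M := hK0.trans hMK
    have hfr : ∃ᶠ n in atTop, (M : ℝ) * γ n < Y n ω := by
      intro hcon
      exact hns (hM M h0 (hcon.mono fun n hn => not_lt.1 hn))
    have hfr2 : ∃ᶠ n in atTop, |γ n| * (Y n ω)⁻¹ ⊓ K⁻¹ ≤ (M : ℝ)⁻¹ := by
      refine (hfr.and_eventually hγ.pos).mono fun n ⟨h1, h2⟩ => (min_le_left _ _).trans ?_
      rw [abs_of_pos h2, ← div_eq_mul_inv, div_le_iff₀ (h.pos hy n ω), inv_mul_eq_div,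
        le_div_iff₀ hM0]
      linarith
    exact (le_of_tendsto_of_frequently hL hfr2).trans_lt (inv_strictAnti₀ hK0 hMK)
  have hev : ∀ᶠ n in atTop, K * γ n ≤ Y n ω := by
    filter_upwards [hL.eventually (gt_mem_nhds hL0), hγ.pos] with n h1 h2
    have h3 : γ n * (Y n ω)⁻¹ < K⁻¹ := by
      rcases min_lt_iff.1 h1 with h3 | h3
      · rwa [abs_of_pos h2] at h3
      · exact absurd h3 (lt_irrefl _)
    rw [← div_eq_mul_inv, div_lt_iff₀ (h.pos hy n ω), inv_mul_eq_div, lt_div_iff₀ hK0] at h3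
    linarith
  refine summable_of_isBigO_nat hs (Asymptotics.IsBigO.of_bound (8 / (ρ₁ + p - q)) ?_)
  filter_upwards [hev, hγ.pos, hγ.eventually_pos_succ, hγ.succ_le hρ0,
    h0.eventually (eventually_le_nhds (show (0 : ℝ) < 1 / 2 by norm_num))] with n h1 h2 h3 h4 h5
  have hYp := h.pos hy n ω
  have h6 : γ (n + 1) ≤ γ n := by nlinarith [mul_nonneg hρ0 (mul_nonneg h3.le h3.le)]
  have h7 : 0 ≤ 1 - Y n ω := by linarith
  rw [abs_of_pos h2, if_pos h1, Real.norm_eq_abs, Real.norm_eq_abs, abs_of_nonneg (by positivity),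
    abs_of_nonneg (by positivity)]
  have e : 8 / (ρ₁ + p - q) * ((ρ₁ + p - q) / 4 * (γ (n + 1) * (1 - Y n ω)) * (γ n * (Y n ω)⁻¹))
      = (2 * (1 - Y n ω)) * (γ (n + 1) * γ n * (Y n ω)⁻¹) := by field_simp; ring
  rw [e]
  calc γ (n + 1) ^ 2 * (Y n ω)⁻¹ ≤ 1 * (γ (n + 1) * γ n * (Y n ω)⁻¹) := by
        rw [one_mul, sq]; gcongr
    _ ≤ _ := by gcongr; linarith

/-- The predictable compensator of a multiplicative decay of intensity `c`. -/
noncomputable def decay (γ : ℕ → ℝ) (Y : ℕ → Ω → ℝ) (c : ℝ) (n : ℕ) (ω : Ω) : ℝ :=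
  ∏ k ∈ Finset.range n, (1 - c * (γ (k + 1) * (1 - Y k ω)))

theorem decay_succ (γ : ℕ → ℝ) (Y : ℕ → Ω → ℝ) (c : ℝ) (n : ℕ) (ω : Ω) :
    decay γ Y c (n + 1) ω = decay γ Y c n ω * (1 - c * (γ (n + 1) * (1 - Y n ω))) := by
  simp [decay, Finset.prod_range_succ]

theorem decay_factor_ge (h : IsReinforced P ℱ p q y γ E F Y) (c : ℝ) (n : ℕ)
    (ω : Ω) : min 1 (1 - c) ≤ 1 - c * (γ (n + 1) * (1 - Y n ω)) := by
  have h1 := h.γ_nonneg n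
  have h2 := h.γ_lt_one n
  have h3 := h.mem_Icc n ω
  have h4 : γ (n + 1) * (1 - Y n ω) ≤ 1 := by nlinarith [h3.1, h3.2]
  have h5 : 0 ≤ γ (n + 1) * (1 - Y n ω) := mul_nonneg h1 (by linarith [h3.2])
  rcases le_total c 0 with h0 | h0
  · rw [min_eq_left (by linarith)]; nlinarith
  · rw [min_eq_right (by linarith)]; nlinarith

theorem exists_decay_ge (h : IsReinforced P ℱ p q y γ E F Y) {c : ℝ} (hc : c < 1) (n : ℕ) :
    ∃ d, 0 < d ∧ ∀ ω, d ≤ decay γ Y c n ω := by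
  have h1 : (0 : ℝ) < min 1 (1 - c) := lt_min one_pos (by linarith)
  refine ⟨min 1 (1 - c) ^ n, by positivity, fun ω => ?_⟩
  have := Finset.prod_le_prod (s := Finset.range n) (f := fun _ => min 1 (1 - c))
    (g := fun k => 1 - c * (γ (k + 1) * (1 - Y k ω)))
    (fun _ _ => h1.le) (fun k _ => h.decay_factor_ge c k ω)
  simpa [decay] using this

theorem decay_pos (h : IsReinforced P ℱ p q y γ E F Y) {c : ℝ} (hc : c < 1) (n : ℕ) (ω : Ω) :
    0 < decay γ Y c n ω := by
  obtain ⟨d, hd, hle⟩ := h.exists_decay_ge hc n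
  exact hd.trans_le (hle ω)

theorem isBddMeas_decay_succ (h : IsReinforced P ℱ p q y γ E F Y) (c : ℝ) (n : ℕ) :
    IsBddMeas (ℱ n) (decay γ Y c (n + 1)) :=
  IsBddMeas.prod _ fun k hk => ((IsBddMeas.const 1).sub ((IsBddMeas.const c).mul
    ((IsBddMeas.const (γ (k + 1))).mul ((IsBddMeas.const 1).sub (h.isBddMeas k))))).mono
      (ℱ.mono (by omega))

theorem isBddMeas_decay (h : IsReinforced P ℱ p q y γ E F Y) (c : ℝ) (n : ℕ) :
    IsBddMeas (ℱ n) (decay γ Y c n) := by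
  cases n with
  | zero => exact IsBddMeas.prod _ fun k hk => by omega
  | succ n => exact (h.isBddMeas_decay_succ c n).mono (ℱ.mono (Nat.le_succ n))

theorem isBddMeas_decay_succ_inv (h : IsReinforced P ℱ p q y γ E F Y) {c : ℝ} (hc : c < 1)
    (n : ℕ) : IsBddMeas (ℱ n) (fun ω => (decay γ Y c (n + 1) ω)⁻¹) := by
  obtain ⟨d, hd, hle⟩ := h.exists_decay_ge hc (n + 1)
  exact (h.isBddMeas_decay_succ c n).inv hd hle

theorem isBddMeas_decay_inv (h : IsReinforced P ℱ p q y γ E F Y) {c : ℝ} (hc : c < 1)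
    (n : ℕ) : IsBddMeas (ℱ n) (fun ω => (decay γ Y c n ω)⁻¹) := by
  obtain ⟨d, hd, hle⟩ := h.exists_decay_ge hc n
  exact (h.isBddMeas_decay c n).inv hd hle

/-- `Y n` divided by its mean decay is a nonnegative martingale. -/
theorem ae_tendsto_mul_inv_decay [IsFiniteMeasure P] (h : IsReinforced P ℱ p q y γ E F Y) :
    ∀ᵐ ω ∂P, ∃ L, Tendsto (fun n => Y n ω * (decay γ Y (q - p) n ω)⁻¹) atTop (𝓝 L) := by
  have hY := h.isBddMeas
  have hc := fun (n : ℕ) (c : ℝ) => IsBddMeas.const (m := ℱ n) c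
  have hqp : q - p < 1 := by linarith [h.q_mem.2, h.p_mem.1]
  have hD := h.isBddMeas_decay_inv hqp
  have hD' := h.isBddMeas_decay_succ_inv hqp
  have := h.robbins_siegmund (V := fun n ω => Y n ω * (decay γ Y (q - p) n ω)⁻¹)
    (a := fun _ _ => 0) (b := fun _ _ => 0) (G := fun n => univ)
    (v0 := fun n ω => Y n ω * (decay γ Y (q - p) (n + 1) ω)⁻¹)
    (vE := fun n ω => (Y n ω + γ (n + 1) * (1 - Y n ω)) * (decay γ Y (q - p) (n + 1) ω)⁻¹)
    (vF := fun n ω => ((1 - γ (n + 1)) * Y n ω) * (decay γ Y (q - p) (n + 1) ω)⁻¹)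
    (fun n ω => mul_nonneg (h.nonneg n ω) (inv_nonneg.2 (h.decay_pos hqp n ω).le))
    (fun _ _ => le_rfl) (fun _ _ => le_rfl)
    (fun n => (hY n).mul (hD n)) (fun n => hc n 0) (fun n => hc n 0)
    (fun n => @MeasurableSet.univ _ (ℱ n))
    (fun n ω hω => by rw [h.step_E n ω hω]) (fun n ω hω => by rw [h.step_F n ω hω])
    (fun n ω h1 h2 => by rw [h.step_else n ω h1 h2])
    (fun n => ((hY n).add ((hc n _).mul ((hc n 1).sub (hY n)))).mul (hD' n))
    (fun n => ((hc n _).mul (hY n)).mul (hD' n)) (fun n => (hY n).mul (hD' n))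
    (Eventually.of_forall fun n ω _ => ?_)
  · filter_upwards [this] with ω hω
    exact (hω (Eventually.of_forall fun _ => mem_univ _) summable_zero).1
  · have h1 := h.decay_pos hqp n ω
    have h2 := h.decay_pos hqp (n + 1) ω
    rw [decay_succ] at h2 ⊢
    have h3 := pos_of_mul_pos_right h2 h1.le
    apply le_of_eq
    set d := decay γ Y (q - p) n ω
    set f := 1 - (q - p) * (γ (n + 1) * (1 - Y n ω)) with hf
    have e : Y n ω * (d * f)⁻¹ + p * Y n ω * ((Y n ω + γ (n + 1) * (1 - Y n ω)) * (d * f)⁻¹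
          - Y n ω * (d * f)⁻¹) + q * (1 - Y n ω) * ((1 - γ (n + 1)) * Y n ω * (d * f)⁻¹
          - Y n ω * (d * f)⁻¹) = Y n ω * f * (d * f)⁻¹ := by rw [hf]; ring
    rw [e]
    field_simp
    ring

/-- The inverse of `Y n` divided by its mean decay is an almost supermartingale, with growth
rate governed by `γ n ^ 2 / Y n`. -/
theorem ae_tendsto_decay_mul_inv [IsFiniteMeasure P] (h : IsReinforced P ℱ p q y γ E F Y)
    (hy : 0 < y) (hγ : IsStepSize γ ρ₁ ρ₂) :
    ∀ᵐ ω ∂P, Summable (fun n => γ (n + 1) ^ 2 * (Y n ω)⁻¹) →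
      ∃ L, Tendsto (fun n => decay γ Y (q - p) n ω * (Y n ω)⁻¹) atTop (𝓝 L) := by
  have hY := h.isBddMeas
  have hYi := h.isBddMeas_inv hy
  have hc := fun (n : ℕ) (c : ℝ) => IsBddMeas.const (m := ℱ n) c
  have hqp : q - p < 1 := by linarith [h.q_mem.2, h.p_mem.1]
  have hD := h.isBddMeas_decay (q - p)
  have hD' := h.isBddMeas_decay_succ (q - p)
  have hiE : ∀ n, IsBddMeas (ℱ n) (fun ω => (Y n ω + γ (n + 1) * (1 - Y n ω))⁻¹) := by
    intro n
    obtain ⟨c, hc0, hcY⟩ := h.exists_pos_le hy n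
    exact ((hY n).add ((hc n _).mul ((hc n 1).sub (hY n)))).inv hc0 fun ω => (hcY ω).trans
      (le_add_of_nonneg_right (mul_nonneg (h.γ_nonneg n) (sub_nonneg.2 (h.le_one n ω))))
  have hiF : ∀ n, IsBddMeas (ℱ n) (fun ω => ((1 - γ (n + 1)) * Y n ω)⁻¹) := by
    intro n
    have : (fun ω => ((1 - γ (n + 1)) * Y n ω)⁻¹)
        = fun ω => (1 - γ (n + 1))⁻¹ * (Y n ω)⁻¹ := by funext ω; rw [mul_inv]
    rw [this]; exact (hc n _).mul (hYi n)
  have := h.robbins_siegmund (V := fun n ω => decay γ Y (q - p) n ω * (Y n ω)⁻¹)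
    (a := fun n ω => 6 * (γ (n + 1) ^ 2 * (Y n ω)⁻¹)) (b := fun _ _ => 0) (G := fun n => univ)
    (v0 := fun n ω => decay γ Y (q - p) (n + 1) ω * (Y n ω)⁻¹)
    (vE := fun n ω => decay γ Y (q - p) (n + 1) ω * (Y n ω + γ (n + 1) * (1 - Y n ω))⁻¹)
    (vF := fun n ω => decay γ Y (q - p) (n + 1) ω * ((1 - γ (n + 1)) * Y n ω)⁻¹)
    (fun n ω => mul_nonneg (h.decay_pos hqp n ω).le (inv_nonneg.2 (h.nonneg n ω)))
    (fun n ω => mul_nonneg (by norm_num) (mul_nonneg (sq_nonneg _) (inv_nonneg.2 (h.nonneg n ω))))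
    (fun _ _ => le_rfl)
    (fun n => (hD n).mul (hYi n)) (fun n => (hc n 6).mul ((hc n _).mul (hYi n))) (fun n => hc n 0)
    (fun n => @MeasurableSet.univ _ (ℱ n))
    (fun n ω hω => by rw [h.step_E n ω hω]) (fun n ω hω => by rw [h.step_F n ω hω])
    (fun n ω h1 h2 => by rw [h.step_else n ω h1 h2])
    (fun n => (hD' n).mul (hiE n)) (fun n => (hD' n).mul (hiF n)) (fun n => (hD' n).mul (hYi n)) ?_
  · filter_upwards [this] with ω hω hs
    exact (hω (Eventually.of_forall fun _ => mem_univ _) (hs.mul_left 6)).1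
  · filter_upwards [hγ.eventually_le (show (0 : ℝ) < 1 / 2 by norm_num)] with n hn ω _
    have hg := h.γ_nonneg n
    have hYp := h.pos hy n ω
    have hY1 := h.le_one n ω
    have h1 := h.decay_pos hqp n ω
    have h2 := h.decay_pos hqp (n + 1) ω
    have h3 := inv_step_le h.p_mem h.q_mem hYp hY1 hg hn
    have e := decay_succ γ Y (q - p) n ω
    set g := γ (n + 1)
    set t := g * (1 - Y n ω) with ht
    have ht0 : 0 ≤ t := mul_nonneg hg (by linarith)
    have htg : t ≤ g := by nlinarith
    have hYinv : 1 ≤ (Y n ω)⁻¹ := (one_le_inv₀ hYp).2 hY1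
    have hs1 : |(q - p) * t| ≤ 1 := by
      rw [abs_le]; constructor <;> nlinarith [h.p_mem.1, h.p_mem.2, h.q_mem.1, h.q_mem.2]
    have hr : t * (2 * g + t * (Y n ω)⁻¹) ≤ 3 * (g ^ 2 * (Y n ω)⁻¹) := by
      have a1 : 2 * g ≤ 2 * g * (Y n ω)⁻¹ := by nlinarith
      have a2 : t * (Y n ω)⁻¹ ≤ g * (Y n ω)⁻¹ := by gcongr
      calc t * (2 * g + t * (Y n ω)⁻¹) ≤ g * (3 * g * (Y n ω)⁻¹) := by
            gcongr; linarith
        _ = _ := by ring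
    have hr0 : 0 ≤ t * (2 * g + t * (Y n ω)⁻¹) := by positivity
    set d := decay γ Y (q - p) (n + 1) ω with hd
    calc d * (Y n ω)⁻¹ + p * Y n ω * (d * (Y n ω + t)⁻¹ - d * (Y n ω)⁻¹)
          + q * (1 - Y n ω) * (d * ((1 - g) * Y n ω)⁻¹ - d * (Y n ω)⁻¹)
        = d * ((Y n ω)⁻¹ + p * Y n ω * ((Y n ω + t)⁻¹ - (Y n ω)⁻¹)
          + q * (1 - Y n ω) * (((1 - g) * Y n ω)⁻¹ - (Y n ω)⁻¹)) := by ring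
      _ ≤ d * ((Y n ω)⁻¹ * (1 + t * (q - p + 2 * g + t * (Y n ω)⁻¹))) := by gcongr
      _ = decay γ Y (q - p) n ω * (Y n ω)⁻¹ * ((1 - (q - p) * t) *
            (1 + (q - p) * t + t * (2 * g + t * (Y n ω)⁻¹))) := by rw [e]; ring
      _ ≤ decay γ Y (q - p) n ω * (Y n ω)⁻¹ * (1 + 6 * (g ^ 2 * (Y n ω)⁻¹)) := by
          have := abs_le.1 hs1
          gcongr
          nlinarith [sq_nonneg ((q - p) * t)]
      _ = _ := by ring

/-- In the slow regime `Y n` is asymptotic to a positive multiple of its mean decay. -/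
theorem ae_tendsto_slow [IsFiniteMeasure P] (h : IsReinforced P ℱ p q y γ E F Y)
    (hy : 0 < y) (hγ : IsStepSize γ ρ₁ ρ₂) (hρ0 : 0 ≤ ρ₁) (hρ : q - p < ρ₁) :
    ∀ᵐ ω ∂P, Tendsto (fun n => Y n ω) atTop (𝓝 0) → ¬ Summable (fun n => Y n ω) →
      ∃ L, 0 < L ∧ Tendsto (fun n => Y n ω * (decay γ Y (q - p) n ω)⁻¹) atTop (𝓝 L) := by
  have hqp : q - p < 1 := by linarith [h.q_mem.2, h.p_mem.1]
  filter_upwards [h.ae_tendsto_mul_inv_decay, h.ae_tendsto_decay_mul_inv hy hγ,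
    h.ae_summable_sq_div hy hγ hρ0 hρ] with ω ⟨L, hL⟩ h2 h3 h0 hns
  obtain ⟨L', hL'⟩ := h2 (h3 h0 hns)
  have h1 : L * L' = 1 := by
    refine tendsto_nhds_unique (hL.mul hL') (tendsto_const_nhds.congr fun n => ?_)
    have a1 := h.decay_pos hqp n ω
    have a2 := h.pos hy n ω
    field_simp
  have hL0 : 0 ≤ L := ge_of_tendsto' hL fun n =>
    mul_nonneg (h.nonneg n ω) (inv_nonneg.2 (h.decay_pos hqp n ω).le)
  refine ⟨L, lt_of_le_of_ne hL0 fun h => ?_, hL⟩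
  rw [← h] at h1; simp at h1

/-- Against the drift, convergence to `0` is always fast. -/
theorem ae_summable_of_lt [IsFiniteMeasure P] (h : IsReinforced P ℱ p q y γ E F Y)
    (hy : 0 < y) (hγ : IsStepSize γ ρ₁ ρ₂) (hρ0 : 0 ≤ ρ₁) (hqp : q < p) :
    ∀ᵐ ω ∂P, Tendsto (fun n => Y n ω) atTop (𝓝 0) → Summable (fun n => Y n ω) := by
  filter_upwards [h.ae_tendsto_slow hy hγ hρ0 (by linarith)] with ω hω h0
  by_contra hns
  obtain ⟨L, hL, hlim⟩ := hω h0 hns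
  have hD : ∀ n, 1 ≤ decay γ Y (q - p) n ω := by
    intro n
    induction n with
    | zero => simp [decay]
    | succ n ih =>
      rw [decay_succ]
      have h1 := mul_nonneg (h.γ_nonneg n) (sub_nonneg.2 (h.le_one n ω))
      exact one_le_mul_of_one_le_of_one_le ih (by nlinarith)
  refine hL.ne' (tendsto_nhds_unique hlim ?_)
  refine squeeze_zero (fun n => mul_nonneg (h.nonneg n ω)
    (inv_nonneg.2 (zero_le_one.trans (hD n)))) (fun n => ?_) h0
  exact mul_le_of_le_one_right (h.nonneg n ω) (inv_le_one_of_one_le₀ (hD n))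

/-- With a strong drift towards `0`, convergence to `0` is always fast: the ratio `Y n / γ n`
converges, whereas every move towards `1` makes it jump by almost `1`. -/
theorem ae_summable_of_inc_le [IsFiniteMeasure P] (h : IsReinforced P ℱ p q y γ E F Y)
    (hγ : IsStepSize γ ρ₁ ρ₂) (hρ0 : 0 ≤ ρ₁) (hρ : ρ₂ ≤ q - p) (hpq : p < q) :
    ∀ᵐ ω ∂P, Tendsto (fun n => Y n ω) atTop (𝓝 0) → Summable (fun n => Y n ω) := by
  have hY := h.isBddMeas
  have hc := fun (n : ℕ) (c : ℝ) => IsBddMeas.const (m := ℱ n) c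
  have := h.robbins_siegmund (V := fun n ω => Y n ω * |γ n|⁻¹)
    (a := fun n ω => 2 * (q - p) * (γ (n + 1) * Y n ω)) (b := fun _ _ => 0) (G := fun n => univ)
    (v0 := fun n ω => Y n ω * |γ (n + 1)|⁻¹)
    (vE := fun n ω => (Y n ω + γ (n + 1) * (1 - Y n ω)) * |γ (n + 1)|⁻¹)
    (vF := fun n ω => ((1 - γ (n + 1)) * Y n ω) * |γ (n + 1)|⁻¹)
    (fun n ω => mul_nonneg (h.nonneg n ω) (by positivity))
    (fun n ω => mul_nonneg (by linarith) (mul_nonneg (h.γ_nonneg n) (h.nonneg n ω)))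
    (fun _ _ => le_rfl)
    (fun n => (hY n).mul (hc n _)) (fun n => (hc n _).mul ((hc n _).mul (hY n))) (fun n => hc n 0)
    (fun n => @MeasurableSet.univ _ (ℱ n))
    (fun n ω hω => by rw [h.step_E n ω hω]) (fun n ω hω => by rw [h.step_F n ω hω])
    (fun n ω h1 h2 => by rw [h.step_else n ω h1 h2])
    (fun n => ((hY n).add ((hc n _).mul ((hc n 1).sub (hY n)))).mul (hc n _))
    (fun n => ((hc n _).mul (hY n)).mul (hc n _)) (fun n => (hY n).mul (hc n _)) ?_
  · filter_upwards [this, h.ae_summable_step_mul hpq.ne, h.ae_summable_iff] with ω hω h1 h2 h0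
    obtain ⟨⟨L, hL⟩, _⟩ := hω (Eventually.of_forall fun _ => mem_univ _) ((h1 h0).mul_left _)
    rw [h2]
    have hd : Tendsto (fun n => Y (n + 1) ω * |γ (n + 1)|⁻¹ - Y n ω * |γ n|⁻¹) atTop (𝓝 0) := by
      simpa using ((tendsto_add_atTop_iff_nat 1).2 hL).sub hL
    filter_upwards [hγ.pos, hγ.eventually_pos_succ, hγ.le_inc,
      hd.eventually (gt_mem_nhds (show (0 : ℝ) < 1 / 2 by norm_num)),
      h0.eventually (eventually_le_nhds (show (0 : ℝ) < 1 / 2 by norm_num))]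
      with n g1 g2 g3 g4 g5 hE
    -- a move towards `1` adds at least `1 - Y n` to the ratio, whose increments tend to `0`
    rw [h.step_E n ω hE, abs_of_pos g1, abs_of_pos g2] at g4
    have e1 : (Y n ω + γ (n + 1) * (1 - Y n ω)) * (γ (n + 1))⁻¹
        = Y n ω * (γ (n + 1))⁻¹ + (1 - Y n ω) := by field_simp
    rw [e1] at g4
    have : 0 ≤ Y n ω * ((γ (n + 1))⁻¹ - (γ n)⁻¹) :=
      mul_nonneg (h.nonneg n ω) (hρ0.trans g3)
    linarith
  · filter_upwards [hγ.pos, hγ.eventually_pos_succ, hγ.inc_le, hγ.le_two_mul_succ hρ0]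
      with n g1 g2 g3 g4 ω _
    rw [abs_of_pos g1, abs_of_pos g2]
    have hy := h.nonneg n ω
    have e1 : (Y n ω + γ (n + 1) * (1 - Y n ω)) * (γ (n + 1))⁻¹
        = Y n ω * (γ (n + 1))⁻¹ + (1 - Y n ω) := by field_simp
    have e2 : ((1 - γ (n + 1)) * Y n ω) * (γ (n + 1))⁻¹ = Y n ω * (γ (n + 1))⁻¹ - Y n ω := by
      field_simp
    rw [e1, e2]
    have a1 : Y n ω * ((γ (n + 1))⁻¹ - (γ n)⁻¹) ≤ Y n ω * (q - p) :=
      mul_le_mul_of_nonneg_left (g3.trans hρ) hy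
    have a2 : (q - p) * (Y n ω * Y n ω)
        ≤ 2 * (q - p) * (γ (n + 1) * Y n ω) * (Y n ω * (γ n)⁻¹) := by
      have : 1 ≤ 2 * γ (n + 1) * (γ n)⁻¹ := by
        rw [← div_eq_mul_inv, one_le_div g1]; linarith
      calc (q - p) * (Y n ω * Y n ω) = (q - p) * (Y n ω * Y n ω) * 1 := by ring
        _ ≤ (q - p) * (Y n ω * Y n ω) * (2 * γ (n + 1) * (γ n)⁻¹) :=
            mul_le_mul_of_nonneg_left this (mul_nonneg (by linarith) (mul_nonneg hy hy))
        _ = _ := by ring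
    linarith

end IsReinforced

/-! ### Polynomial rates -/

theorem HasRate.not_summable {e : ℕ → ℝ} {r : ℝ} (h : HasRate e r) (he : ∀ n, 0 ≤ e n)
    (hr : r ≤ 1) : ¬ Summable e := by
  obtain ⟨L, hL, hlim⟩ := h
  intro hs
  refine Real.not_summable_one_div_natCast
    (summable_of_isBigO_nat hs (Asymptotics.IsBigO.of_bound (2 / L) ?_))
  filter_upwards [hlim.eventually (eventually_ge_nhds (show L / 2 < L by linarith)),
    eventually_ge_atTop 1] with n h1 h2
  have hn : (1 : ℝ) ≤ n := by exact_mod_cast h2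
  have h3 : (n : ℝ) ^ r ≤ n := by
    simpa using Real.rpow_le_rpow_of_exponent_le hn hr
  rw [Real.norm_eq_abs, Real.norm_eq_abs, abs_of_nonneg (he n), abs_of_nonneg (by positivity),
    div_mul_eq_mul_div, div_le_div_iff₀ (by linarith) hL]
  nlinarith [mul_le_mul_of_nonneg_right h3 (he n)]

theorem abs_log_one_add_sub_le {x : ℝ} (hx : |x| ≤ 1 / 2) :
    |Real.log (1 + x) - x| ≤ 2 * x ^ 2 := by
  obtain ⟨h1, h2⟩ := abs_le.1 hx
  have hp : 0 < 1 + x := by linarith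
  have h3 := Real.log_le_sub_one_of_pos hp
  have h4 := Real.one_sub_inv_le_log_of_pos hp
  have h5 : 1 - (1 + x)⁻¹ - x = -(x ^ 2 * (1 + x)⁻¹) := by field_simp; ring
  have h6 : (1 + x)⁻¹ ≤ 2 := by
    rw [inv_le_comm₀ hp (by norm_num)]; linarith
  have h7 : x ^ 2 * (1 + x)⁻¹ ≤ x ^ 2 * 2 := by gcongr
  rw [abs_le]; constructor <;> nlinarith [sq_nonneg x]

theorem summable_inv_succ_sq (A : ℝ) : Summable fun k : ℕ => A * ((k : ℝ) + 1)⁻¹ ^ 2 := by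
  have := (summable_nat_add_iff 1).2 (Real.summable_nat_pow_inv.2 (show 1 < 2 by norm_num))
  simpa using this.mul_left A

theorem summable_log_one_add_sub {x : ℕ → ℝ} {A : ℝ}
    (hx : ∀ᶠ k in atTop, |x k| ≤ A * ((k : ℝ) + 1)⁻¹) :
    Summable fun k => Real.log (1 + x k) - x k := by
  have h0 : Tendsto (fun k : ℕ => A * ((k : ℝ) + 1)⁻¹) atTop (𝓝 0) := by
    simpa using (tendsto_one_div_add_atTop_nhds_zero_nat (𝕜 := ℝ)).const_mul A
  refine summable_of_isBigO_nat (summable_inv_succ_sq (A ^ 2)) (Asymptotics.IsBigO.of_bound 2 ?_)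
  filter_upwards [hx, h0.eventually (eventually_le_nhds (show (0 : ℝ) < 1 / 2 by norm_num))]
    with k h1 h2
  rw [Real.norm_eq_abs, Real.norm_eq_abs, abs_of_nonneg (a := A ^ 2 * _) (by positivity),
    ← mul_pow]
  refine (abs_log_one_add_sub_le (h1.trans h2)).trans ?_
  rw [← sq_abs (x k)]
  gcongr

/-- With harmonic step sizes, a product of decay factors that is perturbed by a summable amount
is asymptotic to a power. -/
theorem exists_tendsto_rpow_mul_prod {γ u : ℕ → ℝ} {C C' c : ℝ} (hC : 0 < C) (hC' : 0 < C')
    (hγ : ∀ᶠ n : ℕ in atTop, γ n = C / (C' + n)) (hu : ∀ k, u k ∈ Icc (0 : ℝ) 1)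
    (hpos : ∀ k, 0 < 1 - c * (γ (k + 1) * (1 - u k)))
    (hs : Summable fun k => γ (k + 1) * u k) :
    ∃ L, 0 < L ∧ Tendsto (fun n : ℕ => (n : ℝ) ^ (C * c)
      * ∏ k ∈ Finset.range n, (1 - c * (γ (k + 1) * (1 - u k)))) atTop (𝓝 L) := by
  have hγ' : ∀ᶠ k : ℕ in atTop, γ (k + 1) = C / (C' + (k + 1)) := by
    filter_upwards [(tendsto_add_atTop_nat 1).eventually hγ] with k hk
    simpa using hk
  set z : ℕ → ℝ := fun k => c * (γ (k + 1) * (1 - u k)) with hz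
  have hlog : ∀ k : ℕ, Real.log ((k : ℝ) + 2) - Real.log ((k : ℝ) + 1)
      = Real.log (1 + ((k : ℝ) + 1)⁻¹) := by
    intro k
    rw [← Real.log_div (by positivity) (by positivity)]
    congr 1; field_simp; ring
  have s1 : Summable fun k : ℕ => Real.log (1 + ((k : ℝ) + 1)⁻¹) - ((k : ℝ) + 1)⁻¹ := by
    refine summable_log_one_add_sub (A := 1) (Eventually.of_forall fun k => ?_)
    rw [one_mul, abs_of_nonneg (by positivity)]
  have s2 : Summable fun k : ℕ => Real.log (1 + -z k) - -z k := by
    refine summable_log_one_add_sub (A := |c| * C) ?_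
    filter_upwards [hγ'] with k hk
    have hg : 0 ≤ γ (k + 1) := by rw [hk]; positivity
    have h1 := (hu k).1
    have h2 := (hu k).2
    have h3 : γ (k + 1) ≤ C * ((k : ℝ) + 1)⁻¹ := by
      rw [hk, ← div_eq_mul_inv]
      exact div_le_div_of_nonneg_left hC.le (by positivity) (by linarith)
    rw [abs_neg, hz, abs_mul, mul_assoc, abs_of_nonneg (mul_nonneg hg (by linarith))]
    exact mul_le_mul_of_nonneg_left (by nlinarith) (abs_nonneg c)
  have s3 : Summable fun k : ℕ => C * c * ((k : ℝ) + 1)⁻¹ - z k := by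
    have a1 : Summable fun k : ℕ => C * c * ((k : ℝ) + 1)⁻¹ - c * γ (k + 1) := by
      refine summable_of_isBigO_nat (summable_inv_succ_sq (|c| * C * C'))
        (Asymptotics.IsBigO.of_bound 1 ?_)
      filter_upwards [hγ'] with k hk
      rw [hk, one_mul, Real.norm_eq_abs, Real.norm_eq_abs]
      have e : C * c * ((k : ℝ) + 1)⁻¹ - c * (C / (C' + (k + 1)))
          = c * (C * C' * (((k : ℝ) + 1)⁻¹ * (C' + (k + 1))⁻¹)) := by
        field_simp; ring
      have e2 : (C' + ((k : ℝ) + 1))⁻¹ ≤ ((k : ℝ) + 1)⁻¹ :=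
        inv_anti₀ (by positivity) (by linarith)
      rw [e, abs_mul, abs_of_nonneg (a := C * C' * _) (by positivity),
        abs_of_nonneg (a := |c| * C * C' * _) (by positivity), sq]
      calc |c| * (C * C' * (((k : ℝ) + 1)⁻¹ * (C' + (k + 1))⁻¹))
          ≤ |c| * (C * C' * (((k : ℝ) + 1)⁻¹ * ((k : ℝ) + 1)⁻¹)) := by gcongr
        _ = _ := by ring
    exact (a1.add (hs.mul_left c)).congr fun k => by simp only [hz]; ring
  have hsum : Summable fun k : ℕ => C * c * (Real.log ((k : ℝ) + 2) - Real.log ((k : ℝ) + 1))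
      + Real.log (1 - z k) := by
    refine (((s1.mul_left (C * c)).add s2).add s3).congr fun k => ?_
    rw [hlog, ← sub_eq_add_neg]; ring
  have hpart : ∀ n : ℕ, Real.exp (∑ k ∈ Finset.range n,
      (C * c * (Real.log ((k : ℝ) + 2) - Real.log ((k : ℝ) + 1)) + Real.log (1 - z k)))
      = ((n : ℝ) + 1) ^ (C * c) * ∏ k ∈ Finset.range n, (1 - z k) := by
    intro n
    induction n with
    | zero => simp
    | succ n ih =>
      rw [Finset.sum_range_succ, Real.exp_add, ih, Real.exp_add, Real.exp_log (hpos n),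
        Finset.prod_range_succ, Real.rpow_def_of_pos (by positivity),
        Real.rpow_def_of_pos (by positivity)]
      have e : Real.exp (Real.log (((n + 1 : ℕ) : ℝ) + 1) * (C * c))
          = Real.exp (Real.log ((n : ℝ) + 1) * (C * c))
            * Real.exp (C * c * (Real.log ((n : ℝ) + 2) - Real.log ((n : ℝ) + 1))) := by
        rw [← Real.exp_add]; congr 1; push_cast
        rw [show (n : ℝ) + 1 + 1 = n + 2 by ring]; ring
      rw [e]; ring
  have hlim := (Real.continuous_exp.tendsto _).comp hsum.hasSum.tendsto_sum_nat
  have hratio : Tendsto (fun n : ℕ => ((n : ℝ) / (n + 1)) ^ (C * c)) atTop (𝓝 1) := by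
    have := (tendsto_natCast_div_add_atTop (1 : ℝ)).rpow_const (p := C * c) (Or.inl one_ne_zero)
    simpa using this
  refine ⟨_, Real.exp_pos _, (one_mul (Real.exp _) ▸ hratio.mul hlim).congr fun n => ?_⟩
  rw [Function.comp_apply, hpart, Real.div_rpow (by positivity) (by positivity)]
  have : ((n : ℝ) + 1) ^ (C * c) ≠ 0 := by positivity
  rw [← mul_assoc, div_mul_cancel₀ _ this]

/-- The harmonic step sizes. -/
theorem isStepSize_of_eq_div {γ : ℕ → ℝ} {C C' : ℝ} (hC : 0 < C) (hC' : 0 < C')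
    (hγ : ∀ᶠ n : ℕ in atTop, γ n = C / (C' + n)) : IsStepSize γ (1 / C) (1 / C) := by
  have hγ' : ∀ᶠ k : ℕ in atTop, γ (k + 1) = C / (C' + (k + 1)) := by
    filter_upwards [(tendsto_add_atTop_nat 1).eventually hγ] with k hk
    simpa using hk
  have hinc : ∀ᶠ n in atTop, (γ (n + 1))⁻¹ - (γ n)⁻¹ = 1 / C := by
    filter_upwards [hγ, hγ'] with n h1 h2
    rw [h1, h2]; field_simp; ring
  have hden : Tendsto (fun n : ℕ => C' + (n : ℝ)) atTop atTop :=
    tendsto_atTop_add_const_left _ _ tendsto_natCast_atTop_atTop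
  refine ⟨hγ.mono fun n h => by rw [h]; positivity, hinc.mono fun n h => h.ge,
    hinc.mono fun n h => h.le, (hden.const_div_atTop C).congr' (hγ.mono fun n h => h.symm), ?_⟩
  intro hs
  refine Real.not_summable_one_div_natCast
    (summable_of_isBigO_nat hs (Asymptotics.IsBigO.of_bound ((C' + 1) / C) ?_))
  filter_upwards [hγ, eventually_ge_atTop 1] with n h1 h2
  have hn : (1 : ℝ) ≤ n := by exact_mod_cast h2
  rw [h1, Real.norm_eq_abs, Real.norm_eq_abs, abs_of_nonneg (by positivity),
    abs_of_nonneg (by positivity)]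
  have : (C' + 1) / C * (C / (C' + n)) = (C' + 1) / (C' + n) := by field_simp
  rw [this, div_le_div_iff₀ (by linarith) (by linarith)]
  nlinarith

/-- Step sizes that decrease more slowly than the harmonic ones: the increments of their inverses
tend to `0`. -/
theorem isStepSize_of_eq_rpow {γ : ℕ → ℝ} {α C C' : ℝ} (hα0 : 0 < α) (hα1 : α < 1) (hC : 0 < C)
    (hC' : 0 < C') (hγ : ∀ᶠ n : ℕ in atTop, γ n = (C / (C' + n)) ^ α) {ρ : ℝ} (hρ : 0 < ρ) :
    IsStepSize γ 0 ρ := by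
  have hγ' : ∀ᶠ k : ℕ in atTop, γ (k + 1) = (C / (C' + k + 1)) ^ α := by
    filter_upwards [(tendsto_add_atTop_nat 1).eventually hγ] with k hk
    rw [hk]; push_cast; rw [add_assoc]
  have hinv : ∀ x : ℝ, 0 < x → ((C / x) ^ α)⁻¹ = (C ^ α)⁻¹ * x ^ α := by
    intro x hx
    rw [Real.div_rpow hC.le hx.le, inv_div, div_eq_mul_inv, mul_comm]
  have hden : Tendsto (fun n : ℕ => C' + (n : ℝ)) atTop atTop :=
    tendsto_atTop_add_const_left _ _ tendsto_natCast_atTop_atTop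
  have hzero : Tendsto γ atTop (𝓝 0) := by
    have := (hden.const_div_atTop C).rpow_const (p := α) (Or.inr hα0.le)
    rw [Real.zero_rpow hα0.ne'] at this
    exact this.congr' (hγ.mono fun n h => h.symm)
  refine ⟨hγ.mono fun n h => by rw [h]; positivity, ?_, ?_, hzero, ?_⟩
  · filter_upwards [hγ, hγ'] with n h1 h2
    rw [h1, h2, hinv _ (by positivity), hinv _ (by positivity), ← mul_sub]
    refine mul_nonneg (by positivity) (sub_nonneg.2 ?_)
    exact Real.rpow_le_rpow (by positivity) (by linarith) hα0.le
  · have hsmall : Tendsto (fun n : ℕ => (C ^ α)⁻¹ * (α * (C' + (n : ℝ)) ^ (-(1 - α)))) atTop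
        (𝓝 0) := by
      simpa using (((tendsto_rpow_neg_atTop (sub_pos.2 hα1)).comp hden).const_mul α).const_mul
        (C ^ α)⁻¹
    filter_upwards [hγ, hγ', hsmall.eventually (eventually_le_nhds hρ)] with n h1 h2 h3
    refine le_trans ?_ h3
    have hx : 0 < C' + (n : ℝ) := by positivity
    rw [h1, h2, hinv _ (by positivity), hinv _ (by positivity), ← mul_sub]
    refine mul_le_mul_of_nonneg_left ?_ (by positivity)
    set x := C' + (n : ℝ)
    have h4 : x + 1 = x * (1 + x⁻¹) := by field_simp
    have h5 : (1 + x⁻¹) ^ α ≤ 1 + α * x⁻¹ :=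
      rpow_one_add_le_one_add_mul_self (by have := inv_pos.2 hx; linarith) hα0.le hα1.le
    have h6 : x ^ (-(1 - α)) = x ^ α * x⁻¹ := by
      rw [← Real.rpow_neg_one, ← Real.rpow_add hx]; congr 1; ring
    rw [h4, Real.mul_rpow hx.le (by positivity), h6]
    have := mul_le_mul_of_nonneg_left h5 (Real.rpow_nonneg hx.le α)
    nlinarith
  · intro hs
    refine (isStepSize_of_eq_div (γ := fun n => C / (C' + n)) hC hC'
      (Eventually.of_forall fun _ => rfl)).not_summable
      (summable_of_isBigO_nat hs (Asymptotics.IsBigO.of_bound 1 ?_))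
    filter_upwards [hγ, (hden.const_div_atTop C).eventually (eventually_le_nhds one_pos)]
      with n h1 h2
    have hx : 0 < C / (C' + n) := by positivity
    rw [h1, one_mul, Real.norm_eq_abs, Real.norm_eq_abs, abs_of_pos hx, abs_of_pos (by positivity)]
    simpa using Real.rpow_le_rpow_of_exponent_ge hx h2 hα1.le

namespace IsReinforced

variable {Ω : Type*} {m : MeasurableSpace Ω} {P : Measure Ω} {ℱ : Filtration ℕ m}
  {p q y : ℝ} {γ : ℕ → ℝ} {E F : ℕ → Set Ω} {Y : ℕ → Ω → ℝ}

/-! ### The fast regime -/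

open Classical in
/-- The process that follows only the moves towards `0`. -/
noncomputable def pureDecay (γ : ℕ → ℝ) (F : ℕ → Set Ω) (n : ℕ) (ω : Ω) : ℝ :=
  ∏ k ∈ Finset.range n, if ω ∈ F k then 1 - γ (k + 1) else 1

theorem pureDecay_succ_of_mem (γ : ℕ → ℝ) {F : ℕ → Set Ω} {n : ℕ} {ω : Ω} (h : ω ∈ F n) :
    pureDecay γ F (n + 1) ω = (1 - γ (n + 1)) * pureDecay γ F n ω := by
  simp [pureDecay, Finset.prod_range_succ, h, mul_comm]

theorem pureDecay_succ_of_notMem (γ : ℕ → ℝ) {F : ℕ → Set Ω} {n : ℕ} {ω : Ω} (h : ω ∉ F n) :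
    pureDecay γ F (n + 1) ω = pureDecay γ F n ω := by
  simp [pureDecay, Finset.prod_range_succ, h]

theorem exists_pureDecay_ge (h : IsReinforced P ℱ p q y γ E F Y) (n : ℕ) :
    ∃ d, 0 < d ∧ ∀ ω, d ≤ pureDecay γ F n ω := by
  refine ⟨∏ k ∈ Finset.range n, (1 - γ (k + 1)),
    Finset.prod_pos fun k _ => sub_pos.2 (h.γ_lt_one k), fun ω => ?_⟩
  refine Finset.prod_le_prod (fun k _ => (sub_pos.2 (h.γ_lt_one k)).le) fun k _ => ?_
  have := h.γ_nonneg k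
  split_ifs <;> linarith

theorem pureDecay_pos (h : IsReinforced P ℱ p q y γ E F Y) (n : ℕ) (ω : Ω) :
    0 < pureDecay γ F n ω := by
  obtain ⟨d, hd, hle⟩ := h.exists_pureDecay_ge n
  exact hd.trans_le (hle ω)

theorem isBddMeas_pureDecay (h : IsReinforced P ℱ p q y γ E F Y) (n : ℕ) :
    IsBddMeas (ℱ n) (pureDecay γ F n) := by
  induction n with
  | zero =>
    have : pureDecay γ F 0 = fun _ => 1 := by funext ω; simp [pureDecay]
    rw [this]; exact IsBddMeas.const 1
  | succ n ih =>
    exact h.isBddMeas_of_step (fun ω hω => pureDecay_succ_of_notMem γ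
      fun h2 => disjoint_left.1 (h.disj n) hω h2) (fun ω hω => pureDecay_succ_of_mem γ hω)
      (fun ω _ hω => pureDecay_succ_of_notMem γ hω) ih ((IsBddMeas.const _).mul ih) ih

theorem isBddMeas_pureDecay_inv (h : IsReinforced P ℱ p q y γ E F Y) (n : ℕ) :
    IsBddMeas (ℱ n) (fun ω => (pureDecay γ F n ω)⁻¹) := by
  obtain ⟨d, hd, hle⟩ := h.exists_pureDecay_ge n
  exact (h.isBddMeas_pureDecay n).inv hd hle

/-- `pureDecay` divided by its compensator is a nonnegative martingale. -/
theorem ae_tendsto_pureDecay_mul_inv [IsFiniteMeasure P] (h : IsReinforced P ℱ p q y γ E F Y) :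
    ∀ᵐ ω ∂P, ∃ L, Tendsto (fun n => pureDecay γ F n ω * (decay γ Y q n ω)⁻¹) atTop (𝓝 L) := by
  have hZ := h.isBddMeas_pureDecay
  have hc := fun (n : ℕ) (c : ℝ) => IsBddMeas.const (m := ℱ n) c
  have hq := h.q_mem.2
  have hD := h.isBddMeas_decay_inv hq
  have hD' := h.isBddMeas_decay_succ_inv hq
  have := h.robbins_siegmund (V := fun n ω => pureDecay γ F n ω * (decay γ Y q n ω)⁻¹)
    (a := fun _ _ => 0) (b := fun _ _ => 0) (G := fun n => univ)
    (v0 := fun n ω => pureDecay γ F n ω * (decay γ Y q (n + 1) ω)⁻¹)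
    (vE := fun n ω => pureDecay γ F n ω * (decay γ Y q (n + 1) ω)⁻¹)
    (vF := fun n ω => ((1 - γ (n + 1)) * pureDecay γ F n ω) * (decay γ Y q (n + 1) ω)⁻¹)
    (fun n ω => mul_nonneg (h.pureDecay_pos n ω).le (inv_nonneg.2 (h.decay_pos hq n ω).le))
    (fun _ _ => le_rfl) (fun _ _ => le_rfl)
    (fun n => (hZ n).mul (hD n)) (fun n => hc n 0) (fun n => hc n 0)
    (fun n => @MeasurableSet.univ _ (ℱ n))
    (fun n ω hω => by
      rw [pureDecay_succ_of_notMem γ fun h2 => disjoint_left.1 (h.disj n) hω h2])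
    (fun n ω hω => by rw [pureDecay_succ_of_mem γ hω])
    (fun n ω _ h2 => by rw [pureDecay_succ_of_notMem γ h2])
    (fun n => (hZ n).mul (hD' n))
    (fun n => ((hc n _).mul (hZ n)).mul (hD' n)) (fun n => (hZ n).mul (hD' n))
    (Eventually.of_forall fun n ω _ => ?_)
  · filter_upwards [this] with ω hω
    exact (hω (Eventually.of_forall fun _ => mem_univ _) summable_zero).1
  · have h1 := h.decay_pos hq n ω
    have h2 := h.decay_pos hq (n + 1) ω
    rw [decay_succ] at h2 ⊢
    have h3 := pos_of_mul_pos_right h2 h1.le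
    apply le_of_eq
    set d := decay γ Y q n ω
    set Z := pureDecay γ F n ω
    set f := 1 - q * (γ (n + 1) * (1 - Y n ω)) with hf
    have e : Z * (d * f)⁻¹ + p * Y n ω * (Z * (d * f)⁻¹ - Z * (d * f)⁻¹)
          + q * (1 - Y n ω) * ((1 - γ (n + 1)) * Z * (d * f)⁻¹ - Z * (d * f)⁻¹)
          = Z * f * (d * f)⁻¹ := by rw [hf]; ring
    rw [e]
    field_simp
    ring

/-- The inverse of that ratio is an almost supermartingale, so the ratio has a positive limit. -/
theorem ae_tendsto_decay_mul_pureDecay_inv [IsFiniteMeasure P]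
    (h : IsReinforced P ℱ p q y γ E F Y) (hγ0 : Tendsto γ atTop (𝓝 0))
    (hγ2 : Summable fun n => γ (n + 1) ^ 2) :
    ∀ᵐ ω ∂P, ∃ L, Tendsto (fun n => decay γ Y q n ω * (pureDecay γ F n ω)⁻¹) atTop (𝓝 L) := by
  have hZi := h.isBddMeas_pureDecay_inv
  have hc := fun (n : ℕ) (c : ℝ) => IsBddMeas.const (m := ℱ n) c
  have hq := h.q_mem.2
  have hD := h.isBddMeas_decay q
  have hD' := h.isBddMeas_decay_succ q
  have := h.robbins_siegmund (V := fun n ω => decay γ Y q n ω * (pureDecay γ F n ω)⁻¹)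
    (a := fun n _ => 2 * γ (n + 1) ^ 2) (b := fun _ _ => 0) (G := fun n => univ)
    (v0 := fun n ω => decay γ Y q (n + 1) ω * (pureDecay γ F n ω)⁻¹)
    (vE := fun n ω => decay γ Y q (n + 1) ω * (pureDecay γ F n ω)⁻¹)
    (vF := fun n ω => decay γ Y q (n + 1) ω * ((1 - γ (n + 1))⁻¹ * (pureDecay γ F n ω)⁻¹))
    (fun n ω => mul_nonneg (h.decay_pos hq n ω).le (inv_nonneg.2 (h.pureDecay_pos n ω).le))
    (fun _ _ => by positivity) (fun _ _ => le_rfl)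
    (fun n => (hD n).mul (hZi n)) (fun n => hc n _) (fun n => hc n 0)
    (fun n => @MeasurableSet.univ _ (ℱ n))
    (fun n ω hω => by
      rw [pureDecay_succ_of_notMem γ fun h2 => disjoint_left.1 (h.disj n) hω h2])
    (fun n ω hω => by rw [pureDecay_succ_of_mem γ hω, mul_inv])
    (fun n ω _ h2 => by rw [pureDecay_succ_of_notMem γ h2])
    (fun n => (hD' n).mul (hZi n)) (fun n => (hD' n).mul ((hc n _).mul (hZi n)))
    (fun n => (hD' n).mul (hZi n)) ?_
  · filter_upwards [this] with ω hω
    exact (hω (Eventually.of_forall fun _ => mem_univ _) (hγ2.mul_left 2)).1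
  · filter_upwards [((tendsto_add_atTop_iff_nat 1).2 hγ0).eventually
      (eventually_le_nhds (show (0 : ℝ) < 1 / 2 by norm_num))] with n hn ω _
    have hg := h.γ_nonneg n
    have h1 := h.decay_pos hq n ω
    have h2 := h.decay_pos hq (n + 1) ω
    have hZ := inv_pos.2 (h.pureDecay_pos n ω)
    have e := decay_succ γ Y q n ω
    have hY0 := h.nonneg n ω
    have hY1 := h.le_one n ω
    have hq0 := h.q_mem.1
    set g := γ (n + 1)
    set t := g * (1 - Y n ω) with ht
    set d := decay γ Y q n ω
    set d' := decay γ Y q (n + 1) ω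
    set Z' := (pureDecay γ F n ω)⁻¹
    have ht0 : 0 ≤ t := mul_nonneg hg (by linarith)
    have htg : t ≤ g := by nlinarith
    have hi : (1 - g)⁻¹ ≤ 1 + 2 * g := by
      rw [inv_le_iff_one_le_mul₀ (by linarith)]; nlinarith
    have hi2 : (1 - g)⁻¹ - 1 = g * (1 - g)⁻¹ := by
      have : 1 - g ≠ 0 := by linarith
      field_simp; ring
    calc d' * Z' + p * Y n ω * (d' * Z' - d' * Z')
          + q * (1 - Y n ω) * (d' * ((1 - g)⁻¹ * Z') - d' * Z')
        = d' * Z' * (1 + q * (1 - Y n ω) * ((1 - g)⁻¹ - 1)) := by ring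
      _ = d' * Z' * (1 + q * t * (1 - g)⁻¹) := by rw [hi2, ht]; ring
      _ ≤ d' * Z' * (1 + q * t * (1 + 2 * g)) := by gcongr
      _ = d * Z' * ((1 - q * t) * (1 + q * t * (1 + 2 * g))) := by rw [e]; ring
      _ ≤ d * Z' * (1 + 2 * g ^ 2) := by
          have a1 : 0 ≤ q * t := by positivity
          have a2 : q * t ≤ g := by nlinarith
          have a3 : q * t * g ≤ g * g := by gcongr
          gcongr
          nlinarith [mul_nonneg (mul_nonneg a1 a1) hg, mul_nonneg a1 a1]
      _ = _ := by ring

/-- If the moves towards `1` stop, `Y n` is asymptotic to a positive multiple of the decay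
compensator of the moves towards `0`. -/
theorem ae_tendsto_fast [IsFiniteMeasure P] (h : IsReinforced P ℱ p q y γ E F Y)
    (hy : 0 < y) (hγ0 : Tendsto γ atTop (𝓝 0)) (hγ2 : Summable fun n => γ (n + 1) ^ 2) :
    ∀ᵐ ω ∂P, Summable (fun n => Y n ω) →
      ∃ L, 0 < L ∧ Tendsto (fun n => Y n ω * (decay γ Y q n ω)⁻¹) atTop (𝓝 L) := by
  filter_upwards [h.ae_tendsto_pureDecay_mul_inv, h.ae_tendsto_decay_mul_pureDecay_inv hγ0 hγ2,
    h.ae_summable_iff] with ω ⟨L, hL⟩ ⟨L', hL'⟩ h3 hs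
  obtain ⟨N, hN⟩ := eventually_atTop.1 (h3.1 hs)
  have h1 : L * L' = 1 := by
    refine tendsto_nhds_unique (hL.mul hL') (tendsto_const_nhds.congr fun n => ?_)
    have a1 := h.decay_pos h.q_mem.2 n ω
    have a2 := h.pureDecay_pos n ω
    field_simp
  have hL0 : 0 ≤ L := ge_of_tendsto' hL fun n =>
    mul_nonneg (h.pureDecay_pos n ω).le (inv_nonneg.2 (h.decay_pos h.q_mem.2 n ω).le)
  have hL1 : 0 < L := lt_of_le_of_ne hL0 fun h => by rw [← h] at h1; simp at h1
  set c := Y N ω / pureDecay γ F N ω with hc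
  have hZN := h.pureDecay_pos N ω
  have hc0 : 0 < c := div_pos (h.pos hy N ω) hZN
  have hYZ : ∀ n, N ≤ n → Y n ω = c * pureDecay γ F n ω := by
    intro n hn
    induction n, hn using Nat.le_induction with
    | base => rw [hc]; field_simp
    | succ n hn ih =>
      by_cases hF : ω ∈ F n
      · rw [h.step_F n ω hF, ih, pureDecay_succ_of_mem γ hF]; ring
      · rw [h.step_else n ω (hN n hn) hF, ih, pureDecay_succ_of_notMem γ hF]
  refine ⟨c * L, mul_pos hc0 hL1, (hL.const_mul c).congr' ?_⟩
  filter_upwards [eventually_ge_atTop N] with n hn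
  rw [hYZ n hn, mul_assoc]

/-! ### Rates for harmonic step sizes -/

/-- For harmonic step sizes the compensator of intensity `c` is of exact order `n ^ (-C c)`. -/
theorem hasRate_of_tendsto (h : IsReinforced P ℱ p q y γ E F Y) {C C' c : ℝ} (hC : 0 < C)
    (hC' : 0 < C') (hγ : ∀ᶠ n : ℕ in atTop, γ n = C / (C' + n)) (hc : c < 1) {ω : Ω}
    (hs : Summable fun n => γ (n + 1) * Y n ω)
    (hL : ∃ L, 0 < L ∧ Tendsto (fun n => Y n ω * (decay γ Y c n ω)⁻¹) atTop (𝓝 L)) :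
    HasRate (fun n => Y n ω) (C * c) := by
  obtain ⟨L, hL, hlim⟩ := hL
  have hpos : ∀ k, 0 < 1 - c * (γ (k + 1) * (1 - Y k ω)) := fun k =>
    (lt_min one_pos (sub_pos.2 hc)).trans_le (h.decay_factor_ge c k ω)
  obtain ⟨L', hL', hlim'⟩ := exists_tendsto_rpow_mul_prod (c := c) hC hC' hγ
    (fun k => h.mem_Icc k ω) hpos hs
  refine ⟨L' * L, mul_pos hL' hL, (hlim'.mul hlim).congr fun n => ?_⟩
  have := h.decay_pos hc n ω
  change (n : ℝ) ^ (C * c) * decay γ Y c n ω * (Y n ω * (decay γ Y c n ω)⁻¹) = _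
  field_simp

theorem ae_hasRate_slow [IsFiniteMeasure P] (h : IsReinforced P ℱ p q y γ E F Y) (hy : 0 < y)
    {C C' : ℝ} (hC : 0 < C) (hC' : 0 < C') (hγ : ∀ᶠ n : ℕ in atTop, γ n = C / (C' + n))
    (hpq : p < q) (hCpq : C * (q - p) < 1) :
    ∀ᵐ ω ∂P, Tendsto (fun n => Y n ω) atTop (𝓝 0) → ¬ Summable (fun n => Y n ω) →
      HasRate (fun n => Y n ω) (C * (q - p)) := by
  filter_upwards [h.ae_tendsto_slow hy (isStepSize_of_eq_div hC hC' hγ) (by positivity)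
    (by rw [lt_div_iff₀ hC]; linarith), h.ae_summable_step_mul hpq.ne] with ω h1 h2 h0 hns
  exact h.hasRate_of_tendsto hC hC' hγ (by linarith [h.q_mem.2, h.p_mem.1]) (h2 h0) (h1 h0 hns)

theorem ae_hasRate_fast [IsFiniteMeasure P] (h : IsReinforced P ℱ p q y γ E F Y) (hy : 0 < y)
    {C C' : ℝ} (hC : 0 < C) (hC' : 0 < C') (hγ : ∀ᶠ n : ℕ in atTop, γ n = C / (C' + n)) :
    ∀ᵐ ω ∂P, Summable (fun n => Y n ω) → HasRate (fun n => Y n ω) (C * q) := by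
  have hγ2 : Summable fun n => γ (n + 1) ^ 2 := by
    refine summable_of_isBigO_nat (summable_inv_succ_sq (C ^ 2)) (Asymptotics.IsBigO.of_bound 1 ?_)
    filter_upwards [(tendsto_add_atTop_nat 1).eventually hγ] with n hn
    rw [hn, one_mul, Real.norm_eq_abs, Real.norm_eq_abs, abs_of_nonneg (by positivity),
      abs_of_nonneg (by positivity), ← mul_pow, ← div_eq_mul_inv]
    push_cast
    refine pow_le_pow_left₀ (by positivity) ?_ 2
    exact div_le_div_of_nonneg_left hC.le (by positivity) (by linarith)
  filter_upwards [h.ae_tendsto_fast hy (isStepSize_of_eq_div hC hC' hγ).tendsto hγ2] with ω h1 hs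
  refine h.hasRate_of_tendsto hC hC' hγ h.q_mem.2 ?_ (h1 hs)
  exact Summable.of_nonneg_of_le (fun n => mul_nonneg (h.γ_nonneg n) (h.nonneg n ω))
    (fun n => mul_le_of_le_one_left (h.nonneg n ω) (h.γ_lt_one n).le) hs

/-- A fast rate `n ^ (-C q)` with `C q ≤ 1` would not be summable, so convergence is never fast. -/
theorem ae_not_summable [IsFiniteMeasure P] (h : IsReinforced P ℱ p q y γ E F Y) (hy : 0 < y)
    {C C' : ℝ} (hC : 0 < C) (hC' : 0 < C') (hγ : ∀ᶠ n : ℕ in atTop, γ n = C / (C' + n))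
    (hCq : C * q ≤ 1) : ∀ᵐ ω ∂P, ¬ Summable (fun n => Y n ω) := by
  filter_upwards [h.ae_hasRate_fast hy hC hC' hγ] with ω h1 hs
  exact (h1 hs).not_summable (fun n => h.nonneg n ω) hCq hs

end IsReinforced

namespace IsReinforced

variable {Ω : Type*} {m : MeasurableSpace Ω} {P : Measure Ω} {ℱ : Filtration ℕ m}
  {p q y : ℝ} {γ : ℕ → ℝ} {E F : ℕ → Set Ω} {Y : ℕ → Ω → ℝ} {ρ₁ ρ₂ : ℝ}

/-! ### Finite runs of prescribed moves -/

/-- The event that the first `n` moves are of the prescribed types `T`. -/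
def run (T : ℕ → Set Ω) (n : ℕ) : Set Ω := {ω | ∀ k < n, ω ∈ T k}

theorem run_succ (T : ℕ → Set Ω) (n : ℕ) : run T (n + 1) = run T n ∩ T n := by
  ext ω
  exact ⟨fun h => ⟨fun k hk => h k (by omega), h n (by omega)⟩, fun h k hk =>
    (Nat.lt_succ_iff_lt_or_eq.1 hk).elim (h.1 k) fun e => e ▸ h.2⟩

theorem measurableSet_run {T : ℕ → Set Ω} {n : ℕ} (hT : ∀ k < n, MeasurableSet[ℱ (k + 1)] (T k)) :
    MeasurableSet[ℱ n] (run T n) := by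
  have e : run T n = ⋂ k, ⋂ (_ : k < n), T k := by ext ω; simp [run]
  rw [e]
  exact @MeasurableSet.iInter _ _ (ℱ n) _ _ fun k => @MeasurableSet.iInter _ _ (ℱ n) _ _ fun hk =>
    ℱ.mono (Nat.succ_le_of_lt hk) _ (hT k hk)

theorem setIntegral_run_succ [IsFiniteMeasure P] {T : ℕ → Set Ω} {n : ℕ} {W : Ω → ℝ}
    (hT : ∀ k < n + 1, MeasurableSet[ℱ (k + 1)] (T k)) (hW : Integrable ((T n).indicator W) P) :
    ∫ ω in run T (n + 1), W ω ∂P = ∫ ω in run T n, (P[(T n).indicator W | ℱ n]) ω ∂P := by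
  rw [setIntegral_condExp (ℱ.le n) hW (measurableSet_run fun k hk => hT k (by omega)),
    setIntegral_indicator (ℱ.le _ _ (hT n (by omega))), run_succ]

/-- If each prescribed move has conditional probability at least `c > 0` after a successful run,
then the run has positive probability. -/
theorem run_pos [IsProbabilityMeasure P] {T : ℕ → Set Ω} {c : ℝ} (hc : 0 < c) (n : ℕ)
    (hT : ∀ k < n, MeasurableSet[ℱ (k + 1)] (T k))
    (h : ∀ k < n, ∀ᵐ ω ∂P, ω ∈ run T k → c ≤ (P[(T k).indicator (1 : Ω → ℝ) | ℱ k]) ω) :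
    0 < P.real (run T n) := by
  induction n with
  | zero => simp [run]
  | succ n ih =>
    have ih := ih (fun k hk => hT k (by omega)) (fun k hk => h k (by omega))
    have hR : MeasurableSet (run T n) := ℱ.le n _ (measurableSet_run fun k hk => hT k (by omega))
    have hi : Integrable ((T n).indicator (1 : Ω → ℝ)) P :=
      (integrable_const 1).indicator (ℱ.le _ _ (hT n (by omega)))
    have e := setIntegral_run_succ (P := P) (W := 1) hT hi
    have e2 : ∫ ω in run T (n + 1), (1 : Ω → ℝ) ω ∂P = P.real (run T (n + 1)) := by simp
    rw [← e2, e]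
    have h1 : ∫ ω in run T n, c ∂P ≤ ∫ ω in run T n, (P[(T n).indicator 1 | ℱ n]) ω ∂P := by
      refine setIntegral_mono_on_ae (integrable_const c).integrableOn
        integrable_condExp.integrableOn hR (h n (by omega))
    refine lt_of_lt_of_le ?_ h1
    simpa using mul_pos ih hc

/-! ### Absorption at the end points -/

/-- Started at `0`, the process stays there. -/
theorem ae_eq_zero [IsFiniteMeasure P] (h : IsReinforced P ℱ p q 0 γ E F Y) :
    ∀ᵐ ω ∂P, ∀ n, Y n ω = 0 := by
  rw [ae_all_iff]
  intro n
  induction n with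
  | zero => exact ae_of_all _ h.zero
  | succ n ih =>
    have hE : P (E n) = 0 := by
      have hm : MeasurableSet (E n) := ℱ.le _ _ (h.measE n)
      have h1 : ∫ ω, (E n).indicator (1 : Ω → ℝ) ω ∂P = 0 := by
        rw [← integral_condExp (ℱ.le n)]
        refine integral_eq_zero_of_ae ?_
        filter_upwards [h.condE n, ih] with ω h1 h2
        rw [h1, h2]; simp
      rw [integral_indicator_one hm] at h1
      simpa [measureReal_def, ENNReal.toReal_eq_zero_iff] using h1
    filter_upwards [ih, measure_eq_zero_iff_ae_notMem.1 hE] with ω h1 h2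
    by_cases hF : ω ∈ F n
    · rw [h.step_F n ω hF, h1, mul_zero]
    · rw [h.step_else n ω h2 hF, h1]

/-! ### Positive probability of fast convergence -/

theorem le_exp_of_run (h : IsReinforced P ℱ p q y γ E F Y) {n : ℕ} {ω : Ω}
    (hω : ω ∈ run F n) : Y n ω ≤ y * Real.exp (-∑ k ∈ Finset.range n, γ (k + 1)) := by
  induction n with
  | zero => simp [h.zero]
  | succ n ih =>
    rw [run_succ] at hω
    rw [h.step_F n ω hω.2, Finset.sum_range_succ, neg_add, Real.exp_add]
    have h1 := Real.add_one_le_exp (-γ (n + 1))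
    have h2 := sub_pos.2 (h.γ_lt_one n)
    calc (1 - γ (n + 1)) * Y n ω ≤ Real.exp (-γ (n + 1)) *
          (y * Real.exp (-∑ k ∈ Finset.range n, γ (k + 1))) := by
          refine mul_le_mul (by linarith) (ih hω.1) (h.nonneg n ω) (Real.exp_pos _).le
      _ = _ := by ring

theorem le_of_forall_notMem (h : IsReinforced P ℱ p q y γ E F Y) {N n : ℕ} (hn : N ≤ n) {ω : Ω}
    (hω : ∀ k, N ≤ k → k < n → ω ∉ E k) : Y n ω ≤ Y N ω := by
  induction n, hn using Nat.le_induction with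
  | base => exact le_rfl
  | succ n hn ih =>
    have ih := ih fun k h1 h2 => hω k h1 (by omega)
    by_cases hF : ω ∈ F n
    · rw [h.step_F n ω hF]
      exact (mul_le_of_le_one_left (h.nonneg n ω) (by linarith [h.γ_nonneg n])).trans ih
    · rwa [h.step_else n ω (hω n hn (by omega)) hF]

/-- For small `Y`, the function `exp (-K * Y / g)`, set to `0` after a move towards `1`, does not
decrease in mean in one step. -/
theorem exp_step_le {p q Y g g' ρ K ε : ℝ} (hp : p ∈ Ioo (0 : ℝ) 1) (hq : q ∈ Ioo (0 : ℝ) 1)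
    (hY : 0 ≤ Y) (hY1 : Y ≤ 1) (hYε : Y ≤ ε) (hg' : 0 < g') (hρ0 : 0 ≤ ρ)
    (hρ : g'⁻¹ - g⁻¹ ≤ ρ) (hK : 0 < K) (hK1 : K * (q - ρ) = 2 * p)
    (hε : ε * (q * K + K * ρ * (q * K)) ≤ p) (hε2 : K * ρ * ε ≤ 1) :
    Real.exp (-(K * Y * g⁻¹)) ≤
      Real.exp (-(K * Y * g'⁻¹)) + p * Y * (0 - Real.exp (-(K * Y * g'⁻¹)))
        + q * (1 - Y) * (Real.exp (-(K * ((1 - g') * Y) * g'⁻¹)) - Real.exp (-(K * Y * g'⁻¹))) := by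
  have e1 : Real.exp (-(K * ((1 - g') * Y) * g'⁻¹))
      = Real.exp (-(K * Y * g'⁻¹)) * Real.exp (K * Y) := by
    rw [← Real.exp_add]; congr 1; field_simp; ring
  have e2 : Real.exp (-(K * Y * g'⁻¹))
      = Real.exp (-(K * Y * g⁻¹)) * Real.exp (-(K * Y * (g'⁻¹ - g⁻¹))) := by
    rw [← Real.exp_add]; congr 1; ring
  have h1 : 1 - K * ρ * Y ≤ Real.exp (-(K * Y * (g'⁻¹ - g⁻¹))) := by
    refine le_trans ?_ (Real.add_one_le_exp _)
    have : K * Y * (g'⁻¹ - g⁻¹) ≤ K * Y * ρ := by gcongr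
    linarith
  have h2 : 1 + K * Y ≤ Real.exp (K * Y) := by linarith [Real.add_one_le_exp (K * Y)]
  have hq1 : 0 ≤ q * (1 - Y) := mul_nonneg hq.1.le (by linarith)
  have h3 : 1 - p * Y + q * (1 - Y) * (K * Y)
      ≤ 1 - p * Y + q * (1 - Y) * (Real.exp (K * Y) - 1) := by
    gcongr; linarith
  have h4 : 0 ≤ 1 - K * ρ * Y := by
    have : K * ρ * Y ≤ K * ρ * ε := by gcongr
    linarith
  have h5 : 0 ≤ 1 - p * Y + q * (1 - Y) * (K * Y) := by
    have : 0 ≤ q * (1 - Y) * (K * Y) := mul_nonneg hq1 (by positivity)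
    have : p * Y ≤ 1 := by nlinarith [hp.1, hp.2]
    linarith
  have h6 : 1 ≤ (1 - K * ρ * Y) * (1 - p * Y + q * (1 - Y) * (K * Y)) := by
    have a1 : Y * (q * K + K * ρ * (q * K)) ≤ p := by
      refine le_trans ?_ hε
      have := hq.1.le
      gcongr
    have a2 : 0 ≤ K * ρ * Y * p + K * ρ * Y * Y * q * K := by
      have := hp.1.le
      have := hq.1.le
      positivity
    have a3 : (1 - K * ρ * Y) * (1 - p * Y + q * (1 - Y) * (K * Y))
        = 1 + Y * (K * (q - ρ) - p - Y * (q * K + K * ρ * (q * K))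
          + (K * ρ * Y * p + K * ρ * Y * Y * q * K)) := by ring
    rw [a3, hK1]
    have : 0 ≤ Y * (2 * p - p - Y * (q * K + K * ρ * (q * K))
          + (K * ρ * Y * p + K * ρ * Y * Y * q * K)) := mul_nonneg hY (by linarith)
    linarith
  calc Real.exp (-(K * Y * g⁻¹)) = Real.exp (-(K * Y * g⁻¹)) * 1 := (mul_one _).symm
    _ ≤ Real.exp (-(K * Y * g⁻¹)) * (Real.exp (-(K * Y * (g'⁻¹ - g⁻¹)))
          * (1 - p * Y + q * (1 - Y) * (Real.exp (K * Y) - 1))) := by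
        gcongr
        exact h6.trans (mul_le_mul h1 h3 h5 (Real.exp_pos _).le)
    _ = _ := by rw [e1, e2]; ring

/-- If the moves towards `0` are strong enough, then with positive probability the moves towards
`1` stop and `Y` tends to `0` at a fast rate. -/
theorem not_ae_not_summable [IsProbabilityMeasure P] (h : IsReinforced P ℱ p q y γ E F Y)
    (hy : y < 1) (hγ : IsStepSize γ ρ₁ ρ₂) (hρ0 : 0 ≤ ρ₂) (hρ : ρ₂ < q) :
    ¬ ∀ᵐ ω ∂P, ¬ Summable (fun n => Y n ω) := by
  have hp := h.p_mem.1
  have hq := h.q_mem.1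
  set K := 2 * p / (q - ρ₂) with hK
  have hqρ : 0 < q - ρ₂ := by linarith
  have hK0 : 0 < K := by positivity
  have hK1 : K * (q - ρ₂) = 2 * p := by rw [hK]; field_simp
  obtain ⟨ε, hε0, hε1, hε2⟩ : ∃ ε, 0 < ε ∧ ε * (q * K + K * ρ₂ * (q * K)) ≤ p ∧ K * ρ₂ * ε ≤ 1 := by
    refine ⟨min (p / (q * K + K * ρ₂ * (q * K))) (1 / (K * ρ₂ + 1)), by positivity, ?_, ?_⟩
    · rw [← le_div_iff₀ (by positivity)]; exact min_le_left _ _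
    · have h1 := min_le_right (p / (q * K + K * ρ₂ * (q * K))) (1 / (K * ρ₂ + 1))
      rw [le_div_iff₀ (by positivity)] at h1
      have : 0 < min (p / (q * K + K * ρ₂ * (q * K))) (1 / (K * ρ₂ + 1)) := by positivity
      nlinarith
  -- after a long run of moves towards `0`, the process is below `ε`
  have hexp : Tendsto (fun n => y * Real.exp (-∑ k ∈ Finset.range n, γ (k + 1))) atTop (𝓝 0) := by
    have := (Real.tendsto_exp_neg_atTop_nhds_zero.comp
      ((not_summable_iff_tendsto_nat_atTop_of_nonneg h.γ_nonneg).1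
        hγ.not_summable_succ)).const_mul y
    simpa using this
  obtain ⟨N, hN⟩ := eventually_atTop.1 ((hexp.eventually (eventually_le_nhds hε0)).and
    (hγ.pos.and (hγ.eventually_pos_succ.and hγ.inc_le)))
  -- only moves towards `0` before time `N`, and no move towards `1` afterwards
  set T : ℕ → Set Ω := fun k => if k < N then F k else (E k)ᶜ with hT
  have hTm : ∀ k, MeasurableSet[ℱ (k + 1)] (T k) := by
    intro k
    simp only [hT]
    split_ifs
    · exact h.measF k
    · exact (h.measE k).compl
  have hTE : ∀ ω n k, N ≤ k → k < n → ω ∈ run T n → ω ∉ E k := by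
    intro ω n k h1 h2 hω
    have := hω k h2
    simpa [hT, not_lt.2 h1] using this
  have hTF : ∀ ω n, n ≤ N → ω ∈ run T n → ω ∈ run F n := by
    intro ω n h1 hω k hk
    have := hω k hk
    simpa [hT, show k < N by omega] using this
  have hTε : ∀ ω n, N ≤ n → ω ∈ run T n → Y n ω ≤ ε := by
    intro ω n h1 hω
    refine (h.le_of_forall_notMem h1 fun k hk1 hk2 => hTE ω n k hk1 hk2 hω).trans ?_
    exact (h.le_exp_of_run (hTF ω N le_rfl fun k hk => hω k (by omega))).trans (hN N le_rfl).1
  have hRm : ∀ n, MeasurableSet (run T n) := fun n =>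
    ℱ.le n _ (measurableSet_run fun k _ => hTm k)
  have hRN : 0 < P.real (run T N) := by
    refine run_pos (ℱ := ℱ) (c := q * (1 - y)) (mul_pos hq (by linarith)) N (fun k _ => hTm k) ?_
    intro k hk
    have e : T k = F k := by simp [hT, hk]
    rw [e]
    filter_upwards [h.condF k] with ω h1 h2
    rw [h1]
    have h3 := h.le_exp_of_run (hTF ω k hk.le h2)
    have h4 : Real.exp (-∑ j ∈ Finset.range k, γ (j + 1)) ≤ 1 :=
      Real.exp_le_one_iff.2 (neg_nonpos.2 (Finset.sum_nonneg fun j _ => h.γ_nonneg j))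
    have h5 : Y k ω ≤ y := h3.trans (mul_le_of_le_one_right h.y_mem.1 h4)
    gcongr
  set V : ℕ → Ω → ℝ := fun n ω => Real.exp (-(K * Y n ω * (γ n)⁻¹)) with hV
  have hc := fun (n : ℕ) (c : ℝ) => IsBddMeas.const (m := ℱ n) c
  have hbm : ∀ (n : ℕ) (f : Ω → ℝ) (c : ℝ), 0 ≤ c → (∀ ω, 0 ≤ f ω) → IsBddMeas (ℱ n) f →
      IsBddMeas (ℱ n) (fun ω => Real.exp (-(K * f ω * c))) := by
    intro n f c hc0 hf0 hf
    refine ⟨(((hf.1.const_mul K).mul_const c).neg).exp, 1, fun ω => ?_⟩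
    rw [abs_of_pos (Real.exp_pos _)]
    exact Real.exp_le_one_iff.2 (neg_nonpos.2 (mul_nonneg (mul_nonneg hK0.le (hf0 ω)) hc0))
  have hVm : ∀ n, N ≤ n → IsBddMeas (ℱ n) (V n) := fun n hn =>
    hbm n _ _ (inv_nonneg.2 (hN n hn).2.1.le) (h.nonneg n) (h.isBddMeas n)
  have hVi : ∀ n, N ≤ n → Integrable (V n) P := fun n hn => (hVm n hn).integrable (P := P) (ℱ.le n)
  have hstep : ∀ n, N ≤ n → ∫ ω in run T n, V n ω ∂P ≤ ∫ ω in run T (n + 1), V (n + 1) ω ∂P := by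
    intro n hn
    have e : T n = (E n)ᶜ := by simp [hT, not_lt.2 hn]
    have hi : Integrable ((T n).indicator (V (n + 1))) P :=
      (hVi (n + 1) (by omega)).indicator (ℱ.le _ _ (hTm n))
    rw [setIntegral_run_succ (fun k _ => hTm k) hi]
    refine setIntegral_mono_on_ae (hVi n hn).integrableOn integrable_condExp.integrableOn (hRm n) ?_
    have hg := (hN n hn).2.2.1
    have hg1 := h.γ_lt_one n
    have h1 := h.condExp_step (n := n) (W := (T n).indicator (V (n + 1))) (vE := fun _ => 0)
      (vF := fun ω => Real.exp (-(K * ((1 - γ (n + 1)) * Y n ω) * (γ (n + 1))⁻¹)))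
      (v0 := fun ω => Real.exp (-(K * Y n ω * (γ (n + 1))⁻¹)))
      (fun ω hω => by rw [e, indicator_of_notMem (by simpa using hω)])
      (fun ω hω => by
        have : ω ∈ T n := by
          rw [e]; exact fun h2 => disjoint_left.1 (h.disj n) h2 hω
        rw [indicator_of_mem this, hV]
        simp only [h.step_F n ω hω])
      (fun ω h1 h2 => by
        have : ω ∈ T n := by rw [e]; exact h1
        rw [indicator_of_mem this, hV]
        simp only [h.step_else n ω h1 h2])
      (hc n 0)
      (hbm n _ _ (inv_nonneg.2 hg.le) (fun ω => mul_nonneg (by linarith) (h.nonneg n ω))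
        ((hc n _).mul (h.isBddMeas n)))
      (hbm n _ _ (inv_nonneg.2 hg.le) (h.nonneg n) (h.isBddMeas n))
    filter_upwards [h1] with ω h1 hω
    rw [h1]
    exact exp_step_le h.p_mem h.q_mem (h.nonneg n ω) (h.le_one n ω) (hTε ω n hn hω) hg hρ0
      (hN n hn).2.2.2 hK0 hK1 hε1 hε2
  have hlow : ∀ n, N ≤ n → ∫ ω in run T N, V N ω ∂P ≤ P.real (run T n) := by
    intro n hn
    have h1 : ∫ ω in run T N, V N ω ∂P ≤ ∫ ω in run T n, V n ω ∂P := by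
      induction n, hn using Nat.le_induction with
      | base => exact le_rfl
      | succ n hn ih => exact ih.trans (hstep n hn)
    refine h1.trans ?_
    have h2 : ∫ ω in run T n, V n ω ∂P ≤ ∫ ω in run T n, (1 : ℝ) ∂P := by
      refine setIntegral_mono (hVi n hn).integrableOn (integrable_const 1).integrableOn fun ω => ?_
      exact Real.exp_le_one_iff.2 (neg_nonpos.2 (mul_nonneg (mul_nonneg hK0.le (h.nonneg n ω))
        (inv_nonneg.2 (hN n hn).2.1.le)))
    simpa using h2
  have hpos : 0 < ∫ ω in run T N, V N ω ∂P := by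
    have h1 : ∫ ω in run T N, Real.exp (-(K * 1 * (γ N)⁻¹)) ∂P ≤ ∫ ω in run T N, V N ω ∂P := by
      refine setIntegral_mono (integrable_const _).integrableOn (hVi N le_rfl).integrableOn
        fun ω => ?_
      have := inv_nonneg.2 (hN N le_rfl).2.1.le
      have := h.le_one N ω
      simp only [hV]
      gcongr
    refine lt_of_lt_of_le ?_ h1
    simpa using mul_pos hRN (Real.exp_pos _)
  intro hcon
  have hzero : P (⋂ n, run T n) = 0 := by
    rw [measure_eq_zero_iff_ae_notMem]
    filter_upwards [hcon, h.ae_summable_iff] with ω h1 h2 hω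
    refine h1 (h2.2 (eventually_atTop.2 ⟨N, fun n hn => ?_⟩))
    exact hTE ω (n + 1) n hn (by omega) (mem_iInter.1 hω (n + 1))
  have hanti : Antitone (run T) := fun i j hij ω hω k hk => hω k (by omega)
  have hlim := tendsto_measure_iInter_atTop (μ := P) (fun n => (hRm n).nullMeasurableSet) hanti
    ⟨0, measure_ne_top P _⟩
  rw [hzero] at hlim
  have hlim2 : Tendsto (fun n => P.real (run T n)) atTop (𝓝 0) := by
    have := (ENNReal.tendsto_toReal ENNReal.zero_ne_top).comp hlim
    rwa [ENNReal.toReal_zero] at this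
  have := ge_of_tendsto hlim2 (eventually_atTop.2 ⟨N, hlow⟩)
  linarith

/-! ### Positive probability of slow convergence -/

/-- If the drift towards `0` is weak, then with positive probability `Y` tends to `0` at a slow
rate. Otherwise `Y n + K * min (γ n / Y n) (1 / K)`, a supermartingale from some time `N` on,
would tend to `1` almost surely; but it is smaller than `1` at time `N` when no move has been made
before. -/
theorem not_ae_summable [IsProbabilityMeasure P] (h : IsReinforced P ℱ p q y γ E F Y)
    (hy0 : 0 < y) (hy : y < 1) (hγ : IsStepSize γ ρ₁ ρ₂) (hρ0 : 0 ≤ ρ₁) (hρ : q - p < ρ₁)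
    (hpq : p < q) :
    ¬ ∀ᵐ ω ∂P, Tendsto (fun n => Y n ω) atTop (𝓝 0) → Summable (fun n => Y n ω) := by
  intro hcon
  have hY := h.isBddMeas
  have hYi := h.isBddMeas_inv hy0
  have hc := fun (n : ℕ) (c : ℝ) => IsBddMeas.const (m := ℱ n) c
  have hη0 : 0 < ρ₁ + p - q := by linarith
  set K := 4 / (ρ₁ + p - q) with hK
  have hK0 : 0 < K := by positivity
  set Q : ℕ → Ω → ℝ := fun n ω => Y n ω + K * (|γ n| * (Y n ω)⁻¹ ⊓ K⁻¹) with hQ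
  have hQm : ∀ n, IsBddMeas (ℱ n) (Q n) := fun n =>
    (hY n).add ((hc n K).mul (((hc n _).mul (hYi n)).min (hc n _)))
  have hQi : ∀ n, Integrable (Q n) P := fun n => (hQm n).integrable (P := P) (ℱ.le n)
  -- fast convergence to `0` brings the truncated term to its maximum `1 / K`
  have hQlim : ∀ᵐ ω ∂P, Tendsto (fun n => Q n ω) atTop (𝓝 1) := by
    filter_upwards [hcon, h.ae_tendsto_zero_or_one hpq.ne hγ.not_summable_succ,
      h.ae_tendsto_truncated_inv hy0 hγ hρ0 hρ le_rfl] with ω h1 h2 ⟨⟨L, hL⟩, _⟩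
    rcases h2 with h0 | h0
    · have hs := h1 h0
      have hLK : L = K⁻¹ := by
        have hle : L ≤ K⁻¹ := le_of_tendsto' hL fun n => min_le_right _ _
        refine hle.eq_of_not_lt fun hlt => hγ.not_summable ?_
        refine summable_of_isBigO_nat hs (Asymptotics.IsBigO.of_bound K⁻¹ ?_)
        filter_upwards [hL.eventually (gt_mem_nhds hlt), hγ.pos] with n h3 h4
        have h5 := (min_lt_iff.1 h3).resolve_right (lt_irrefl _)
        have hYp := h.pos hy0 n ω
        rw [← div_eq_mul_inv, div_lt_iff₀ hYp] at h5
        rw [Real.norm_eq_abs, Real.norm_eq_abs, abs_of_pos hYp]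
        exact h5.le
      have := h0.add (hL.const_mul K)
      rw [hLK, mul_inv_cancel₀ hK0.ne', zero_add] at this
      exact this
    · have h3 : Tendsto (fun n => |γ n| * (Y n ω)⁻¹) atTop (𝓝 0) := by
        simpa using hγ.tendsto.abs.mul (h0.inv₀ one_ne_zero)
      have h4 := h0.add ((h3.min (tendsto_const_nhds (x := K⁻¹))).const_mul K)
      rw [min_eq_left (by positivity), mul_zero, add_zero] at h4
      exact h4
  have hγy : Tendsto (fun n => K * (γ n * y⁻¹)) atTop (𝓝 0) := by
    simpa using (hγ.tendsto.mul_const y⁻¹).const_mul K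
  obtain ⟨N, hN⟩ := eventually_atTop.1 (hγ.pos.and (hγ.eventually_pos_succ.and
    ((hγ.succ_le hρ0).and ((hγ.le_two_mul_succ hρ0).and
    ((hγ.eventually_le (show 0 < (ρ₁ + p - q) / 8 by positivity)).and
    ((hγ.eventually_le (show (0 : ℝ) < 1 / 2 by norm_num)).and
    (hγy.eventually (gt_mem_nhds (sub_pos.2 hy)))))))))
  set T : ℕ → Set Ω := fun k => (E k ∪ F k)ᶜ with hT
  have hTm : ∀ k, MeasurableSet[ℱ (k + 1)] (T k) := fun k => ((h.measE k).union (h.measF k)).compl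
  have hR : 0 < P.real (run T N) := by
    refine run_pos (ℱ := ℱ) (c := 1 - max p q)
      (sub_pos.2 (max_lt h.p_mem.2 h.q_mem.2)) N (fun k _ => hTm k) fun k _ => ?_
    have h1 := h.condExp_step (n := k) (W := (T k).indicator 1) (vE := fun _ => 0)
      (vF := fun _ => 0) (v0 := fun _ => 1)
      (fun ω hω => indicator_of_notMem (by simp [hT, hω]) _)
      (fun ω hω => indicator_of_notMem (by simp [hT, hω]) _)
      (fun ω h1 h2 => indicator_of_mem (by simp [hT, h1, h2]) _) (hc k 0) (hc k 0) (hc k 1)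
    filter_upwards [h1] with ω h1 _
    rw [h1]
    have := h.mem_Icc k ω
    nlinarith [mul_le_mul_of_nonneg_right (le_max_left p q) this.1,
      mul_le_mul_of_nonneg_right (le_max_right p q) (sub_nonneg.2 this.2)]
  have hRm : MeasurableSet[ℱ N] (run T N) := measurableSet_run fun k _ => hTm k
  have hYR : ∀ n, ∀ ω ∈ run T n, Y n ω = y := by
    intro n
    induction n with
    | zero => exact fun ω _ => h.zero ω
    | succ n ih =>
      intro ω hω
      rw [run_succ] at hω
      have h1 : ω ∉ E n ∪ F n := hω.2
      rw [h.step_else n ω (fun h2 => h1 (Or.inl h2)) (fun h2 => h1 (Or.inr h2)), ih ω hω.1]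
  have hiE : ∀ n, IsBddMeas (ℱ n) (fun ω => (Y n ω + γ (n + 1) * (1 - Y n ω))⁻¹) := by
    intro n
    obtain ⟨c, hc0, hcY⟩ := h.exists_pos_le hy0 n
    exact ((hY n).add ((hc n _).mul ((hc n 1).sub (hY n)))).inv hc0 fun ω => (hcY ω).trans
      (le_add_of_nonneg_right (mul_nonneg (h.γ_nonneg n) (sub_nonneg.2 (h.le_one n ω))))
  have hiF : ∀ n, IsBddMeas (ℱ n) (fun ω => ((1 - γ (n + 1)) * Y n ω)⁻¹) := by
    intro n
    have : (fun ω => ((1 - γ (n + 1)) * Y n ω)⁻¹)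
        = fun ω => (1 - γ (n + 1))⁻¹ * (Y n ω)⁻¹ := by funext ω; rw [mul_inv]
    rw [this]; exact (hc n _).mul (hYi n)
  have hstep : ∀ n, N ≤ n → ∫ ω in run T N, Q (n + 1) ω ∂P ≤ ∫ ω in run T N, Q n ω ∂P := by
    intro n hn
    rw [← setIntegral_condExp (ℱ.le n) (hQi (n + 1)) (ℱ.mono hn _ hRm)]
    refine setIntegral_mono_ae integrable_condExp.integrableOn (hQi n).integrableOn ?_
    obtain ⟨g1, g2, g3, g4, g5, g6, _⟩ := hN n hn
    have h1 := h.condExp_step (n := n) (W := Q (n + 1))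
      (vE := fun ω => (Y n ω + γ (n + 1) * (1 - Y n ω))
        + K * (|γ (n + 1)| * (Y n ω + γ (n + 1) * (1 - Y n ω))⁻¹ ⊓ K⁻¹))
      (vF := fun ω => (1 - γ (n + 1)) * Y n ω
        + K * (|γ (n + 1)| * ((1 - γ (n + 1)) * Y n ω)⁻¹ ⊓ K⁻¹))
      (v0 := fun ω => Y n ω + K * (|γ (n + 1)| * (Y n ω)⁻¹ ⊓ K⁻¹))
      (fun ω hω => by simp only [hQ, h.step_E n ω hω])
      (fun ω hω => by simp only [hQ, h.step_F n ω hω])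
      (fun ω h1 h2 => by simp only [hQ, h.step_else n ω h1 h2])
      (((hY n).add ((hc n _).mul ((hc n 1).sub (hY n)))).add ((hc n K).mul
        (((hc n _).mul (hiE n)).min (hc n _))))
      (((hc n _).mul (hY n)).add ((hc n K).mul (((hc n _).mul (hiF n)).min (hc n _))))
      ((hY n).add ((hc n K).mul (((hc n _).mul (hYi n)).min (hc n _))))
    filter_upwards [h1] with ω h1
    rw [h1]
    have hYp := h.pos hy0 n ω
    have hY1 := h.le_one n ω
    have h2 := truncated_inv_step_le h.p_mem h.q_mem hYp hY1 g2 hρ0 hη0 g3 g4 hK0 le_rfl g5 g6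
    have h3 : 0 ≤ if K * γ n ≤ Y n ω then
        (ρ₁ + p - q) / 4 * (γ (n + 1) * (1 - Y n ω)) * (γ n * (Y n ω)⁻¹) else 0 := by
      have := sub_nonneg.2 hY1
      split_ifs
      · positivity
      · exact le_rfl
    have h4 : 0 ≤ (q - p) * (γ (n + 1) * (Y n ω * (1 - Y n ω))) :=
      mul_nonneg (by linarith) (mul_nonneg g2.le (mul_nonneg hYp.le (by linarith)))
    have h5 := mul_le_mul_of_nonneg_left (h2.trans (sub_le_self _ h3)) hK0.le
    simp only [hQ]
    rw [abs_of_pos g1, abs_of_pos g2]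
    nlinarith
  have hanti : ∀ n, N ≤ n → ∫ ω in run T N, Q n ω ∂P ≤ ∫ ω in run T N, Q N ω ∂P := by
    intro n hn
    induction n, hn using Nat.le_induction with
    | base => exact le_rfl
    | succ n hn ih => exact (hstep n hn).trans ih
  have hlim : Tendsto (fun n => ∫ ω in run T N, Q n ω ∂P) atTop
      (𝓝 (∫ ω in run T N, (1 : ℝ) ∂P)) := by
    refine tendsto_integral_of_dominated_convergence (fun _ => 2)
      (fun n => (hQi n).integrableOn.aestronglyMeasurable) (integrable_const 2)
      (fun n => ae_of_all _ fun ω => ?_) (ae_restrict_of_ae hQlim)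
    have h1 := h.mem_Icc n ω
    have h2 : 0 ≤ |γ n| * (Y n ω)⁻¹ ⊓ K⁻¹ :=
      le_min (mul_nonneg (abs_nonneg _) (inv_nonneg.2 h1.1)) (by positivity)
    have h3 : K * (|γ n| * (Y n ω)⁻¹ ⊓ K⁻¹) ≤ K * K⁻¹ :=
      mul_le_mul_of_nonneg_left (min_le_right _ _) hK0.le
    rw [mul_inv_cancel₀ hK0.ne'] at h3
    have h4 : 0 ≤ K * (|γ n| * (Y n ω)⁻¹ ⊓ K⁻¹) := mul_nonneg hK0.le h2
    rw [Real.norm_eq_abs, abs_of_nonneg (add_nonneg h1.1 h4)]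
    linarith [h1.2]
  have h1 : ∫ ω in run T N, (1 : ℝ) ∂P ≤ ∫ ω in run T N, Q N ω ∂P :=
    le_of_tendsto hlim (eventually_atTop.2 ⟨N, hanti⟩)
  have h2 : ∫ ω in run T N, Q N ω ∂P ≤ ∫ ω in run T N, (y + K * (γ N * y⁻¹)) ∂P := by
    refine setIntegral_mono_on (hQi N).integrableOn (integrable_const _).integrableOn
      (ℱ.le N _ hRm) fun ω hω => ?_
    simp only [hQ]
    rw [hYR N ω hω, abs_of_pos (hN N le_rfl).1]
    gcongr
    exact min_le_left _ _
  have h3 := (hN N le_rfl).2.2.2.2.2.2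
  have h4 : P.real (run T N) ≤ P.real (run T N) * (y + K * (γ N * y⁻¹)) := by
    simpa using h1.trans h2
  nlinarith

end IsReinforced

/-! ### Independence of the past and the next step -/

/-- If `X` is independent of `Y` and the pair `(X, Y)` is independent of `Z`, then `(X, Z)` is
independent of `Y`. -/
theorem ProbabilityTheory.IndepFun.prodMk_of_prodMk {Ω α β δ : Type*}
    {m : MeasurableSpace Ω} [MeasurableSpace α] [MeasurableSpace β] [MeasurableSpace δ]
    {P : Measure Ω} [IsProbabilityMeasure P] {X : Ω → α}
    {Y : Ω → β} {Z : Ω → δ} (hX : Measurable X) (hY : Measurable Y) (hZ : Measurable Z)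
    (h1 : IndepFun X Y P) (h2 : IndepFun (fun ω => (X ω, Y ω)) Z P) :
    IndepFun (fun ω => (X ω, Z ω)) Y P := by
  rw [indepFun_iff_map_prod_eq_prod_map_map (by fun_prop) (by fun_prop),
    Measure.ext_prod₃_iff']
  intro s t u hs ht hu
  have h3 : IndepFun X Z P := h2.comp measurable_fst measurable_id
  rw [Measure.prod_prod, Measure.map_apply (by fun_prop) ((hs.prod ht).prod hu),
    Measure.map_apply (by fun_prop) (hs.prod ht), Measure.map_apply hY hu]
  have e1 : (fun ω => ((X ω, Z ω), Y ω)) ⁻¹' ((s ×ˢ t) ×ˢ u)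
      = (fun ω => (X ω, Y ω)) ⁻¹' (s ×ˢ u) ∩ Z ⁻¹' t := by
    ext ω; simp only [mem_preimage, mem_prod, mem_inter_iff]; tauto
  have e2 : (fun ω => (X ω, Z ω)) ⁻¹' (s ×ˢ t) = X ⁻¹' s ∩ Z ⁻¹' t := rfl
  have e3 : (fun ω => (X ω, Y ω)) ⁻¹' (s ×ˢ u) = X ⁻¹' s ∩ Y ⁻¹' u := rfl
  rw [e1, e2, h2.measure_inter_preimage_eq_mul _ _ (hs.prod hu) ht, e3,
    h1.measure_inter_preimage_eq_mul _ _ hs hu, h3.measure_inter_preimage_eq_mul _ _ hs ht]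
  ring

/-- The conditional probability of an event that depends on a known variable and an independent
one: the known variable can be frozen. -/
theorem condExp_indicator_preimage_prodMk {Ω β : Type*} {m' m : MeasurableSpace Ω}
    [MeasurableSpace β] {P : Measure[m] Ω} [IsProbabilityMeasure P] (hm : m' ≤ m) {X : Ω → ℝ}
    (hX : Measurable[m'] X) {Z : Ω → β} (hZ : Measurable[m] Z)
    (hind : Indep m' (MeasurableSpace.comap Z inferInstance) P) {S : Set (ℝ × β)}
    (hS : MeasurableSet S) :
    P[((fun ω => (X ω, Z ω)) ⁻¹' S).indicator (1 : Ω → ℝ) | m']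
      =ᵐ[P] fun ω => P.real (Z ⁻¹' (Prod.mk (X ω) ⁻¹' S)) := by
  have hXm : Measurable X := hX.mono hm le_rfl
  have hXZ : MeasurableSet ((fun ω => (X ω, Z ω)) ⁻¹' S) := (hXm.prodMk hZ) hS
  have e : ∀ x, P.real (Z ⁻¹' (Prod.mk x ⁻¹' S)) = ((P.map Z) (Prod.mk x ⁻¹' S)).toReal := by
    intro x
    rw [Measure.map_apply hZ (measurable_prodMk_left hS), measureReal_def]
  have : IsProbabilityMeasure (P.map Z) := Measure.isProbabilityMeasure_map hZ.aemeasurable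
  have hν : Measurable fun x => (P.map Z) (Prod.mk x ⁻¹' S) := measurable_measure_prodMk_left hS
  have hf : Measurable[m'] fun ω => P.real (Z ⁻¹' (Prod.mk (X ω) ⁻¹' S)) := by
    simp only [e]
    exact hν.ennreal_toReal.comp hX
  have hfi : Integrable (fun ω => P.real (Z ⁻¹' (Prod.mk (X ω) ⁻¹' S))) P := by
    refine Integrable.of_bound (hf.mono hm le_rfl).aestronglyMeasurable 1 (ae_of_all _ fun ω => ?_)
    rw [Real.norm_eq_abs, abs_of_nonneg measureReal_nonneg]
    exact measureReal_le_one
  refine (ae_eq_condExp_of_forall_setIntegral_eq hm ((integrable_const 1).indicator hXZ)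
    (fun s _ _ => hfi.integrableOn) (fun s hs _ => ?_) hf.aestronglyMeasurable).symm
  have hs' : MeasurableSet s := hm s hs
  -- on an event of the known past, the joint law of `X` and `Z` is still a product
  have hprod : ((P.restrict s).map X).prod (P.map Z)
      = (P.restrict s).map (fun ω => (X ω, Z ω)) := by
    refine Measure.prod_eq fun a b ha hb => ?_
    rw [Measure.map_apply (hXm.prodMk hZ) (ha.prod hb), Measure.map_apply hXm ha,
      Measure.map_apply hZ hb, Measure.restrict_apply (hXm ha),
      Measure.restrict_apply ((hXm.prodMk hZ) (ha.prod hb))]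
    have e1 : (fun ω => (X ω, Z ω)) ⁻¹' (a ×ˢ b) ∩ s = (X ⁻¹' a ∩ s) ∩ Z ⁻¹' b := by
      ext ω; simp only [mem_preimage, mem_prod, mem_inter_iff]; tauto
    rw [e1]
    exact (Indep_iff _ _ P).1 hind _ _ ((hX ha).inter hs) ⟨b, hb, rfl⟩
  have h1 : ∫ ω in s, ((fun ω => (X ω, Z ω)) ⁻¹' S).indicator (1 : Ω → ℝ) ω ∂P
      = ((P.restrict s).map (fun ω => (X ω, Z ω)) S).toReal := by
    rw [integral_indicator_one hXZ, Measure.map_apply (hXm.prodMk hZ) hS, measureReal_def]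
  rw [h1, ← hprod, Measure.prod_apply hS, lintegral_map hν hXm]
  simp only [e]
  rw [integral_toReal (f := fun ω => (P.map Z) (Prod.mk (X ω) ⁻¹' S)) (hν.comp hXm).aemeasurable
    (ae_of_all _ fun ω => measure_lt_top _ _)]

/-! ### The bandit recursion as a reinforced process -/

theorem measurable_indicatorPair {Ω : Type*} [MeasurableSpace Ω] {A B : Set Ω}
    (hA : MeasurableSet A) (hB : MeasurableSet B) : Measurable (indicatorPair A B) :=
  (measurable_const.indicator hA).prodMk (measurable_const.indicator hB)

/-- The variables used in the first `n` steps. -/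
noncomputable def history {Ω : Type*} (U : ℕ → Ω → ℝ) (A B : ℕ → Set Ω) (n : ℕ) (ω : Ω) :
    (Finset.range n → ℝ × ℝ) × (Finset.range n → ℝ) :=
  (fun k => indicatorPair (A k) (B k) ω, fun k => U k ω)

theorem measurable_history {Ω : Type*} {m : MeasurableSpace Ω} {U : ℕ → Ω → ℝ} {A B : ℕ → Set Ω}
    {n : ℕ} (hU : ∀ k < n, Measurable (U k))
    (hAB : ∀ k < n, Measurable (indicatorPair (A k) (B k))) : Measurable (history U A B n) :=
  (measurable_pi_lambda _ fun (k : Finset.range n) => hAB k (Finset.mem_range.1 k.2)).prodMk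
    (measurable_pi_lambda _ fun (k : Finset.range n) => hU k (Finset.mem_range.1 k.2))

theorem measurable_comap_history_U {Ω : Type*} (U : ℕ → Ω → ℝ) (A B : ℕ → Set Ω) {k n : ℕ}
    (hk : k < n) : Measurable[MeasurableSpace.comap (history U A B n) inferInstance] (U k) := by
  have h : Measurable fun z : (Finset.range n → ℝ × ℝ) × (Finset.range n → ℝ) =>
      z.2 ⟨k, Finset.mem_range.2 hk⟩ := by fun_prop
  exact h.comp (comap_measurable (history U A B n))

theorem measurable_comap_history_pair {Ω : Type*} (U : ℕ → Ω → ℝ) (A B : ℕ → Set Ω) {k n : ℕ}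
    (hk : k < n) : Measurable[MeasurableSpace.comap (history U A B n) inferInstance]
      (indicatorPair (A k) (B k)) := by
  have h : Measurable fun z : (Finset.range n → ℝ × ℝ) × (Finset.range n → ℝ) =>
      z.1 ⟨k, Finset.mem_range.2 hk⟩ := by fun_prop
  exact h.comp (comap_measurable (history U A B n))

/-- The filtration generated by the variables used so far. -/
noncomputable def pastFiltration {Ω : Type*} [m : MeasurableSpace Ω] {U : ℕ → Ω → ℝ}
    {A B : ℕ → Set Ω} (hU : ∀ n, Measurable (U n)) (hA : ∀ n, MeasurableSet (A n))
    (hB : ∀ n, MeasurableSet (B n)) : Filtration ℕ m where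
  seq n := MeasurableSpace.comap (history U A B n) inferInstance
  mono' _ _ hij := Measurable.comap_le (measurable_history
    (fun _ hk => measurable_comap_history_U U A B (hk.trans_le hij))
    (fun _ hk => measurable_comap_history_pair U A B (hk.trans_le hij)))
  le' _ := Measurable.comap_le (measurable_history (fun k _ => hU k)
    fun k _ => measurable_indicatorPair (hA k) (hB k))

theorem measureReal_preimage_Iic_of_uniform {Ω : Type*} [MeasurableSpace Ω] {P : Measure Ω}
    {V : Ω → ℝ} (hV : Measurable V)
    (hV_law : P.map V = (volume : Measure ℝ).restrict (Icc 0 1)) {x : ℝ}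
    (hx : x ∈ Icc (0 : ℝ) 1) : P.real (V ⁻¹' Iic x) = x := by
  rw [measureReal_def, ← Measure.map_apply hV measurableSet_Iic, hV_law,
    Measure.restrict_apply measurableSet_Iic,
    show Iic x ∩ Icc (0 : ℝ) 1 = Icc 0 x by
      ext y; simp only [mem_inter_iff, mem_Iic, mem_Icc]; constructor
      · exact fun h => ⟨h.2.1, h.1⟩
      · exact fun h => ⟨h.2, h.1, h.2.trans hx.2⟩]
  simp [hx.1]

theorem bandit_mem_Icc {Ω : Type*} {U : ℕ → Ω → ℝ} {A B : ℕ → Set Ω} {γ : ℕ → ℝ}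
    (hγ : ∀ n, 1 ≤ n → 0 ≤ γ n ∧ γ n < 1) {x : ℝ} (hx : x ∈ Icc (0 : ℝ) 1) (n : ℕ) (ω : Ω) :
    bandit γ U A B x n ω ∈ Icc (0 : ℝ) 1 := by
  induction n with
  | zero => exact hx
  | succ n ih =>
    obtain ⟨h0, h1⟩ := hγ (n + 1) (by omega)
    obtain ⟨i0, i1⟩ := ih
    classical
    rw [bandit]
    simp only [indicator_apply]
    split_ifs <;> constructor <;> nlinarith

section Bandit

variable {Ω : Type*} [m : MeasurableSpace Ω] {P : Measure Ω} [IsProbabilityMeasure P]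
  {U : ℕ → Ω → ℝ} {A B : ℕ → Set Ω}

/-- The variables of the next step are independent of those of the past. -/
theorem indep_history (hU : ∀ n, Measurable (U n)) (hA : ∀ n, MeasurableSet (A n))
    (hB : ∀ n, MeasurableSet (B n)) (hU_indep : iIndepFun U P)
    (hAB_indep : iIndepFun (fun n => indicatorPair (A n) (B n)) P)
    (hUAB_indep : IndepFun (fun ω n => U n ω) (fun ω n => indicatorPair (A n) (B n) ω) P) (n : ℕ) :
    IndepFun (history U A B n) (fun ω => (indicatorPair (A n) (B n) ω, U n ω)) P := by
  have hAB : ∀ n, Measurable (indicatorPair (A n) (B n)) := fun n =>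
    measurable_indicatorPair (hA n) (hB n)
  have hdisj : Disjoint (Finset.range n) {n} := by simp
  set u : Ω → (Finset.range n → ℝ) := fun ω k => U k ω with hu
  set a : Ω → (Finset.range n → ℝ × ℝ) := fun ω k => indicatorPair (A k) (B k) ω with ha
  have hum : Measurable u := measurable_pi_lambda _ fun k => hU k
  have ham : Measurable a := measurable_pi_lambda _ fun k => hAB k
  have hn : n ∈ ({n} : Finset ℕ) := Finset.mem_singleton_self n
  have huv : IndepFun u (U n) P :=
    (hU_indep.indepFun_finset (Finset.range n) {n} hdisj hU).comp measurable_id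
      (measurable_pi_apply (⟨n, hn⟩ : ({n} : Finset ℕ)))
  have hab : IndepFun a (indicatorPair (A n) (B n)) P :=
    (hAB_indep.indepFun_finset (Finset.range n) {n} hdisj hAB).comp measurable_id
      (measurable_pi_apply (⟨n, hn⟩ : ({n} : Finset ℕ)))
  have hall : IndepFun (fun ω => (u ω, U n ω)) (fun ω => (a ω, indicatorPair (A n) (B n) ω)) P :=
    hUAB_indep.comp
      ((measurable_pi_lambda _ fun (k : Finset.range n) => measurable_pi_apply (k : ℕ)).prodMk
        (measurable_pi_apply n))
      ((measurable_pi_lambda _ fun (k : Finset.range n) => measurable_pi_apply (k : ℕ)).prodMk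
        (measurable_pi_apply n))
  have h1 : IndepFun (fun ω => (u ω, (a ω, indicatorPair (A n) (B n) ω))) (U n) P :=
    IndepFun.prodMk_of_prodMk hum (hU n) (ham.prodMk (hAB n)) huv hall
  have h2 : IndepFun (fun ω => (a ω, u ω)) (indicatorPair (A n) (B n)) P :=
    IndepFun.prodMk_of_prodMk ham (hAB n) hum hab (hall.symm.comp measurable_id measurable_fst)
  have h3 : IndepFun (fun ω => (indicatorPair (A n) (B n) ω, (a ω, u ω))) (U n) P :=
    h1.comp (φ := fun z => (z.2.2, (z.2.1, z.1))) (by fun_prop) measurable_id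
  exact (IndepFun.prodMk_of_prodMk (hAB n) (ham.prodMk hum) (hU n) h2.symm h3).symm

end Bandit

/-- The bandit recursion is a reinforced process for the filtration of the past. -/
theorem isReinforced_bandit {Ω : Type*} [m : MeasurableSpace Ω] {P : Measure Ω}
    [IsProbabilityMeasure P] {pA pB : ℝ} (hpA : pA ∈ Ioo (0 : ℝ) 1) (hpB : pB ∈ Ioo (0 : ℝ) 1)
    {U : ℕ → Ω → ℝ} {A B : ℕ → Set Ω} (hU : ∀ n, Measurable (U n))
    (hA : ∀ n, MeasurableSet (A n)) (hB : ∀ n, MeasurableSet (B n))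
    (hU_law : ∀ n, P.map (U n) = (volume : Measure ℝ).restrict (Icc 0 1))
    (hA_prob : ∀ n, P (A n) = ENNReal.ofReal pA) (hB_prob : ∀ n, P (B n) = ENNReal.ofReal pB)
    (hU_indep : iIndepFun U P) (hAB_indep : iIndepFun (fun n => indicatorPair (A n) (B n)) P)
    (hUAB_indep : IndepFun (fun ω n => U n ω) (fun ω n => indicatorPair (A n) (B n) ω) P)
    {γ : ℕ → ℝ} (hγ : ∀ n, 1 ≤ n → 0 ≤ γ n ∧ γ n < 1) {x : ℝ} (hx : x ∈ Icc (0 : ℝ) 1) :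
    IsReinforced P (pastFiltration hU hA hB) pA pB x γ
      (fun n => {ω | U n ω ≤ bandit γ U A B x n ω} ∩ A n)
      (fun n => {ω | bandit γ U A B x n ω < U n ω} ∩ B n) (bandit γ U A B x) := by
  set X := bandit γ U A B x with hX
  set ℱ := pastFiltration hU hA hB with hℱ
  have memA : ∀ n ω, ω ∈ A n ↔ (indicatorPair (A n) (B n) ω).1 = 1 := by
    intro n ω
    by_cases h : ω ∈ A n <;> simp [indicatorPair, h]
  have memB : ∀ n ω, ω ∈ B n ↔ (indicatorPair (A n) (B n) ω).2 = 1 := by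
    intro n ω
    by_cases h : ω ∈ B n <;> simp [indicatorPair, h]
  have hUm : ∀ n, Measurable[ℱ (n + 1)] (U n) := fun n =>
    measurable_comap_history_U U A B (Nat.lt_succ_self n)
  have hABm : ∀ n, Measurable[ℱ (n + 1)] (indicatorPair (A n) (B n)) := fun n =>
    measurable_comap_history_pair U A B (Nat.lt_succ_self n)
  have hAm : ∀ n, MeasurableSet[ℱ (n + 1)] (A n) := by
    intro n
    have e : A n = indicatorPair (A n) (B n) ⁻¹' {z | z.1 = 1} := by ext ω; exact memA n ω
    rw [e]
    exact hABm n (measurable_fst (measurableSet_singleton 1))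
  have hBm : ∀ n, MeasurableSet[ℱ (n + 1)] (B n) := by
    intro n
    have e : B n = indicatorPair (A n) (B n) ⁻¹' {z | z.2 = 1} := by ext ω; exact memB n ω
    rw [e]
    exact hABm n (measurable_snd (measurableSet_singleton 1))
  have hEF : ∀ n, Measurable[ℱ n] (X n) →
      MeasurableSet[ℱ (n + 1)] ({ω | U n ω ≤ X n ω} ∩ A n) ∧
      MeasurableSet[ℱ (n + 1)] ({ω | X n ω < U n ω} ∩ B n) := by
    intro n hn
    have hn' : Measurable[ℱ (n + 1)] (X n) := hn.mono (ℱ.mono (Nat.le_succ n)) le_rfl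
    exact ⟨(measurableSet_le (hUm n) hn').inter (hAm n),
      (measurableSet_lt hn' (hUm n)).inter (hBm n)⟩
  have hXm : ∀ n, Measurable[ℱ n] (X n) := by
    intro n
    induction n with
    | zero => exact measurable_const
    | succ n ih =>
      have hn' : Measurable[ℱ (n + 1)] (X n) := ih.mono (ℱ.mono (Nat.le_succ n)) le_rfl
      obtain ⟨h1, h2⟩ := hEF n ih
      exact hn'.add ((((hn'.const_sub 1).indicator h1).sub (hn'.indicator h2)).const_mul _)
  have hZ : ∀ n, Measurable fun ω => (indicatorPair (A n) (B n) ω, U n ω) := fun n =>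
    (measurable_indicatorPair (hA n) (hB n)).prodMk (hU n)
  have hind : ∀ n, Indep (ℱ n) (MeasurableSpace.comap
      (fun ω => (indicatorPair (A n) (B n) ω, U n ω)) inferInstance) P := fun n =>
    indep_history hU hA hB hU_indep hAB_indep hUAB_indep n
  have hUp : ∀ n, IndepFun (indicatorPair (A n) (B n)) (U n) P := fun n =>
    hUAB_indep.symm.comp (measurable_pi_apply n) (measurable_pi_apply n)
  have hX01 : ∀ n ω, X n ω ∈ Icc (0 : ℝ) 1 := bandit_mem_Icc hγ hx
  have hle : ∀ n, ∀ y ∈ Icc (0 : ℝ) 1, P.real (U n ⁻¹' Iic y) = y := fun n y hy =>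
    measureReal_preimage_Iic_of_uniform (hU n) (hU_law n) hy
  have hcond : ∀ n (s : Set (ℝ × ℝ)) (t : ℝ → Set ℝ), MeasurableSet s →
      MeasurableSet {z : ℝ × (ℝ × ℝ) × ℝ | z.2.1 ∈ s ∧ z.2.2 ∈ t z.1} →
      (∀ y, MeasurableSet (t y)) →
      P[{ω | indicatorPair (A n) (B n) ω ∈ s ∧ U n ω ∈ t (X n ω)}.indicator (1 : Ω → ℝ) | ℱ n]
        =ᵐ[P] fun ω => P.real (indicatorPair (A n) (B n) ⁻¹' s) * P.real (U n ⁻¹' t (X n ω)) := by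
    intro n s t hs hst ht
    have h1 := condExp_indicator_preimage_prodMk (ℱ.le n) (hXm n) (hZ n) (hind n) hst
    refine h1.trans (ae_of_all _ fun ω => ?_)
    simp only [measureReal_def, ← ENNReal.toReal_mul]
    congr 1
    exact (hUp n).measure_inter_preimage_eq_mul _ _ hs (ht _)
  have hnot : ∀ n ω, U n ω ≤ X n ω → X n ω < U n ω → False := fun n ω h1 h2 => h2.not_ge h1
  have hsucc : ∀ n ω, X (n + 1) ω = X n ω + γ (n + 1) *
      (({ω' | U n ω' ≤ X n ω'} ∩ A n).indicator (fun ω' => 1 - X n ω') ω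
        - ({ω' | X n ω' < U n ω'} ∩ B n).indicator (fun ω' => X n ω') ω) := fun _ _ => rfl
  refine ⟨hpA, hpB, hx, fun n => (hγ _ (by omega)).1, fun n => (hγ _ (by omega)).2, fun _ => rfl,
    fun n ω hω => ?_, fun n ω hω => ?_, fun n ω h1 h2 => ?_, fun n => ?_,
    fun n => (hEF n (hXm n)).1, fun n => (hEF n (hXm n)).2, fun n => ?_, fun n => ?_⟩
  · have h2 : ω ∉ {ω | X n ω < U n ω} ∩ B n := fun h2 => hnot n ω hω.1 h2.1
    rw [hsucc, indicator_of_mem hω, indicator_of_notMem h2, sub_zero]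
  · have h2 : ω ∉ {ω | U n ω ≤ X n ω} ∩ A n := fun h2 => hnot n ω h2.1 hω.1
    rw [hsucc, indicator_of_mem hω, indicator_of_notMem h2]
    ring
  · rw [hsucc, indicator_of_notMem h1, indicator_of_notMem h2]
    ring
  · exact disjoint_left.2 fun ω h1 h2 => hnot n ω h1.1 h2.1
  · have h1 := hcond n {z | z.1 = 1} Iic (measurable_fst (measurableSet_singleton 1))
      ((measurableSet_eq_fun (by fun_prop) (by fun_prop)).inter
        (measurableSet_le (f := fun z : ℝ × (ℝ × ℝ) × ℝ => z.2.2) (by fun_prop) (by fun_prop)))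
      fun _ => measurableSet_Iic
    have e : {ω | indicatorPair (A n) (B n) ω ∈ {z | z.1 = 1} ∧ U n ω ∈ Iic (X n ω)}
        = {ω | U n ω ≤ X n ω} ∩ A n := by
      ext ω; exact ⟨fun h => ⟨h.2, (memA n ω).2 h.1⟩, fun h => ⟨(memA n ω).1 h.2, h.1⟩⟩
    have e2 : indicatorPair (A n) (B n) ⁻¹' {z | z.1 = 1} = A n := by ext ω; exact (memA n ω).symm
    rw [e] at h1
    refine h1.trans (ae_of_all _ fun ω => ?_)
    beta_reduce
    rw [e2, hle n _ (hX01 n ω), measureReal_def, hA_prob, ENNReal.toReal_ofReal hpA.1.le]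
  · have h1 := hcond n {z | z.2 = 1} Ioi (measurable_snd (measurableSet_singleton 1))
      ((measurableSet_eq_fun (by fun_prop) (by fun_prop)).inter
        (measurableSet_lt (g := fun z : ℝ × (ℝ × ℝ) × ℝ => z.2.2) (by fun_prop) (by fun_prop)))
      fun _ => measurableSet_Ioi
    have e : {ω | indicatorPair (A n) (B n) ω ∈ {z | z.2 = 1} ∧ U n ω ∈ Ioi (X n ω)}
        = {ω | X n ω < U n ω} ∩ B n := by
      ext ω; exact ⟨fun h => ⟨h.2, (memB n ω).2 h.1⟩, fun h => ⟨(memB n ω).1 h.2, h.1⟩⟩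
    have e2 : indicatorPair (A n) (B n) ⁻¹' {z | z.2 = 1} = B n := by ext ω; exact (memB n ω).symm
    rw [e] at h1
    refine h1.trans (ae_of_all _ fun ω => ?_)
    beta_reduce
    have e3 : U n ⁻¹' Ioi (X n ω) = (U n ⁻¹' Iic (X n ω))ᶜ := by
      rw [← preimage_compl, compl_Iic]
    rw [e2, e3, probReal_compl_eq_one_sub (hU n measurableSet_Iic), hle n _ (hX01 n ω),
      measureReal_def, hB_prob, ENNReal.toReal_ofReal hpB.1.le]

/-! ### The fallible and infallible regimes -/

theorem mainTheorem7 {Ω : Type*} [MeasurableSpace Ω] (P : Measure Ω) [IsProbabilityMeasure P]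
    (pA pB : ℝ) (hpB : 0 < pB) (hpBA : pB < pA) (hpA : pA < 1)
    (U : ℕ → Ω → ℝ) (A B : ℕ → Set Ω)
    (hU : ∀ n, Measurable (U n))
    (hA : ∀ n, MeasurableSet (A n))
    (hB : ∀ n, MeasurableSet (B n))
    (hU_law : ∀ n, P.map (U n) = (volume : Measure ℝ).restrict (Icc 0 1))
    (hA_prob : ∀ n, P (A n) = ENNReal.ofReal pA)
    (hB_prob : ∀ n, P (B n) = ENNReal.ofReal pB)
    (hU_indep : iIndepFun U P)
    (hAB_indep : iIndepFun (fun n => indicatorPair (A n) (B n)) P)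
    (hUAB_indep : IndepFun (fun ω n => U n ω) (fun ω n => indicatorPair (A n) (B n) ω) P)
    (α C C' : ℝ) (hα : α ∈ Ioc (0 : ℝ) 1) (hC : 0 < C) (hC' : 0 < C')
    (γ : ℕ → ℝ) (hγ : ∀ n, 1 ≤ n → 0 ≤ γ n ∧ γ n < 1)
    (hγ_eq : ∀ᶠ n : ℕ in atTop, γ n = (C / (C' + n)) ^ α) :
    -- fallible regimes
    ((α < 1 ∨ (α = 1 ∧ 1 < C * pB)) →
      (∀ x ∈ Ico (0 : ℝ) 1, IsFallible P (bandit γ U A B x)) ∧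
      (∀ x ∈ Ioo (0 : ℝ) 1, P (convergesTo (bandit γ U A B x) 0) < 1) ∧
      (∀ x ∈ Ico (0 : ℝ) 1, ∀ᵐ ω ∂P, ω ∈ convergesTo (bandit γ U A B x) 0 →
        IsFast (fun n => bandit γ U A B x n ω))) ∧
    (α = 1 → 1 < C * pB →
      ∀ x ∈ Ioo (0 : ℝ) 1, ∀ᵐ ω ∂P, ω ∈ convergesTo (bandit γ U A B x) 0 →
        HasRate (fun n => bandit γ U A B x n ω) (C * pB)) ∧
    -- infallible regime
    (α = 1 → C ≤ 1 / pB →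
      ∀ x ∈ Ioc (0 : ℝ) 1, IsInfallible P (bandit γ U A B x)) ∧
    -- only the fast rate of convergence to the target
    (α = 1 → 1 / (pA - pB) ≤ C →
      ∀ x ∈ Ioo (0 : ℝ) 1, ∀ᵐ ω ∂P, ω ∈ convergesTo (bandit γ U A B x) 1 →
        IsFast (fun n => 1 - bandit γ U A B x n ω) ∧
        HasRate (fun n => 1 - bandit γ U A B x n ω) (C * pA)) ∧
    -- exactly two rates of convergence to the target, each with positive probability
    (α = 1 → 1 / pA < C → C < 1 / (pA - pB) →
      ∀ x ∈ Ioo (0 : ℝ) 1,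
        (∀ᵐ ω ∂P, ω ∈ convergesTo (bandit γ U A B x) 1 →
          (¬ IsFast (fun n => 1 - bandit γ U A B x n ω) ∧
            HasRate (fun n => 1 - bandit γ U A B x n ω) (C * (pA - pB))) ∨
          (IsFast (fun n => 1 - bandit γ U A B x n ω) ∧
            HasRate (fun n => 1 - bandit γ U A B x n ω) (C * pA))) ∧
        0 < P {ω | ω ∈ convergesTo (bandit γ U A B x) 1 ∧
          ¬ IsFast (fun n => 1 - bandit γ U A B x n ω) ∧
          HasRate (fun n => 1 - bandit γ U A B x n ω) (C * (pA - pB))} ∧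
        0 < P {ω | ω ∈ convergesTo (bandit γ U A B x) 1 ∧
          IsFast (fun n => 1 - bandit γ U A B x n ω) ∧
          HasRate (fun n => 1 - bandit γ U A B x n ω) (C * pA)}) ∧
    -- infallible, and only the slow rate of convergence to the target
    (α = 1 → C ≤ 1 / pA →
      (∀ x ∈ Ioc (0 : ℝ) 1, IsInfallible P (bandit γ U A B x)) ∧
      ∀ x ∈ Ioo (0 : ℝ) 1, ∀ᵐ ω ∂P, ω ∈ convergesTo (bandit γ U A B x) 1 →
        ¬ IsFast (fun n => 1 - bandit γ U A B x n ω) ∧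
        HasRate (fun n => 1 - bandit γ U A B x n ω) (C * (pA - pB))) := by
  have hpA0 : 0 < pA := hpB.trans hpBA
  have hpB1 : pB < 1 := hpBA.trans hpA
  have hX : ∀ x ∈ Icc (0 : ℝ) 1, IsReinforced P (pastFiltration hU hA hB) pA pB x γ
      (fun n => {ω | U n ω ≤ bandit γ U A B x n ω} ∩ A n)
      (fun n => {ω | bandit γ U A B x n ω < U n ω} ∩ B n) (bandit γ U A B x) := fun x hx =>
    isReinforced_bandit ⟨hpA0, hpA⟩ ⟨hpB, hpB1⟩ hU hA hB hU_law hA_prob hB_prob hU_indep hAB_indep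
      hUAB_indep hγ hx
  have one_iff : ∀ x ω, ω ∈ convergesTo (bandit γ U A B x) 1 ↔
      Tendsto (fun n => 1 - bandit γ U A B x n ω) atTop (𝓝 0) := by
    intro x ω
    refine ⟨fun h => by simpa using Tendsto.const_sub 1 h, fun h => ?_⟩
    have := Tendsto.const_sub 1 h
    simpa [convergesTo] using this
  have hγ1 : α = 1 → ∀ᶠ n : ℕ in atTop, γ n = C / (C' + n) := fun h => by
    simpa [h] using hγ_eq
  -- the step sizes, with inverse increments bounded below `pB` in the fallible regimes
  have hstep : (α < 1 ∨ (α = 1 ∧ 1 < C * pB)) →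
      ∃ ρ₁ ρ₂, 0 ≤ ρ₁ ∧ 0 ≤ ρ₂ ∧ ρ₂ < pB ∧ IsStepSize γ ρ₁ ρ₂ := by
    rintro (h | ⟨h, h2⟩)
    · exact ⟨0, pB / 2, le_rfl, by positivity, by linarith,
        isStepSize_of_eq_rpow hα.1 h hC hC' hγ_eq (by positivity)⟩
    · exact ⟨1 / C, 1 / C, by positivity, by positivity, by rw [div_lt_iff₀ hC]; linarith,
        isStepSize_of_eq_div hC hC' (hγ1 h)⟩
  have hinf : α = 1 → C ≤ 1 / pB → ∀ x ∈ Ioc (0 : ℝ) 1, IsInfallible P (bandit γ U A B x) := by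
    intro h1 hCB x hx
    rcases hx.2.eq_or_lt with rfl | hx1
    · have h2 := (hX 1 ⟨zero_le_one, le_rfl⟩).symm
      rw [sub_self] at h2
      filter_upwards [h2.ae_eq_zero] with ω hω
      exact tendsto_const_nhds.congr fun n => by linarith [hω n]
    · have h2 := hX x ⟨hx.1.le, hx.2⟩
      have hs := isStepSize_of_eq_div hC hC' (hγ1 h1)
      rw [le_div_iff₀ hpB] at hCB
      filter_upwards [h2.ae_tendsto_zero_or_one hpBA.ne' hs.not_summable_succ,
        h2.ae_summable_of_lt hx.1 hs (by positivity) hpBA,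
        h2.ae_not_summable hx.1 hC hC' (hγ1 h1) hCB] with ω h3 h4 h5
      exact h3.resolve_left fun h => h5 (h4 h)
  refine ⟨fun hreg => ⟨fun x hx => ?_, fun x hx => ?_, fun x hx => ?_⟩, fun h1 hCB x hx => ?_, hinf,
    fun h1 hCπ x hx => ?_, fun h1 hCA hCπ x hx => ⟨?_, ?_, ?_⟩, fun h1 hCA => ⟨?_, fun x hx => ?_⟩⟩
  · obtain ⟨ρ₁, ρ₂, hρ1, hρ2, hρ, hs⟩ := hstep hreg
    refine pos_iff_ne_zero.2 fun h0 => ?_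
    refine (hX x ⟨hx.1, hx.2.le⟩).not_ae_not_summable hx.2 hs hρ2 hρ ?_
    filter_upwards [measure_eq_zero_iff_ae_notMem.1 h0] with ω hω hsum
    exact hω hsum.tendsto_atTop_zero
  · obtain ⟨ρ₁, ρ₂, hρ1, hρ2, hρ, hs⟩ := hstep hreg
    have h2 := hX x ⟨hx.1.le, hx.2.le⟩
    have hm : MeasurableSet (convergesTo (bandit γ U A B x) 0) :=
      measurableSet_tendsto _ fun n => (h2.isBddMeas n).1.mono (Filtration.le _ n) le_rfl
    refine lt_of_le_of_ne prob_le_one fun h0 => ?_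
    refine h2.symm.not_ae_not_summable (by linarith [hx.1]) hs hρ2 (hρ.trans hpBA) ?_
    filter_upwards [(mem_ae_iff_prob_eq_one hm).2 h0] with ω hω hsum
    have h3 := (one_iff x ω).2 hsum.tendsto_atTop_zero
    exact zero_ne_one (tendsto_nhds_unique (show Tendsto _ _ _ from hω) h3)
  · obtain ⟨ρ₁, ρ₂, hρ1, hρ2, hρ, hs⟩ := hstep hreg
    rcases hx.1.eq_or_lt with rfl | hx0
    · filter_upwards [(hX 0 ⟨le_rfl, zero_le_one⟩).ae_eq_zero] with ω hω _
      exact summable_zero.congr fun n => (hω n).symm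
    · exact (hX x ⟨hx.1, hx.2.le⟩).ae_summable_of_lt hx0 hs hρ1 hpBA
  · have h2 := hX x ⟨hx.1.le, hx.2.le⟩
    filter_upwards [h2.ae_summable_of_lt hx.1 (isStepSize_of_eq_div hC hC' (hγ1 h1))
      (by positivity) hpBA, h2.ae_hasRate_fast hx.1 hC hC' (hγ1 h1)] with ω h3 h4 h0
    exact h4 (h3 h0)
  · have h2 := (hX x ⟨hx.1.le, hx.2.le⟩).symm
    have hπ : 0 < pA - pB := by linarith
    filter_upwards [h2.ae_summable_of_inc_le (isStepSize_of_eq_div hC hC' (hγ1 h1))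
      (by positivity) (by rwa [one_div_le hC hπ]) hpBA,
      h2.ae_hasRate_fast (by linarith [hx.2]) hC hC' (hγ1 h1)] with ω h3 h4 h0
    have h5 := h3 ((one_iff x ω).1 h0)
    exact ⟨h5, h4 h5⟩
  · have h2 := (hX x ⟨hx.1.le, hx.2.le⟩).symm
    have hπ : 0 < pA - pB := by linarith
    rw [lt_div_iff₀ hπ] at hCπ
    filter_upwards [h2.ae_hasRate_slow (by linarith [hx.2]) hC hC' (hγ1 h1) hpBA hCπ,
      h2.ae_hasRate_fast (by linarith [hx.2]) hC hC' (hγ1 h1)] with ω h3 h4 h0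
    by_cases h5 : Summable fun n => 1 - bandit γ U A B x n ω
    · exact Or.inr ⟨h5, h4 h5⟩
    · exact Or.inl ⟨h5, h3 ((one_iff x ω).1 h0) h5⟩
  · have h2 := (hX x ⟨hx.1.le, hx.2.le⟩).symm
    have hπ : 0 < pA - pB := by linarith
    rw [lt_div_iff₀ hπ] at hCπ
    refine pos_iff_ne_zero.2 fun h0 => ?_
    refine h2.not_ae_summable (by linarith [hx.2]) (by linarith [hx.1])
      (isStepSize_of_eq_div hC hC' (hγ1 h1)) (by positivity)
      (by rw [lt_div_iff₀ hC]; linarith) hpBA ?_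
    filter_upwards [measure_eq_zero_iff_ae_notMem.1 h0,
      h2.ae_hasRate_slow (by linarith [hx.2]) hC hC' (hγ1 h1) hpBA hCπ] with ω hω h3 h4
    by_contra h5
    exact hω ⟨(one_iff x ω).2 h4, h5, h3 h4 h5⟩
  · have h2 := (hX x ⟨hx.1.le, hx.2.le⟩).symm
    rw [div_lt_iff₀ hpA0] at hCA
    refine pos_iff_ne_zero.2 fun h0 => ?_
    refine h2.not_ae_not_summable (by linarith [hx.1]) (isStepSize_of_eq_div hC hC' (hγ1 h1))
      (by positivity) (by rw [div_lt_iff₀ hC]; linarith) ?_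
    filter_upwards [measure_eq_zero_iff_ae_notMem.1 h0,
      h2.ae_hasRate_fast (by linarith [hx.2]) hC hC' (hγ1 h1)] with ω hω h3 h4
    exact hω ⟨(one_iff x ω).2 h4.tendsto_atTop_zero, h4, h3 h4⟩
  · exact hinf h1 (hCA.trans (one_div_le_one_div_of_le hpB hpBA.le))
  · have h2 := (hX x ⟨hx.1.le, hx.2.le⟩).symm
    rw [le_div_iff₀ hpA0] at hCA
    have hCB := mul_pos hC hpB
    filter_upwards [h2.ae_hasRate_slow (by linarith [hx.2]) hC hC' (hγ1 h1) hpBA (by linarith),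
      h2.ae_not_summable (by linarith [hx.2]) hC hC' (hγ1 h1) hCA] with ω h3 h4 h0
    exact ⟨h4, h3 ((one_iff x ω).1 h0) h4⟩
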